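/- **Setting.** For $n\ge 0$ let $\mathfrak F_n$ be the set of convex $\varphi:\mathbb R^n\to\mathbb R$ with $\varphi(-x)=\varphi(x)$, $e^{-\varphi}\in L^1(\mathbb R^n)$, $\mathbb E\|X_\varphi\|_2^2<\infty$ and $\mathbb E\|\nabla\varphi(X_\varphi)\|_2^2<\infty$, where $X_\varphi$ is a random vector with density proportional to $e^{-\varphi}$. Let $\mathcal I_\varphi=\mathbb E[\nabla\varphi(X_\varphi)\nabla\varphi(X_\varphi)^T]$ and let $\|\cdot\|_2$ be the operator norm on matrices. For $v\in\mathbb R^n$ let $P^\varphi_v(x)=\varphi(x+v)-\varphi(x)-\frac12v^T\mathcal I_\varphi v$. Let $\sigma_n$ be the uniform probability measure on the unit sphere $S^{n-1}$ (zero if $n=0$), and let $\mathrm{KS}$ denote the $\ell_\infty$ distance of cumulative distribution functions. A sequence $(\psi_n)$ with $\psi_n\in\mathfrak F_n$ satisfies * (D1) if there are $a_n\to0$ with $\sigma_n\{v:\mathrm{KS}(P_v^{\psi_n}(X_{\psi_n}),v^T\nabla\psi_n(X_{\psi_n}))\le a_n\}\ge 1-a_n$ for all $n$; * (D2) if $\|\nabla\psi_n(X_{\psi_n})\|_2/\sqrt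 n\to1$ in probability as $n\to\infty$. For probability measures $P,Q$ and $\alpha\in[0,1]$ let $T[P,Q](\alpha)=\inf\{1-Q(A): A \text{ measurable},\ P(A)\le\alpha\}$, and let $G_\mu=T[N(0,1),N(\mu,1)]$. Two datasets $D,D'\in\mathcal X^k$ are neighbouring if they differ in exactly one entry. A query $f:\mathcal X^k\to\mathbb R^n$ has sensitivity $1$ if $\sup\|f(D)-f(D')\|_2=1$ over neighbouring $D,D'$. **Statement.** Let $\mu>0$ and let $\varphi_n\in\mathfrak F_n$ for every $n$; write $\mathcal I_n=\mathcal I_{\varphi_n}$ and $t_n=\mu^{-1}\sqrt{\|\mathcal I_n\|_2}$. Suppose that the sequence $\tilde\varphi_n(x)=\varphi_n(\|\mathcal I_n\|_2^{-1/2}x)$ satisfies (D1) and (D2), and that $\mathcal I_n=\|\mathcal I_n\|_2(1+o(1))I_{n\times n}$, that is, $\big\|\,\|\mathcal I_n\|_2^{-1}\mathcal I_n-I_{n\times n}\big\|_2\to0$. Then there are positive numbers $c_n\to0$ and measurable sets $E_n\subseteq S^{n-1}$ with $\sigma_n(E_n)>1-c_n$ such that the following holds for every $n$, every set $\mathcal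 X$, every $k$ and every query $f:\mathcal X^k\to\mathbb R^n$ of sensitivity $1$. Let $M$ be the mechanism $M(D)=f(D)+t_nX_{\varphi_n}$, and let $R$ be the set of pairs $(D,D')$ of neighbouring datasets with $\frac{f(D')-f(D)}{\|f(D')-f(D)\|_2}\in E_n$. 1. For all $(D,D')\in R$ and $\alpha\in[0,1]$, $\;T[M(D),M(D')](\alpha)\ge G_\mu(\alpha)-c_n$. 2. If moreover the sensitivity $1$ is already reached on the pairs under consideration, that is, $\sup_{(D,D')\in R}\|f(D)-f(D')\|_2=1$, then $$\Big\|\inf_{(D,D')\in R}T[M(D),M(D')]-G_\mu\Big\|_\infty\le c_n,$$ where the infimum is pointwise and the norm is the supremum over $\alpha\in[0,1]$. -/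

import Mathlib

open MeasureTheory ProbabilityTheory Filter Topology Matrix

namespace GDP

noncomputable section

/-- The Euclidean space of dimension `n`. -/
abbrev Vec (n : ℕ) : Type := EuclideanSpace ℝ (Fin n)

/-! ### Trade-off (ROC) functions -/

/-- The ROC (trade-off) function of the test `P` vs. `Q`: the least type II error `1 - Q A` among all
tests of level `α`. A test with values in `{0, 1}` is given by its (measurable) rejection region `A`. -/
def roc {Ω : Type*} [MeasurableSpace Ω] (P Q : Measure Ω) (α : ℝ) : ℝ :=
  sInf {β : ℝ | ∃ A : Set Ω, MeasurableSet A ∧ P.real A ≤ α ∧ β = 1 - Q.real A}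

/-- `G_μ = T[N(0,1), N(μ,1)]`. -/
def gaussianRoc (μ : ℝ) (α : ℝ) : ℝ :=
  roc (gaussianReal 0 1) (gaussianReal μ 1) α

/-! ### Log-concave noise and its Fisher information -/

/-- The law of `X_φ`: the probability measure with density proportional to `exp (-φ)`. -/
def noiseLaw {n : ℕ} (φ : Vec n → ℝ) : Measure (Vec n) :=
  (volume : Measure (Vec n)).tilted (fun x => -φ x)

/-- The class `𝔉_n` of even convex potentials `φ` with `exp (-φ)` integrable, `E‖X_φ‖² < ∞` and
`E‖∇φ(X_φ)‖² < ∞`. (A convex function is differentiable almost everywhere, so the value of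
`gradient φ` at the points where `φ` is not differentiable plays no role.) -/
def potentials (n : ℕ) : Set (Vec n → ℝ) :=
  {φ | ConvexOn ℝ Set.univ φ ∧ (∀ x, φ (-x) = φ x) ∧
    Integrable (fun x => Real.exp (-φ x)) ∧
    Integrable (fun x => ‖x‖ ^ 2) (noiseLaw φ) ∧
    Integrable (fun x => ‖gradient φ x‖ ^ 2) (noiseLaw φ)}

/-- The Fisher information matrix `E[∇φ(X_φ) ∇φ(X_φ)ᵀ]`. -/
def fisher {n : ℕ} (φ : Vec n → ℝ) : Matrix (Fin n) (Fin n) ℝ :=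
  Matrix.of fun i j => ∫ x, gradient φ x i * gradient φ x j ∂(noiseLaw φ)

/-- The operator norm of a matrix with respect to the Euclidean norm. -/
def opNorm {n : ℕ} (A : Matrix (Fin n) (Fin n) ℝ) : ℝ :=
  ‖Matrix.toEuclideanCLM (n := Fin n) (𝕜 := ℝ) A‖

/-- The rescaled potential `x ↦ φ(‖I_φ‖₂^{-1/2} x)`. -/
def rescaled {n : ℕ} (φ : Vec n → ℝ) : Vec n → ℝ :=
  fun x => φ ((Real.sqrt (opNorm (fisher φ)))⁻¹ • x)

/-- `I_n = ‖I_n‖₂ (1 + o(1)) I_{n×n}`, the error being measured in operator norm. -/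
def AsympIsotropic (φ : (n : ℕ) → Vec n → ℝ) : Prop :=
  Tendsto (fun n => opNorm ((opNorm (fisher (φ n)))⁻¹ • fisher (φ n) - 1)) atTop (𝓝 0)

/-! ### The technical conditions -/

/-- The uniform probability measure on the unit sphere, as a measure on the ambient space
(for `n = 0` the sphere is empty and this is the zero measure). -/
def sphereUnif (n : ℕ) : Measure (Vec n) :=
  (((volume : Measure (Vec n)).toSphere Set.univ)⁻¹ • (volume : Measure (Vec n)).toSphere).map
    Subtype.val

/-- The likelihood projection `P_v^φ(x) = φ(x + v) - φ(x) - ½ vᵀ I_φ v`. -/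
def likelihoodProj {n : ℕ} (φ : Vec n → ℝ) (v x : Vec n) : ℝ :=
  φ (x + v) - φ x - 1 / 2 * (v.ofLp ⬝ᵥ (fisher φ *ᵥ v.ofLp))

/-- The Kolmogorov-Smirnov distance of the random variables `f` and `g` under `P`. -/
def ksDist {Ω : Type*} [MeasurableSpace Ω] (P : Measure Ω) (f g : Ω → ℝ) : ℝ :=
  ⨆ s : ℝ, |P.real {x | f x ≤ s} - P.real {x | g x ≤ s}|

/-- `KS(P_v^{φ_n}(X_n), vᵀ∇φ_n(X_n)) = o(1)` with probability at least `1 - o(1)` over the uniform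
random unit vector `v`. -/
def CondD1 (φ : (n : ℕ) → Vec n → ℝ) : Prop :=
  ∃ a : ℕ → ℝ, Tendsto a atTop (𝓝 0) ∧ ∀ n, 1 - a n ≤ (sphereUnif n).real
    {v | ksDist (noiseLaw (φ n)) (likelihoodProj (φ n) v)
      (fun x => inner ℝ v (gradient (φ n) x)) ≤ a n}

/-- `‖∇φ_n(X_n)‖₂ = √n (1 + o_P(1))`. -/
def CondD2 (φ : (n : ℕ) → Vec n → ℝ) : Prop :=
  ∀ ε : ℝ, 0 < ε → Tendsto (fun n => (noiseLaw (φ n)).real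
    {x | ε ≤ |‖gradient (φ n) x‖ / Real.sqrt n - 1|}) atTop (𝓝 0)

/-! ### Queries and the noise-addition mechanism -/

/-- Two datasets of `k` individuals are neighbours if they differ in exactly one individual. -/
def Neighbors {𝒳 : Type*} {k : ℕ} (D D' : Fin k → 𝒳) : Prop :=
  ∃ i, D i ≠ D' i ∧ ∀ j, j ≠ i → D j = D' j

/-- All pairs of neighbouring datasets. -/
def neighborPairs (𝒳 : Type*) (k : ℕ) : Set ((Fin k → 𝒳) × (Fin k → 𝒳)) :=
  {p | Neighbors p.1 p.2}

/-- The pairs `(D, D')` of neighbouring datasets for which the direction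
`(f(D') - f(D)) / ‖f(D') - f(D)‖₂` belongs to `S`. -/
def pairsInDirections {𝒳 : Type*} {k n : ℕ} (f : (Fin k → 𝒳) → Vec n) (S : Set (Vec n)) :
    Set ((Fin k → 𝒳) × (Fin k → 𝒳)) :=
  {p | Neighbors p.1 p.2 ∧ ‖f p.2 - f p.1‖⁻¹ • (f p.2 - f p.1) ∈ S}

/-- The supremum of `‖f(D) - f(D')‖₂` over the pairs `(D, D')` in `R` is `1`. -/
def SensitivityOne {𝒳 : Type*} {k n : ℕ} (f : (Fin k → 𝒳) → Vec n)
    (R : Set ((Fin k → 𝒳) × (Fin k → 𝒳))) : Prop :=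
  IsLUB ((fun p => ‖f p.1 - f p.2‖) '' R) 1

/-- The scale `t = μ⁻¹ √‖I_φ‖₂`. -/
def noiseScale {n : ℕ} (μ : ℝ) (φ : Vec n → ℝ) : ℝ :=
  μ⁻¹ * Real.sqrt (opNorm (fisher φ))

/-- The law of the output `M(D) = f(D) + t X_φ` of the noise-addition mechanism. -/
def mechanism {𝒳 : Type*} {k n : ℕ} (f : (Fin k → 𝒳) → Vec n) (t : ℝ) (φ : Vec n → ℝ)
    (D : Fin k → 𝒳) : Measure (Vec n) :=
  (noiseLaw φ).map (fun x => f D + t • x)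

/-- The pointwise infimum over the pairs `(D, D')` in `R` of the ROC functions `T[M(D), M(D')]`. -/
def infRoc {𝒳 : Type*} {k n : ℕ} (M : (Fin k → 𝒳) → Measure (Vec n))
    (R : Set ((Fin k → 𝒳) × (Fin k → 𝒳))) (α : ℝ) : ℝ :=
  sInf ((fun p => roc (M p.1) (M p.2) α) '' R)

end

end GDP

/-!
For a unit vector `θ` the translate of the noise `X` by `μ θ` has log-likelihood ratio
`L(x) = ψ (x + μ θ) - ψ x`, where `ψ` is the rescaled potential. Once `L(X)` is uniformly close to
`N(μ²/2, μ²)` in distribution, the trade-off function of the two laws is close to the Gaussian one;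
convexity of `ψ` makes the likelihood-ratio regions increasing along `θ`, so that shorter translations
in the same direction are only harder to detect (`real_le_exp_mul_add`, `gaussianRoc_sub_le_roc`,
`exists_test_le`). Everything thus rests on a central limit theorem for `L` in most directions. The
hypotheses compare `L` with a linear statistic for translations of length one only, whereas `μ` is
arbitrary; other lengths, and the normality itself, are reached by a rigidity argument.

Let `V` be an independent Gaussian vector of covariance `(t/n) I`, let `P_τ` be the heat semigroup, let
`f` be the square root of the density of `X`, and let `κ(t) = ⟨f, P_{t/n} f⟩` be the Hellinger affinity
of `X` and `X + V` given `V`. Then `κ` loses in a time step `h` at most `(h/8) ρ(t)`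
(`heat_autocorrelation_sub_le`, `affinity_sub_le`), where `ρ ≤ κ` is the affinity weighted by the inner
product of the clipped normalized scores `∇ψ/√n` at the two ends. Hence `κ(t) ≥ exp(-t/8) - o(1)`. On
the other hand, the hypothesis on the Kolmogorov-Smirnov distance gives `κ(1) ≤ exp(-1/8) + o(1)`
(`eventually_affinity_one_le`): for unit vectors `L` is close to the linear statistic plus the constant
`1/2`, and the exponential moment of the latter, averaged over the directions, is Gaussian.
So the decay is extremal, which forces `κ - ρ → 0` for `t < 1`
(`eventually_sub_le_of_extremal_decay`): the scores at `X` and at `X + V` agree asymptotically.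

Contiguity of the noise and its translates propagates this stability to all `t > 0`
(`AsympRegular.stableScore_add`), and a Cameron-Martin shift together with convexity turns it into the
linearization `L_V = ⟪V, ∇ψ(X)⟫ + t/2 + o(1)` (`AsympRegular.linearIncr_of_stableScore`). For two
independent copies of the noise and the same `V` the linear statistics are jointly Gaussian given the
copies, with asymptotically orthonormal scores; hence the conditional distribution function of `L_V`
given `V` converges in mean square (`AsympRegular.tendsto_integral_sq_cdf_incr_sub`). Convexity along
rays transfers this from Gaussian vectors to uniform directions
(`AsympRegular.eventually_sphere_cdf_ge`, `AsympRegular.eventually_sphere_cdf_le`).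
-/

namespace GDP

noncomputable section

/-! ### Isotropic Gaussian vectors -/

/-- The centred Gaussian law on `ℝⁿ` with covariance matrix `τ I` (a point mass at `0` for `τ ≤ 0`). -/
def gaussVec (n : ℕ) (τ : ℝ) : Measure (Vec n) :=
  (stdGaussian (Vec n)).map (fun z => Real.sqrt τ • z)

instance isProbabilityMeasure_gaussVec (n : ℕ) (τ : ℝ) : IsProbabilityMeasure (gaussVec n τ) :=
  Measure.isProbabilityMeasure_map (by fun_prop)

lemma charFun_gaussVec {n : ℕ} {τ : ℝ} (hτ : 0 ≤ τ) (ξ : Vec n) :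
    charFun (gaussVec n τ) ξ = Complex.exp (-(τ * ‖ξ‖ ^ 2 / 2 : ℝ)) := by
  rw [gaussVec, charFun_map_smul, charFun_stdGaussian, norm_smul, Real.norm_eq_abs,
    abs_of_nonneg (Real.sqrt_nonneg _)]
  congr 1
  have : Real.sqrt τ ^ 2 = τ := Real.sq_sqrt hτ
  have h2 : (Real.sqrt τ * ‖ξ‖) ^ 2 = τ * ‖ξ‖ ^ 2 := by rw [mul_pow, this]
  rw [← Complex.ofReal_pow, h2]
  push_cast
  ring

lemma gaussVec_conv {n : ℕ} {τ η : ℝ} (hτ : 0 ≤ τ) (hη : 0 ≤ η) :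
    gaussVec n τ ∗ gaussVec n η = gaussVec n (τ + η) := by
  refine Measure.ext_of_charFun ?_
  ext ξ
  rw [charFun_conv, charFun_gaussVec hτ, charFun_gaussVec hη, charFun_gaussVec (by positivity),
    ← Complex.exp_add]
  congr 1
  push_cast
  ring

lemma gaussVec_add_eq_map {n : ℕ} {τ η : ℝ} (hτ : 0 ≤ τ) (hη : 0 ≤ η) :
    gaussVec n (τ + η) = ((gaussVec n τ).prod (gaussVec n η)).map (fun q => q.1 + q.2) := by
  rw [← gaussVec_conv hτ hη]; rfl

lemma gaussVec_map_neg {n : ℕ} {τ : ℝ} (hτ : 0 ≤ τ) :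
    (gaussVec n τ).map (fun v => -v) = gaussVec n τ := by
  have : IsProbabilityMeasure ((gaussVec n τ).map (fun v => -v)) :=
    Measure.isProbabilityMeasure_map (by fun_prop)
  refine Measure.ext_of_charFun ?_
  ext ξ
  have : (fun v : Vec n => -v) = fun v => (-1 : ℝ) • v := by ext; simp
  rw [this, charFun_map_smul, charFun_gaussVec hτ, charFun_gaussVec hτ]
  simp

lemma gaussVec_zero (n : ℕ) : gaussVec n 0 = Measure.dirac 0 := by
  simp [gaussVec]

lemma integrable_exp_neg_sq_norm {n : ℕ} {b : ℝ} (hb : 0 < b) :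
    Integrable (fun v : Vec n => Real.exp (-b * ‖v‖ ^ 2)) := by
  have h := GaussianFourier.integrable_cexp_neg_mul_sq_norm_add (V := Vec n) (b := (b : ℂ))
    (by simpa using hb) 0 0
  refine h.re.congr (Eventually.of_forall fun v => ?_)
  have : (-(b : ℂ) * (‖v‖ : ℂ) ^ 2 + 0 * ((inner ℝ (0 : Vec n) v : ℝ) : ℂ))
      = ((-b * ‖v‖ ^ 2 : ℝ) : ℂ) := by push_cast; ring
  simp only [this, ← Complex.ofReal_exp]
  rfl

/-- The Gaussian law of positive variance has the usual density. -/
lemma gaussVec_eq_tilted {n : ℕ} {τ : ℝ} (hτ : 0 < τ) :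
    gaussVec n τ = (volume : Measure (Vec n)).tilted (fun v => -(2 * τ)⁻¹ * ‖v‖ ^ 2) := by
  have hb : 0 < (2 * τ)⁻¹ := by positivity
  have : IsProbabilityMeasure
      ((volume : Measure (Vec n)).tilted (fun v => -(2 * τ)⁻¹ * ‖v‖ ^ 2)) :=
    isProbabilityMeasure_tilted (integrable_exp_neg_sq_norm hb)
  refine Measure.ext_of_charFun ?_
  ext ξ
  rw [charFun_gaussVec hτ.le, charFun_apply, integral_tilted]
  have hb' : 0 < (((2 * τ)⁻¹ : ℝ) : ℂ).re := by simpa using hτ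
  have h0 := GaussianFourier.integral_cexp_neg_mul_sq_norm (V := Vec n) hb'
  have h1 := GaussianFourier.integral_cexp_neg_mul_sq_norm_add (V := Vec n) hb' Complex.I ξ
  have h2 : ((∫ v : Vec n, Real.exp (-(2 * τ)⁻¹ * ‖v‖ ^ 2) : ℝ) : ℂ)
      = ∫ v : Vec n, Complex.exp (-(((2 * τ)⁻¹ : ℝ) : ℂ) * (‖v‖ : ℂ) ^ 2) := by
    rw [← integral_complex_ofReal]
    congr 1
    ext v
    push_cast
    rfl
  have hpos : (0 : ℝ) < ∫ v : Vec n, Real.exp (-(2 * τ)⁻¹ * ‖v‖ ^ 2) :=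
    integral_exp_pos (integrable_exp_neg_sq_norm hb)
  have hne : ((∫ v : Vec n, Real.exp (-(2 * τ)⁻¹ * ‖v‖ ^ 2) : ℝ) : ℂ) ≠ 0 := by
    exact_mod_cast hpos.ne'
  have h3 : ∀ v : Vec n, (Real.exp (-(2 * τ)⁻¹ * ‖v‖ ^ 2) /
      ∫ v : Vec n, Real.exp (-(2 * τ)⁻¹ * ‖v‖ ^ 2)) •
        Complex.exp ((inner ℝ v ξ : ℝ) * Complex.I)
      = Complex.exp (-(((2 * τ)⁻¹ : ℝ) : ℂ) * (‖v‖ : ℂ) ^ 2 + Complex.I * (inner ℝ ξ v : ℝ)) /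
        ((∫ v : Vec n, Real.exp (-(2 * τ)⁻¹ * ‖v‖ ^ 2) : ℝ) : ℂ) := by
    intro v
    rw [Complex.exp_add, real_inner_comm, Complex.real_smul, Complex.ofReal_div, Complex.ofReal_exp]
    push_cast
    rw [mul_comm Complex.I]
    ring
  simp_rw [h3]
  rw [integral_div, h1, h2, h0, mul_div_cancel_left₀]
  · congr 1
    push_cast
    rw [Complex.I_sq]
    field_simp
    ring
  · rw [← h0, ← h2]; exact hne

lemma gaussVec_absolutelyContinuous {n : ℕ} {τ : ℝ} (hτ : 0 < τ) :
    gaussVec n τ ≪ (volume : Measure (Vec n)) := by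
  rw [gaussVec_eq_tilted hτ]; exact tilted_absolutelyContinuous _ _

/-- Exponential tilting of a Gaussian law is a translation. -/
lemma integral_gaussVec_exp_inner_mul {n : ℕ} {τ : ℝ} (hτ : 0 < τ) (b : Vec n) (g : Vec n → ℝ) :
    ∫ v, Real.exp (inner ℝ b v) * g v ∂(gaussVec n τ)
      = Real.exp (τ * ‖b‖ ^ 2 / 2) * ∫ v, g (v + τ • b) ∂(gaussVec n τ) := by
  rw [gaussVec_eq_tilted hτ, integral_tilted, integral_tilted,
    ← integral_add_right_eq_self _ (τ • b), ← integral_const_mul]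
  congr 1
  ext v
  simp only [smul_eq_mul]
  have h : -(2 * τ)⁻¹ * ‖v + τ • b‖ ^ 2 + inner ℝ b (v + τ • b)
      = τ * ‖b‖ ^ 2 / 2 + -(2 * τ)⁻¹ * ‖v‖ ^ 2 := by
    rw [norm_add_sq_real, norm_smul, inner_smul_right, inner_add_right, inner_smul_right,
      real_inner_self_eq_norm_sq, real_inner_comm, mul_pow, Real.norm_eq_abs, sq_abs]
    field_simp
    ring
  have h' := congrArg Real.exp h
  rw [Real.exp_add, Real.exp_add] at h'
  linear_combination (g (v + τ • b) / ∫ (x : Vec n), Real.exp (-(2 * τ)⁻¹ * ‖x‖ ^ 2)) * h'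

lemma gaussVec_map_inner {n : ℕ} {τ : ℝ} (hτ : 0 ≤ τ) (a : Vec n) :
    (gaussVec n τ).map (fun v => inner ℝ v a) = gaussianReal 0 (τ * ‖a‖ ^ 2).toNNReal := by
  have : IsProbabilityMeasure ((gaussVec n τ).map (fun v => inner ℝ v a)) :=
    Measure.isProbabilityMeasure_map (by fun_prop)
  refine Measure.ext_of_charFun ?_
  ext s
  rw [charFun_gaussianReal, charFun_apply, integral_map (by fun_prop) (by fun_prop)]
  have : ∀ v : Vec n, (inner ℝ (inner ℝ v a : ℝ) s : ℝ) = inner ℝ v (s • a) := by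
    intro v; simp [inner_smul_right]
  simp_rw [this]
  rw [← charFun_apply, charFun_gaussVec hτ, norm_smul, Real.coe_toNNReal _ (by positivity)]
  congr 1
  have hs : ((|s| : ℝ) : ℂ) ^ 2 = (s : ℂ) ^ 2 := by rw [← Complex.ofReal_pow, sq_abs]; simp
  push_cast
  rw [Real.norm_eq_abs, mul_pow, hs]
  ring

lemma integrable_sq_inner_gaussVec {n : ℕ} {τ : ℝ} (hτ : 0 ≤ τ) (a : Vec n) :
    MemLp (fun v => inner ℝ v a) 2 (gaussVec n τ) := by
  have h : MemLp id 2 ((gaussVec n τ).map (fun v => inner ℝ v a)) := by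
    rw [gaussVec_map_inner hτ]; exact memLp_id_gaussianReal 2
  exact (memLp_map_measure_iff h.1 (by fun_prop)).1 h

lemma integral_sq_inner_gaussVec {n : ℕ} {τ : ℝ} (hτ : 0 ≤ τ) (a : Vec n) :
    ∫ v, (inner ℝ v a : ℝ) ^ 2 ∂(gaussVec n τ) = τ * ‖a‖ ^ 2 := by
  have h : ∫ v, (inner ℝ v a : ℝ) ^ 2 ∂(gaussVec n τ)
      = ∫ x, x ^ 2 ∂((gaussVec n τ).map (fun v => inner ℝ v a)) := by
    rw [integral_map (by fun_prop) (by fun_prop)]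
  rw [h, gaussVec_map_inner hτ]
  have h2 := variance_fun_id_gaussianReal (μ := 0) (v := (τ * ‖a‖ ^ 2).toNNReal)
  rw [variance_eq_integral (by fun_prop)] at h2
  simpa [integral_id_gaussianReal, Real.coe_toNNReal _ (show 0 ≤ τ * ‖a‖ ^ 2 by positivity)] using h2

/-- The covariance of a Gaussian vector, by polarization. -/
lemma integral_inner_mul_inner_gaussVec {n : ℕ} {τ : ℝ} (hτ : 0 ≤ τ) (a b : Vec n) :
    ∫ v, (inner ℝ v a : ℝ) * inner ℝ v b ∂(gaussVec n τ) = τ * inner ℝ a b := by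
  have hi : ∀ c : Vec n, Integrable (fun v => (inner ℝ v c : ℝ) ^ 2) (gaussVec n τ) := fun c =>
    (integrable_sq_inner_gaussVec hτ c).integrable_sq
  have h : ∀ v : Vec n, (inner ℝ v a : ℝ) * inner ℝ v b
      = ((inner ℝ v (a + b) : ℝ) ^ 2 - (inner ℝ v (a - b) : ℝ) ^ 2) / 4 := by
    intro v; rw [inner_add_right, inner_sub_right]; ring
  simp_rw [h]
  rw [integral_div, integral_sub (hi _) (hi _), integral_sq_inner_gaussVec hτ,
    integral_sq_inner_gaussVec hτ, norm_add_sq_real, norm_sub_sq_real]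
  ring

/-! ### The norm of a Gaussian vector -/

lemma integral_exp_neg_sq_norm_gaussVec {n : ℕ} {τ b : ℝ} (hτ : 0 < τ) (hb : 0 ≤ b) :
    ∫ v, Real.exp (-b * ‖v‖ ^ 2) ∂(gaussVec n τ) = (1 + 2 * τ * b) ^ (-(n / 2 : ℝ)) := by
  rw [gaussVec_eq_tilted hτ, integral_exp_tilted]
  have h1 : (0 : ℝ) < (2 * τ)⁻¹ := by positivity
  have h2 : ((fun v : Vec n => -(2 * τ)⁻¹ * ‖v‖ ^ 2) + fun v => -b * ‖v‖ ^ 2)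
      = fun v => -((2 * τ)⁻¹ + b) * ‖v‖ ^ 2 := by ext v; simp; ring
  rw [h2, GaussianFourier.integral_rexp_neg_mul_sq_norm h1,
    GaussianFourier.integral_rexp_neg_mul_sq_norm (by positivity), finrank_euclideanSpace_fin,
    ← Real.div_rpow (by positivity) (by positivity), Real.rpow_neg (by positivity),
    ← Real.inv_rpow (by positivity)]
  congr 1
  have : (0 : ℝ) < 1 + 2 * τ * b := by positivity
  field_simp

lemma tendsto_one_add_div_rpow_neg {ι : Type*} {l : Filter ι} {d : ι → ℕ}
    (hd : Tendsto d l atTop) {c : ℝ} (hc : 0 ≤ c) :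
    Tendsto (fun k => (1 + 2 * c / (d k : ℝ)) ^ (-(d k / 2 : ℝ))) l (𝓝 (Real.exp (-c))) := by
  have h := (Real.tendsto_one_add_div_pow_exp (2 * c)).comp hd
  have h2 := h.rpow_const (p := -(1 / 2 : ℝ)) (Or.inl (Real.exp_pos _).ne')
  rw [← Real.exp_mul] at h2
  have e : 2 * c * -(1 / 2) = -c := by ring
  rw [e] at h2
  refine h2.congr fun k => ?_
  simp only [Function.comp]
  rw [← Real.rpow_natCast, ← Real.rpow_mul (by positivity)]
  congr 1
  ring

/-- The squared norm of a Gaussian vector of covariance `(t / d) I` concentrates at `t` when the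
dimension `d` tends to infinity. -/
lemma tendsto_gaussVec_norm_sq {ι : Type*} {l : Filter ι} {d : ι → ℕ}
    (hd : Tendsto d l atTop) {t : ℝ} (ht : 0 < t) {ε : ℝ} (hε : 0 < ε) :
    Tendsto (fun k => (gaussVec (d k) (t / d k)).real {v | ε ≤ |‖v‖ ^ 2 - t|}) l (𝓝 0) := by
  set c : ℝ := Real.exp (-t) * (1 - Real.exp (-ε)) with hc
  have hcpos : 0 < c := mul_pos (Real.exp_pos _) (by simpa using hε)
  have hM : Tendsto (fun k => ∫ v, (Real.exp (-‖v‖ ^ 2) - Real.exp (-t)) ^ 2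
      ∂(gaussVec (d k) (t / d k))) l (𝓝 0) := by
    have e1 := tendsto_one_add_div_rpow_neg hd ht.le
    have e2 := tendsto_one_add_div_rpow_neg hd (c := 2 * t) (by positivity)
    have e3 := (e2.sub (e1.const_mul (2 * Real.exp (-t)))).add_const (Real.exp (-t) ^ 2)
    have z : Real.exp (-(2 * t)) - 2 * Real.exp (-t) * Real.exp (-t) + Real.exp (-t) ^ 2 = 0 := by
      rw [show -(2 * t) = -t + -t by ring, Real.exp_add]; ring
    rw [z] at e3
    refine e3.congr' ?_
    filter_upwards [hd.eventually_ge_atTop 1] with k hk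
    have hk0 : (0 : ℝ) < d k := by exact_mod_cast hk
    have hτ : 0 < t / d k := by positivity
    have i1 : ∀ b : ℝ, 0 ≤ b →
        Integrable (fun v : Vec (d k) => Real.exp (-b * ‖v‖ ^ 2)) (gaussVec (d k) (t / d k)) := by
      intro b hb
      refine Integrable.of_bound (C := 1) (by fun_prop) (Eventually.of_forall fun v => ?_)
      rw [Real.norm_eq_abs, abs_of_pos (Real.exp_pos _), Real.exp_le_one_iff]
      nlinarith [sq_nonneg ‖v‖]
    have hx : ∀ v : Vec (d k), (Real.exp (-‖v‖ ^ 2) - Real.exp (-t)) ^ 2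
        = Real.exp (-2 * ‖v‖ ^ 2) - 2 * Real.exp (-t) * Real.exp (-1 * ‖v‖ ^ 2)
          + Real.exp (-t) ^ 2 := by
      intro v
      have : Real.exp (-2 * ‖v‖ ^ 2) = Real.exp (-‖v‖ ^ 2) ^ 2 := by
        rw [← Real.exp_nat_mul]; congr 1; push_cast; ring
      rw [this]; simp only [neg_mul, one_mul]; ring
    have j2 := i1 2 (by norm_num)
    have j1 := (i1 1 (by norm_num)).const_mul (2 * Real.exp (-t))
    simp_rw [hx]
    rw [integral_add (f := fun v => Real.exp (-2 * ‖v‖ ^ 2) - 2 * Real.exp (-t) *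
      Real.exp (-1 * ‖v‖ ^ 2)) (j2.sub j1) (integrable_const _), integral_sub j2 j1,
      integral_const_mul, integral_exp_neg_sq_norm_gaussVec hτ (by norm_num),
      integral_exp_neg_sq_norm_gaussVec hτ (by norm_num)]
    simp only [integral_const, probReal_univ, one_smul]
    congr 3 <;> · field_simp
  have hM2 := hM.div_const (c ^ 2)
  rw [zero_div] at hM2
  refine squeeze_zero (fun k => measureReal_nonneg) (fun k => ?_) hM2
  rw [le_div_iff₀ (by positivity), mul_comm]
  have hint : Integrable (fun v : Vec (d k) => (Real.exp (-‖v‖ ^ 2) - Real.exp (-t)) ^ 2)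
      (gaussVec (d k) (t / d k)) := by
    refine Integrable.of_bound (C := 1) (by fun_prop) (Eventually.of_forall fun v => ?_)
    have a1 : Real.exp (-‖v‖ ^ 2) ≤ 1 := by
      rw [Real.exp_le_one_iff]; nlinarith [sq_nonneg ‖v‖]
    have a2 : Real.exp (-t) ≤ 1 := by rw [Real.exp_le_one_iff]; linarith
    have a3 := Real.exp_pos (-‖v‖ ^ 2)
    have a4 := Real.exp_pos (-t)
    rw [Real.norm_eq_abs, abs_of_nonneg (sq_nonneg _), sq_le_one_iff_abs_le_one, abs_le]
    constructor <;> linarith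
  refine le_trans ?_ (mul_meas_ge_le_integral_of_nonneg
    (Eventually.of_forall fun v => sq_nonneg _) hint (c ^ 2))
  refine mul_le_mul_of_nonneg_left ?_ (by positivity)
  refine measureReal_mono ?_
  intro v hv
  simp only [Set.mem_ofPred_eq] at hv ⊢
  rw [sq_le_sq, abs_of_pos hcpos]
  set x := ‖v‖ ^ 2
  have key : ∀ y : ℝ, Real.exp (-y) = Real.exp (-t) * Real.exp (-(y - t)) := by
    intro y; rw [← Real.exp_add]; congr 1; ring
  rw [key x, hc]
  rcases le_abs'.1 hv with h | h
  · refine le_trans ?_ (le_abs_self _)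
    have h1 : 1 + ε ≤ Real.exp (-(x - t)) :=
      le_trans (by linarith) (Real.add_one_le_exp _)
    have h2 : 1 - ε ≤ Real.exp (-ε) := by have := Real.add_one_le_exp (-ε); linarith
    nlinarith [Real.exp_pos (-t)]
  · refine le_trans ?_ (neg_le_abs _)
    have h1 : Real.exp (-(x - t)) ≤ Real.exp (-ε) := Real.exp_le_exp.2 (by linarith)
    nlinarith [Real.exp_pos (-t)]

/-! ### Directions of Gaussian vectors are uniform on the sphere -/

/-- The direction of a nondegenerate isotropic Gaussian vector is uniform on the unit sphere. -/
lemma gaussVec_map_direction {n : ℕ} (hn : 0 < n) {τ : ℝ} (hτ : 0 < τ) :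
    (gaussVec n τ).map (fun v => ‖v‖⁻¹ • v) = sphereUnif n := by
  have : Nonempty (Fin n) := ⟨⟨0, hn⟩⟩
  have : Nontrivial (Vec n) := inferInstance
  set μ : Measure (Vec n) := volume with hμ
  obtain ⟨I, hI⟩ : ∃ I : ℝ, I = ∫ v : Vec n, Real.exp (-(2 * τ)⁻¹ * ‖v‖ ^ 2) := ⟨_, rfl⟩
  set h : ℝ → ENNReal := fun r => ENNReal.ofReal (Real.exp (-(2 * τ)⁻¹ * r ^ 2) / I) with hh
  have hhm : Measurable h := by fun_prop
  have hdir : Measurable (fun v : Vec n => ‖v‖⁻¹ • v) := by fun_prop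
  -- Polar coordinates: the radial density factors out.
  set C : ENNReal := ∫⁻ r : Set.Ioi (0 : ℝ), h r ∂(Measure.volumeIoiPow (Module.finrank ℝ (Vec n) - 1))
    with hC
  have key : ∀ A : Set (Vec n), MeasurableSet A →
      (gaussVec n τ).map (fun v => ‖v‖⁻¹ • v) A = (μ.toSphere.map Subtype.val) A * C := by
    intro A hA
    rw [Measure.map_apply hdir hA, Measure.map_apply measurable_subtype_coe hA,
      gaussVec_eq_tilted hτ, tilted_apply' _ _ (hdir hA), ← hI]
    rw [← lintegral_indicator (hdir hA), ← restrict_compl_singleton (μ := volume) (0 : Vec n),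
      ← lintegral_subtype_comap (measurableSet_singleton _).compl]
    have e : ∀ x : ({0}ᶜ : Set (Vec n)),
        ((fun v : Vec n => ‖v‖⁻¹ • v) ⁻¹' A).indicator (fun a => ENNReal.ofReal
          (Real.exp (-(2 * τ)⁻¹ * ‖a‖ ^ 2) / I)) x.1
        = (fun q : Metric.sphere (0 : Vec n) 1 × Set.Ioi (0 : ℝ) =>
            (Subtype.val ⁻¹' A).indicator (fun _ => (1 : ENNReal)) q.1 * h q.2)
            (homeomorphUnitSphereProd (Vec n) x) := by
      intro x
      have e' : (homeomorphUnitSphereProd (Vec n) x).1 ∈ Subtype.val ⁻¹' A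
          ↔ x.1 ∈ (fun v : Vec n => ‖v‖⁻¹ • v) ⁻¹' A := by
        simp only [Set.mem_preimage, homeomorphUnitSphereProd_apply_fst_coe]
      by_cases hx : x.1 ∈ (fun v : Vec n => ‖v‖⁻¹ • v) ⁻¹' A
      · simp only [Set.indicator_of_mem hx, Set.indicator_of_mem (e'.2 hx), hh,
          homeomorphUnitSphereProd_apply_snd_coe, one_mul]
      · simp only [Set.indicator_of_notMem hx, Set.indicator_of_notMem (fun h => hx (e'.1 h)),
          zero_mul]
    rw [lintegral_congr e]
    rw [(μ.measurePreserving_homeomorphUnitSphereProd).lintegral_comp_emb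
      (Homeomorph.measurableEmbedding _) (fun q : Metric.sphere (0 : Vec n) 1 × Set.Ioi (0 : ℝ) =>
            (Subtype.val ⁻¹' A).indicator (fun _ => (1 : ENNReal)) q.1 * h q.2),
      lintegral_prod_mul (f := (Subtype.val ⁻¹' A).indicator (fun _ => (1 : ENNReal)))
        (g := fun r : Set.Ioi (0 : ℝ) => h r) ((measurable_const.indicator (measurable_subtype_coe hA)).aemeasurable)
        (hhm.comp measurable_subtype_coe).aemeasurable,
      lintegral_indicator (measurable_subtype_coe hA)]
    simp [hC]
  have : IsProbabilityMeasure ((gaussVec n τ).map (fun v => ‖v‖⁻¹ • v)) :=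
    Measure.isProbabilityMeasure_map hdir.aemeasurable
  have htot : μ.toSphere Set.univ * C = 1 := by
    have := key Set.univ MeasurableSet.univ
    rw [measure_univ, Measure.map_apply measurable_subtype_coe MeasurableSet.univ] at this
    simpa using this.symm
  have h0 : μ.toSphere Set.univ ≠ 0 := by
    intro h; rw [h, zero_mul] at htot; exact zero_ne_one htot
  have hCinv : C = (μ.toSphere Set.univ)⁻¹ :=
    ENNReal.eq_inv_of_mul_eq_one_left (by rw [mul_comm]; exact htot)
  ext A hA
  rw [key A hA, sphereUnif, Measure.map_smul, Measure.smul_apply, hCinv, smul_eq_mul, mul_comm]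

/-! ### Gaussian averages of autocorrelations -/

/-- A random translation independent of the point preserves Lebesgue measure. -/
lemma measurePreserving_add_shift {n : ℕ} {Q : Type*} [MeasurableSpace Q] (m : Measure Q)
    [IsProbabilityMeasure m] {s : Q → Vec n} (hs : Measurable s) :
    MeasurePreserving (fun z : Vec n × Q => z.1 + s z.2)
      ((volume : Measure (Vec n)).prod m) volume := by
  have hmeas : Measurable (fun z : Vec n × Q => z.1 + s z.2) := by fun_prop
  refine ⟨hmeas, ?_⟩
  ext A hA
  rw [Measure.map_apply hmeas hA, Measure.prod_apply_symm (hmeas hA)]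
  have : ∀ q : Q, volume ((fun x : Vec n => (x, q)) ⁻¹' ((fun z : Vec n × Q => z.1 + s z.2) ⁻¹' A))
      = volume A := by
    intro q
    exact measure_preimage_add_right volume (s q) A
  simp [this]

lemma memLp_add_shift {n : ℕ} {Q : Type*} [MeasurableSpace Q] (m : Measure Q)
    [IsProbabilityMeasure m] {s : Q → Vec n} (hs : Measurable s)
    {E : Type*} [NormedAddCommGroup E] {p : ENNReal} {g : Vec n → E} (hg : MemLp g p volume) :
    MemLp (fun z : Vec n × Q => g (z.1 + s z.2)) p ((volume : Measure (Vec n)).prod m) :=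
  hg.comp_measurePreserving (measurePreserving_add_shift m hs)

lemma integrable_mul_shift {n : ℕ} {Q : Type*} [MeasurableSpace Q] (m : Measure Q)
    [IsProbabilityMeasure m] {s s' : Q → Vec n} (hs : Measurable s) (hs' : Measurable s')
    {g h : Vec n → ℝ} (hg : MemLp g 2 volume) (hh : MemLp h 2 volume) :
    Integrable (fun z : Vec n × Q => g (z.1 + s z.2) * h (z.1 + s' z.2))
      ((volume : Measure (Vec n)).prod m) :=
  (memLp_add_shift m hs hg).integrable_mul (memLp_add_shift m hs' hh)

lemma memLp_add_right {n : ℕ} {E : Type*} [NormedAddCommGroup E] {g : Vec n → E} {p : ENNReal}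
    (hg : MemLp g p volume) (w : Vec n) : MemLp (fun x => g (x + w)) p volume :=
  hg.comp_measurePreserving (measurePreserving_add_right volume w)

lemma integrable_mul_add_right {n : ℕ} {g h : Vec n → ℝ} (hg : MemLp g 2 volume)
    (hh : MemLp h 2 volume) (w : Vec n) : Integrable (fun x => g x * h (x + w)) volume :=
  hg.integrable_mul (memLp_add_right hh w)

lemma integral_mul_shift_shift {n : ℕ} (g h : Vec n → ℝ) (a b : Vec n) :
    ∫ x, g (x + a) * h (x + b) = ∫ x, g x * h (x + (b - a)) := by
  rw [← integral_add_right_eq_self (fun x => g x * h (x + (b - a))) a]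
  congr 1
  ext x
  congr 2
  abel

/-- Correlations averaged over the heat kernel factor through the half-time heat kernel. -/
lemma integral_gaussVec_correlation {n : ℕ} {τ : ℝ} (hτ : 0 ≤ τ) {g h : Vec n → ℝ}
    (hg : MemLp g 2 volume) (hh : MemLp h 2 volume) :
    ∫ v, (∫ x, g x * h (x + v)) ∂(gaussVec n τ)
      = ∫ x, (∫ v, g (x + v) ∂(gaussVec n (τ / 2))) * ∫ v, h (x + v) ∂(gaussVec n (τ / 2)) := by
  set ν := gaussVec n (τ / 2) with hν
  have h2 : 0 ≤ τ / 2 := by linarith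
  have hsplit : gaussVec n τ = (ν.prod ν).map (fun q : Vec n × Vec n => q.2 - q.1) := by
    have e : (fun q : Vec n × Vec n => q.2 - q.1)
        = (fun q => q.1 + q.2) ∘ (Prod.map (fun v => -v) id) := by
      ext q : 1; simp [sub_eq_add_neg, add_comm]
    rw [e, ← Measure.map_map (by fun_prop) (by fun_prop),
      ← Measure.map_prod_map _ _ (by fun_prop) (by fun_prop), Measure.map_id, hν,
      gaussVec_map_neg h2, ← gaussVec_add_eq_map h2 h2]
    congr 1; ring
  have hint := integrable_mul_shift (ν.prod ν) measurable_fst measurable_snd hg hh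
  have hprob : IsProbabilityMeasure ((ν.prod ν).map (fun q : Vec n × Vec n => q.2 - q.1)) :=
    Measure.isProbabilityMeasure_map (by fun_prop)
  have hcorr : AEStronglyMeasurable (fun v => ∫ x, g x * h (x + v))
      ((ν.prod ν).map (fun q : Vec n × Vec n => q.2 - q.1)) := by
    have := (integrable_mul_shift ((ν.prod ν).map (fun q : Vec n × Vec n => q.2 - q.1)) (s := fun _ => 0)
      (s' := fun v => v) (by fun_prop) (by fun_prop) hg hh).integral_prod_right.1
    simpa using this
  rw [hsplit, integral_map (by fun_prop) hcorr]
  have e1 : ∀ x, (∫ v, g (x + v) ∂ν) * ∫ v, h (x + v) ∂ν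
      = ∫ q, g (x + q.1) * h (x + q.2) ∂(ν.prod ν) := fun x =>
    (integral_prod_mul (fun v => g (x + v)) (fun v => h (x + v))).symm
  simp_rw [e1]
  have sw : ∫ x, (∫ q, g (x + q.1) * h (x + q.2) ∂(ν.prod ν))
      = ∫ q, (∫ x, g (x + q.1) * h (x + q.2)) ∂(ν.prod ν) := integral_integral_swap hint
  rw [sw]
  simp_rw [integral_mul_shift_shift]

lemma memLp_gaussVec_average {n : ℕ} {τ : ℝ} {g : Vec n → ℝ} (hg : MemLp g 2 volume) :
    MemLp (fun x => ∫ v, g (x + v) ∂(gaussVec n τ)) 2 volume := by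
  set ν := gaussVec n τ
  have hint := integrable_mul_shift (ν.prod ν) measurable_fst measurable_snd hg hg
  have hi := hint.integral_prod_left
  have e1 : ∀ x, ∫ q, g (x + q.1) * g (x + q.2) ∂(ν.prod ν) = (∫ v, g (x + v) ∂ν) ^ 2 := by
    intro x
    rw [integral_prod_mul (fun v => g (x + v)) (fun v => g (x + v)), sq]
  have hm : AEStronglyMeasurable (fun x => ∫ v, g (x + v) ∂ν) volume :=
    (memLp_add_shift ν measurable_id hg).1.integral_prod_right'
  rw [memLp_two_iff_integrable_sq hm]
  exact hi.congr (Eventually.of_forall fun x => e1 x)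

/-- The heat-averaged autocorrelation of a square integrable function is largest at the origin. -/
lemma integral_gaussVec_correlation_le {n : ℕ} {τ : ℝ} (hτ : 0 ≤ τ) {g : Vec n → ℝ}
    (hg : MemLp g 2 volume) (w : Vec n) :
    ∫ v, (∫ x, g x * g (x + (w + v))) ∂(gaussVec n τ)
      ≤ ∫ v, (∫ x, g x * g (x + v)) ∂(gaussVec n τ) := by
  have e : ∀ v x : Vec n, g (x + (w + v)) = (fun y => g (y + w)) (x + v) := by
    intro v x; simp only; congr 1; abel
  simp_rw [e]
  rw [integral_gaussVec_correlation hτ hg (memLp_add_right hg w),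
    integral_gaussVec_correlation hτ hg hg]
  set G : Vec n → ℝ := fun x => ∫ v, g (x + v) ∂(gaussVec n (τ / 2)) with hG
  have hGm : MemLp G 2 volume := memLp_gaussVec_average hg
  have e2 : ∀ x, ∫ v, (fun y => g (y + w)) (x + v) ∂(gaussVec n (τ / 2)) = G (x + w) := by
    intro x; simp only [hG]; congr 1; ext v; congr 1; abel
  simp_rw [e2]
  have hs : ∫ x, G (x + w) * G (x + w) = ∫ x, G x * G x :=
    integral_add_right_eq_self (fun x => G x * G x) w
  have i1 : Integrable (fun x => G x * G x) := hGm.integrable_mul hGm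
  have i2 : Integrable (fun x => G (x + w) * G (x + w)) :=
    (memLp_add_right hGm w).integrable_mul (memLp_add_right hGm w)
  have hle : ∫ x, G x * G (x + w) ≤ ∫ x, (1 / 2) * (G x * G x + G (x + w) * G (x + w)) := by
    refine integral_mono (integrable_mul_add_right hGm hGm w) ?_ fun x => ?_
    · exact (i1.add i2).const_mul _
    · simp only; nlinarith [sq_nonneg (G x - G (x + w))]
  rw [integral_const_mul, integral_add i1 i2, hs] at hle
  linarith

/-- The heat-averaged correlation of increments `f (· + u) - f` is at most that of the directional
derivative `⟨u, F⟩`. -/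
lemma integral_gaussVec_increment_le {n : ℕ} {τ : ℝ} (hτ : 0 ≤ τ) {f : Vec n → ℝ}
    {g : Vec n → ℝ} (hg : MemLp g 2 volume) (u : Vec n)
    (hFTC : ∀ᵐ x, f (x + u) - f x = ∫ r in (0 : ℝ)..1, g (x + r • u)) :
    ∫ v, (∫ x, (f (x + u) - f x) * (f (x + v + u) - f (x + v))) ∂(gaussVec n τ)
      ≤ ∫ v, (∫ x, g x * g (x + v)) ∂(gaussVec n τ) := by
  set I : Measure ℝ := volume.restrict (Set.Ioc 0 1) with hI
  have hIp : IsProbabilityMeasure I := ⟨by simp [hI]⟩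
  set γ := gaussVec n τ
  have e1 : ∀ v : Vec n, ∫ x, (f (x + u) - f x) * (f (x + v + u) - f (x + v))
      = ∫ x, ∫ q, g (x + q.1 • u) * g (x + (v + q.2 • u)) ∂(I.prod I) := by
    intro v
    refine integral_congr_ae ?_
    have hFTC' : ∀ᵐ x, f (x + v + u) - f (x + v) = ∫ r in (0 : ℝ)..1, g (x + v + r • u) :=
      (measurePreserving_add_right volume v).quasiMeasurePreserving.ae hFTC
    filter_upwards [hFTC, hFTC'] with x h1 h2
    rw [h1, h2, intervalIntegral.integral_of_le zero_le_one,
      intervalIntegral.integral_of_le zero_le_one]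
    rw [← integral_prod_mul (fun r => g (x + r • u)) (fun r => g (x + v + r • u))]
    simp_rw [add_assoc]
    rfl
  simp_rw [e1]
  have hint : Integrable (fun z : Vec n × (Vec n × (ℝ × ℝ)) =>
      g (z.1 + z.2.2.1 • u) * g (z.1 + (z.2.1 + z.2.2.2 • u)))
      ((volume : Measure (Vec n)).prod (γ.prod (I.prod I))) :=
    integrable_mul_shift (γ.prod (I.prod I)) (s := fun q => q.2.1 • u)
      (s' := fun q => q.1 + q.2.2 • u) (by fun_prop) (by fun_prop) hg hg
  have hswap1 : ∀ v : Vec n, ∫ x, ∫ q, g (x + q.1 • u) * g (x + (v + q.2 • u)) ∂(I.prod I)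
      = ∫ q, (∫ x, g (x + q.1 • u) * g (x + (v + q.2 • u))) ∂(I.prod I) := by
    intro v
    refine integral_integral_swap ?_
    exact integrable_mul_shift (I.prod I) (s := fun q => q.1 • u)
      (s' := fun q => v + q.2 • u) (by fun_prop) (by fun_prop) hg hg
  simp_rw [hswap1]
  have hint2 : Integrable (fun p : Vec n × (ℝ × ℝ) =>
      ∫ x, g (x + p.2.1 • u) * g (x + (p.1 + p.2.2 • u))) (γ.prod (I.prod I)) :=
    hint.integral_prod_right
  rw [integral_integral_swap hint2]
  have hb : ∀ q : ℝ × ℝ, ∫ v, (∫ x, g (x + q.1 • u) * g (x + (v + q.2 • u))) ∂γ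
      ≤ ∫ v, (∫ x, g x * g (x + v)) ∂γ := by
    intro q
    refine le_trans (le_of_eq ?_) (integral_gaussVec_correlation_le hτ hg ((q.2 - q.1) • u))
    congr 1
    ext v
    rw [integral_mul_shift_shift]
    congr 1
    ext x
    congr 3
    rw [sub_smul]; abel
  refine le_trans (integral_mono hint2.integral_prod_right (integrable_const _) hb) ?_
  simp

lemma integrable_sq_norm_gaussVec {n : ℕ} (τ : ℝ) :
    Integrable (fun v => ‖v‖ ^ 2) (gaussVec n τ) := by
  have h0 : MemLp (fun z : Vec n => z) 2 (stdGaussian (Vec n)) := IsGaussian.memLp_two_id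
  have h : MemLp (fun z : Vec n => Real.sqrt τ • z) 2 (stdGaussian (Vec n)) :=
    h0.const_smul (Real.sqrt τ)
  rw [gaussVec, integrable_map_measure (by fun_prop) (by fun_prop)]
  exact h.integrable_norm_pow (by norm_num)

/-- Averaging the directional correlations over an independent Gaussian direction. -/
lemma integral_gaussVec_directional_correlation {n : ℕ} {τ η : ℝ} (hη : 0 ≤ η)
    {F : Vec n → Vec n} (hF : MemLp F 2 volume) :
    Integrable (fun u => ∫ v, (∫ x, (inner ℝ u (F x) : ℝ) * inner ℝ u (F (x + v)))
        ∂(gaussVec n τ)) (gaussVec n η) ∧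
    ∫ u, (∫ v, (∫ x, (inner ℝ u (F x) : ℝ) * inner ℝ u (F (x + v))) ∂(gaussVec n τ))
        ∂(gaussVec n η)
      = η * ∫ v, (∫ x, (inner ℝ (F x) (F (x + v)) : ℝ)) ∂(gaussVec n τ) := by
  set γ := gaussVec n τ
  set γ' := gaussVec n η
  set B : Vec n × Vec n → ℝ := fun p => ‖F (p.1)‖ * ‖F (p.1 + p.2)‖ with hB
  have hBint : Integrable B ((volume : Measure (Vec n)).prod γ) := by
    have := integrable_mul_shift γ (s := fun _ => 0) (s' := fun v => v) (by fun_prop) (by fun_prop)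
      hF.norm hF.norm
    simpa [hB] using this
  have hsq : Integrable (fun u : Vec n => ‖u‖ ^ 2) γ' := integrable_sq_norm_gaussVec η
  have hFm1 : AEStronglyMeasurable (fun p : Vec n × Vec n => F p.1)
      ((volume : Measure (Vec n)).prod γ) := by
    have := (memLp_add_shift γ (s := fun _ => 0) (by fun_prop) hF).1
    simpa using this
  have hFm2 : AEStronglyMeasurable (fun p : Vec n × Vec n => F (p.1 + p.2))
      ((volume : Measure (Vec n)).prod γ) :=
    (memLp_add_shift γ (s := fun v => v) (by fun_prop) hF).1
  have hint : Integrable (fun z : Vec n × (Vec n × Vec n) =>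
      (inner ℝ z.1 (F z.2.1) : ℝ) * inner ℝ z.1 (F (z.2.1 + z.2.2)))
      (γ'.prod ((volume : Measure (Vec n)).prod γ)) := by
    refine (hsq.mul_prod hBint).mono' ?_ (Eventually.of_forall fun z => ?_)
    · have hz : AEStronglyMeasurable (fun z : Vec n × (Vec n × Vec n) => z.1)
        (γ'.prod ((volume : Measure (Vec n)).prod γ)) := by fun_prop
      exact (hz.inner (𝕜 := ℝ) hFm1.comp_snd).mul (hz.inner (𝕜 := ℝ) hFm2.comp_snd)
    · rw [norm_mul]
      have a := abs_real_inner_le_norm z.1 (F z.2.1)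
      have b := abs_real_inner_le_norm z.1 (F (z.2.1 + z.2.2))
      calc ‖(inner ℝ z.1 (F z.2.1) : ℝ)‖ * ‖(inner ℝ z.1 (F (z.2.1 + z.2.2)) : ℝ)‖
          ≤ (‖z.1‖ * ‖F z.2.1‖) * (‖z.1‖ * ‖F (z.2.1 + z.2.2)‖) :=
            mul_le_mul a b (norm_nonneg _) (by positivity)
        _ = ‖z.1‖ ^ 2 * B z.2 := by simp only [hB]; ring
  have e : ∀ᵐ u ∂γ', ∫ v, (∫ x, (inner ℝ u (F x) : ℝ) * inner ℝ u (F (x + v))) ∂γ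
      = ∫ p, (inner ℝ u (F p.1) : ℝ) * inner ℝ u (F (p.1 + p.2))
          ∂((volume : Measure (Vec n)).prod γ) := by
    filter_upwards [hint.prod_right_ae] with u hu
    rw [integral_prod_symm _ hu]
  constructor
  · exact hint.integral_prod_left.congr (e.mono fun u hu => hu.symm)
  · have sw := integral_integral_swap (f := fun (u : Vec n) (p : Vec n × Vec n) =>
      (inner ℝ u (F p.1) : ℝ) * inner ℝ u (F (p.1 + p.2))) hint
    have e3 : ∀ p : Vec n × Vec n,
        ∫ u, (inner ℝ u (F p.1) : ℝ) * inner ℝ u (F (p.1 + p.2)) ∂γ'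
          = η * inner ℝ (F p.1) (F (p.1 + p.2)) := fun p =>
      integral_inner_mul_inner_gaussVec hη _ _
    rw [integral_congr_ae e, sw]
    simp_rw [e3]
    rw [integral_const_mul, integral_prod_symm]
    refine hBint.mono' (hFm1.inner (𝕜 := ℝ) hFm2) (Eventually.of_forall fun p => ?_)
    exact abs_real_inner_le_norm _ _

/-- One heat step decreases the averaged autocorrelation of `f` at most by the averaged correlation
of its gradient `F`: the integrated form of `∂_τ ⟨f, P_τ f⟩ = -½ ⟨∇f, P_τ ∇f⟩`, with the right
monotonicity. -/
lemma heat_autocorrelation_sub_le {n : ℕ} {τ η : ℝ} (hτ : 0 ≤ τ) (hη : 0 ≤ η) {f : Vec n → ℝ}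
    {F : Vec n → Vec n} (hf : MemLp f 2 volume) (hF : MemLp F 2 volume)
    (hFTC : ∀ u, ∀ᵐ x, f (x + u) - f x = ∫ r in (0 : ℝ)..1, (inner ℝ u (F (x + r • u)) : ℝ)) :
    (∫ v, (∫ x, f x * f (x + v)) ∂(gaussVec n τ)) -
        ∫ v, (∫ x, f x * f (x + v)) ∂(gaussVec n (τ + η))
      ≤ η / 2 * ∫ v, (∫ x, (inner ℝ (F x) (F (x + v)) : ℝ)) ∂(gaussVec n τ) := by
  set A : Vec n → ℝ := fun w => ∫ x, f x * f (x + w) with hA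
  have hff := hf.integrable_mul hf
  have hAb : ∀ w, ‖A w‖ ≤ ∫ x, f x * f x := by
    intro w
    have hs : ∫ x, f (x + w) * f (x + w) = ∫ x, f x * f x :=
      integral_add_right_eq_self (fun x => f x * f x) w
    have hffw := (memLp_add_right hf w).integrable_mul (memLp_add_right hf w)
    calc ‖A w‖ ≤ ∫ x, ‖f x * f (x + w)‖ := norm_integral_le_integral_norm _
      _ ≤ ∫ x, (1 / 2) * (f x * f x + f (x + w) * f (x + w)) := by
          refine integral_mono (integrable_mul_add_right hf hf w).norm
            ((hff.add hffw).const_mul _) fun x => ?_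
          simp only [Real.norm_eq_abs, abs_mul]
          nlinarith [sq_nonneg (|f x| - |f (x + w)|), abs_mul_abs_self (f x),
            abs_mul_abs_self (f (x + w))]
      _ = ∫ x, f x * f x := by
          rw [integral_const_mul]
          have : ∫ x, (f x * f x + f (x + w) * f (x + w)) = _ := integral_add hff hffw
          rw [this, hs]; ring
  have hAm : ∀ {Q : Type} [MeasurableSpace Q] (m : Measure Q) [IsProbabilityMeasure m]
      (s : Q → Vec n), Measurable s → Integrable (fun q => A (s q)) m := by
    intro Q _ m _ s hs
    have := (integrable_mul_shift m (s := fun _ => 0) (s' := s) (by fun_prop) hs hf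
      hf).integral_prod_right
    simpa [hA] using this
  set γ := gaussVec n τ with hγ
  set γ' := gaussVec n η with hγ'
  -- Correlations of increments are second differences of the autocorrelation `A`.
  have hN : ∀ u : Vec n, ∫ v, (∫ x, (f (x + u) - f x) * (f (x + v + u) - f (x + v))) ∂γ
      = ∫ v, (2 * A v - A (v + u) - A (v - u)) ∂γ := by
    intro u
    congr 1
    ext v
    have i1 : Integrable (fun x => f (x + u) * f (x + (v + u))) :=
      (memLp_add_right hf _).integrable_mul (memLp_add_right hf _)
    have i2 : Integrable (fun x => f (x + u) * f (x + v)) :=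
      (memLp_add_right hf _).integrable_mul (memLp_add_right hf _)
    have i3 : Integrable (fun x => f x * f (x + (v + u))) := integrable_mul_add_right hf hf _
    have i4 : Integrable (fun x => f x * f (x + v)) := integrable_mul_add_right hf hf _
    have e : ∀ x, (f (x + u) - f x) * (f (x + v + u) - f (x + v))
        = f (x + u) * f (x + (v + u)) - f (x + u) * f (x + v) - f x * f (x + (v + u))
          + f x * f (x + v) := by
      intro x; rw [add_assoc]; ring
    simp_rw [e]
    rw [integral_add (f := fun x => f (x + u) * f (x + (v + u)) - f (x + u) * f (x + v)
        - f x * f (x + (v + u))) ((i1.sub i2).sub i3) i4,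
      integral_sub (f := fun x => f (x + u) * f (x + (v + u)) - f (x + u) * f (x + v))
        (i1.sub i2) i3, integral_sub i1 i2,
      integral_mul_shift_shift, integral_mul_shift_shift]
    simp only [hA, add_sub_cancel_right]
    ring
  obtain ⟨hMi, hM⟩ := integral_gaussVec_directional_correlation (τ := τ) hη hF
  have hle : ∀ u : Vec n, ∫ v, (2 * A v - A (v + u) - A (v - u)) ∂γ
      ≤ ∫ v, (∫ x, (inner ℝ u (F x) : ℝ) * inner ℝ u (F (x + v))) ∂γ := by
    intro u
    rw [← hN u]
    exact integral_gaussVec_increment_le hτ (g := fun x => (inner ℝ u (F x) : ℝ))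
      (hF.const_inner u) u (hFTC u)
  have j1 : Integrable (fun p : Vec n × Vec n => 2 * A p.2) (γ'.prod γ) :=
    (hAm (γ'.prod γ) (fun p => p.2) (by fun_prop)).const_mul 2
  have j2 : Integrable (fun p : Vec n × Vec n => A (p.2 + p.1)) (γ'.prod γ) :=
    hAm (γ'.prod γ) (fun p => p.2 + p.1) (by fun_prop)
  have j3 : Integrable (fun p : Vec n × Vec n => A (p.2 - p.1)) (γ'.prod γ) :=
    hAm (γ'.prod γ) (fun p => p.2 - p.1) (by fun_prop)
  have hj : Integrable (fun p : Vec n × Vec n => 2 * A p.2 - A (p.2 + p.1) - A (p.2 - p.1))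
      (γ'.prod γ) := (j1.sub j2).sub j3
  have htot := integral_mono hj.integral_prod_left hMi hle
  rw [hM, ← integral_prod _ hj, integral_sub (f := fun p : Vec n × Vec n => 2 * A p.2 -
    A (p.2 + p.1)) (j1.sub j2) j3, integral_sub j1 j2, integral_const_mul] at htot
  have hAs : ∀ m : Measure (Vec n), [IsProbabilityMeasure m] → AEStronglyMeasurable A m :=
    fun m _ => (hAm m (fun v => v) measurable_id).1
  have k1 : ∫ p : Vec n × Vec n, A p.2 ∂(γ'.prod γ) = ∫ v, A v ∂γ := by
    have := integral_fun_snd (μ := γ') (ν := γ) A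
    simpa using this
  have k2 : ∫ p : Vec n × Vec n, A (p.2 + p.1) ∂(γ'.prod γ) = ∫ v, A v ∂(gaussVec n (τ + η)) := by
    rw [add_comm τ η, gaussVec_add_eq_map hη hτ, integral_map (by fun_prop)]
    · simp_rw [add_comm]; rfl
    · rw [← gaussVec_add_eq_map hη hτ]; exact hAs _
  have k3 : ∫ p : Vec n × Vec n, A (p.2 - p.1) ∂(γ'.prod γ) = ∫ v, A v ∂(gaussVec n (τ + η)) := by
    have e : (fun q : Vec n × Vec n => q.2 - q.1)
        = (fun q => q.1 + q.2) ∘ (Prod.map (fun v => -v) id) := by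
      ext q : 1; simp [sub_eq_add_neg, add_comm]
    have e2 : gaussVec n (τ + η) = (γ'.prod γ).map (fun q => q.2 - q.1) := by
      rw [e, ← Measure.map_map (by fun_prop) (by fun_prop),
        ← Measure.map_prod_map _ _ (by fun_prop) (by fun_prop), Measure.map_id, hγ',
        gaussVec_map_neg hη, ← gaussVec_add_eq_map hη hτ, add_comm]
    rw [e2, integral_map (by fun_prop)]
    rw [← e2]; exact hAs _
  rw [k1, k2, k3] at htot
  linarith

/-! ### Convex potentials -/

section Convex

variable {n : ℕ} {ψ : Vec n → ℝ}

lemma continuous_of_convexOn (hc : ConvexOn ℝ Set.univ ψ) : Continuous ψ :=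
  continuousOn_univ.1 (hc.continuousOn isOpen_univ)

lemma ae_differentiableAt_of_convexOn (hc : ConvexOn ℝ Set.univ ψ) :
    ∀ᵐ x, DifferentiableAt ℝ ψ x := by
  have hl : LocallyLipschitzOn Set.univ ψ := hc.locallyLipschitzOn isOpen_univ
  rw [ae_iff]
  refine measure_null_of_locally_null _ fun x _ => ?_
  obtain ⟨K, t, ht, hK⟩ := hl (Set.mem_univ x)
  rw [nhdsWithin_univ] at ht
  refine ⟨interior t ∩ {y | ¬ DifferentiableAt ℝ ψ y}, ?_, ?_⟩
  · rw [Set.inter_comm]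
    exact inter_mem_nhdsWithin _ (interior_mem_nhds.2 ht)
  · have h := (hK.mono interior_subset).ae_differentiableWithinAt_of_mem (μ := volume)
    rw [ae_iff] at h
    refine measure_mono_null ?_ h
    rintro y ⟨hy1, hy2⟩ hcon
    exact hy2 ((hcon hy1).differentiableAt (isOpen_interior.mem_nhds hy1))

lemma measurable_gradient : Measurable (gradient ψ) :=
  ((InnerProductSpace.toDual ℝ (Vec n)).symm.continuous.measurable).comp (measurable_fderiv ℝ ψ)

lemma hasDerivAt_line {x u : Vec n} {r : ℝ} (h : DifferentiableAt ℝ ψ (x + r • u)) :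
    HasDerivAt (fun s : ℝ => ψ (x + s • u)) (inner ℝ u (gradient ψ (x + r • u))) r := by
  have h1 : HasDerivAt (fun s : ℝ => x + s • u) u r := by
    simpa using ((hasDerivAt_id r).smul_const u).const_add x
  have h2 := h.hasFDerivAt.comp_hasDerivAt r h1
  rw [real_inner_comm, inner_gradient_left]
  exact h2

lemma convexOn_line (hc : ConvexOn ℝ Set.univ ψ) (x u : Vec n) :
    ConvexOn ℝ Set.univ (fun s : ℝ => ψ (x + s • u)) := by
  have := hc.comp_affineMap (AffineMap.lineMap x (x + u))
  rw [Set.preimage_univ] at this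
  have e : (fun s : ℝ => ψ (x + s • u)) = ψ ∘ AffineMap.lineMap x (x + u) := by
    ext s; simp [AffineMap.lineMap_apply, add_comm]
  rw [e]; exact this

/-- The subgradient inequality. -/
lemma inner_gradient_le_sub (hc : ConvexOn ℝ Set.univ ψ) {x : Vec n} (h : DifferentiableAt ℝ ψ x)
    (v : Vec n) : inner ℝ v (gradient ψ x) ≤ ψ (x + v) - ψ x := by
  have h0 : DifferentiableAt ℝ ψ (x + (0 : ℝ) • v) := by simpa using h
  have := (convexOn_line hc x v).le_slope_of_hasDerivAt (Set.mem_univ 0) (Set.mem_univ 1)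
    zero_lt_one (hasDerivAt_line h0)
  simpa [slope_def_field] using this

/-- Convexity along a ray: increments grow at least linearly. -/
lemma mul_increment_le (hc : ConvexOn ℝ Set.univ ψ) (x v : Vec n) {s : ℝ} (hs : 1 ≤ s) :
    s * (ψ (x + v) - ψ x) ≤ ψ (x + s • v) - ψ x := by
  have hs0 : 0 < s := by linarith
  have := hc.2 (Set.mem_univ x) (Set.mem_univ (x + s • v))
    (show 0 ≤ 1 - s⁻¹ by rw [sub_nonneg]; exact inv_le_one_of_one_le₀ hs)
    (show 0 ≤ s⁻¹ by positivity) (by ring)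
  have e : (1 - s⁻¹) • x + s⁻¹ • (x + s • v) = x + v := by
    rw [smul_add, smul_smul, inv_mul_cancel₀ hs0.ne', sub_smul, one_smul, one_smul]; abel
  rw [e, smul_eq_mul, smul_eq_mul] at this
  have h2 := mul_le_mul_of_nonneg_left this hs0.le
  have e2 : s * ((1 - s⁻¹) * ψ x + s⁻¹ * ψ (x + s • v)) = (s - 1) * ψ x + ψ (x + s • v) := by
    field_simp
  rw [e2] at h2
  linarith

/-- Convexity along a ray: shortened increments shrink at least linearly. -/
lemma increment_le_mul (hc : ConvexOn ℝ Set.univ ψ) (x v : Vec n) {s : ℝ} (hs : 0 ≤ s)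
    (hs1 : s ≤ 1) : ψ (x + s • v) - ψ x ≤ s * (ψ (x + v) - ψ x) := by
  have := hc.2 (Set.mem_univ x) (Set.mem_univ (x + v))
    (show 0 ≤ 1 - s by linarith) hs (by ring)
  have e : (1 - s) • x + s • (x + v) = x + s • v := by
    rw [smul_add, sub_smul, one_smul]; abel
  rw [e, smul_eq_mul, smul_eq_mul] at this
  linarith

/-- The normalized square root of the density `exp (-ψ)`. -/
def sqrtDensity (ψ : Vec n → ℝ) (x : Vec n) : ℝ :=
  (Real.sqrt (∫ x, Real.exp (-ψ x)))⁻¹ * Real.exp (-ψ x / 2)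

/-- The gradient of `sqrtDensity ψ`, at the points where `ψ` is differentiable. -/
def gradSqrtDensity (ψ : Vec n → ℝ) (x : Vec n) : Vec n :=
  (-(sqrtDensity ψ x / 2)) • gradient ψ x

/-- The fundamental theorem of calculus for `sqrtDensity ψ` along almost every parallel segment. -/
lemma sqrtDensity_add_sub (hc : ConvexOn ℝ Set.univ ψ) (u : Vec n) :
    ∀ᵐ x, sqrtDensity ψ (x + u) - sqrtDensity ψ x
      = ∫ r in (0 : ℝ)..1, (inner ℝ u (gradSqrtDensity ψ (x + r • u)) : ℝ) := by
  have hD : ∀ᵐ z ∂((volume : Measure (Vec n)).prod (volume.restrict (Set.Ioc (0 : ℝ) 1))),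
      DifferentiableAt ℝ ψ (z.1 + z.2 • u) := by
    have hp : IsProbabilityMeasure (volume.restrict (Set.Ioc (0 : ℝ) 1)) := ⟨by simp⟩
    exact (measurePreserving_add_shift (volume.restrict (Set.Ioc (0 : ℝ) 1))
      (s := fun r => r • u) (by fun_prop)).quasiMeasurePreserving.ae
      (ae_differentiableAt_of_convexOn hc)
  filter_upwards [Measure.ae_ae_of_ae_prod hD] with x hx
  set g : ℝ → ℝ := fun s => ψ (x + s • u) with hg
  have hgc : ConvexOn ℝ Set.univ g := convexOn_line hc x u
  have hgcont : Continuous g := (continuous_of_convexOn hc).comp (by fun_prop)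
  set c := (Real.sqrt (∫ x, Real.exp (-ψ x)))⁻¹
  set D : ℝ → ℝ := fun s => derivWithin g (Set.Ioi s) s with hDdef
  have hDmono : Monotone D := by
    have := hgc.monotoneOn_rightDeriv
    rw [interior_univ] at this
    exact monotoneOn_univ.1 this
  have hder : ∀ s, HasDerivWithinAt (fun s => sqrtDensity ψ (x + s • u))
      (c * (Real.exp (-g s / 2) * (-D s / 2))) (Set.Ioi s) s := by
    intro s
    have h1 : HasDerivWithinAt g (D s) (Set.Ioi s) s :=
      hgc.hasDerivWithinAt_rightDeriv_of_mem_interior (by simp)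
    exact (((h1.neg).div_const 2).exp).const_mul c
  have hii : IntervalIntegrable (fun s => c * (Real.exp (-g s / 2) * (-D s / 2))) volume 0 1 := by
    have h1 : IntervalIntegrable D volume 0 1 := (hDmono.monotoneOn _).intervalIntegrable
    have h2 := (h1.neg.div_const 2).continuousOn_mul (g := fun s => Real.exp (-g s / 2))
      (by fun_prop)
    exact h2.const_mul c
  have hF := intervalIntegral.integral_eq_sub_of_hasDeriv_right
    (f := fun s => sqrtDensity ψ (x + s • u)) (a := 0) (b := 1)
    (by
      have : Continuous (fun s : ℝ => sqrtDensity ψ (x + s • u)) := by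
        unfold sqrtDensity
        exact continuous_const.mul (Real.continuous_exp.comp ((hgcont.neg).div_const 2))
      exact this.continuousOn) (fun s _ => hder s) hii
  simp only [one_smul, zero_smul, add_zero] at hF
  rw [← hF, intervalIntegral.integral_of_le zero_le_one, intervalIntegral.integral_of_le zero_le_one]
  refine integral_congr_ae ?_
  filter_upwards [hx] with r hr
  have h1 : HasDerivWithinAt g (D r) (Set.Ioi r) r :=
    hgc.hasDerivWithinAt_rightDeriv_of_mem_interior (by simp)
  have h2 : HasDerivWithinAt g (inner ℝ u (gradient ψ (x + r • u))) (Set.Ioi r) r :=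
    (hasDerivAt_line hr).hasDerivWithinAt
  have h3 : D r = inner ℝ u (gradient ψ (x + r • u)) :=
    (uniqueDiffWithinAt_Ioi r).eq_deriv _ h1 h2
  rw [gradSqrtDensity, inner_smul_right, ← h3]
  simp only [sqrtDensity, hg]
  ring

end Convex

/-! ### The noise law -/

section NoiseLaw

variable {n : ℕ} {ψ : Vec n → ℝ}

lemma isProbabilityMeasure_noiseLaw (hψ : ψ ∈ potentials n) : IsProbabilityMeasure (noiseLaw ψ) :=
  isProbabilityMeasure_tilted hψ.2.2.1

lemma continuous_potential (hψ : ψ ∈ potentials n) : Continuous ψ := continuous_of_convexOn hψ.1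

lemma continuous_sqrtDensity (hψ : ψ ∈ potentials n) : Continuous (sqrtDensity ψ) := by
  have := continuous_potential hψ
  unfold sqrtDensity
  fun_prop

lemma sq_sqrtDensity (hψ : ψ ∈ potentials n) (x : Vec n) :
    sqrtDensity ψ x ^ 2 = Real.exp (-ψ x) / ∫ x, Real.exp (-ψ x) := by
  have hZ : 0 < ∫ x, Real.exp (-ψ x) := integral_exp_pos hψ.2.2.1
  rw [sqrtDensity, mul_pow, inv_pow, Real.sq_sqrt hZ.le, ← Real.exp_nat_mul]
  have e : ((2 : ℕ) : ℝ) * (-ψ x / 2) = -ψ x := by push_cast; ring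
  rw [e, div_eq_inv_mul]

lemma sqrtDensity_add (v x : Vec n) :
    sqrtDensity ψ (x + v) = sqrtDensity ψ x * Real.exp (-(ψ (x + v) - ψ x) / 2) := by
  rw [sqrtDensity, sqrtDensity, mul_assoc, ← Real.exp_add]
  congr 2; ring

lemma integral_noiseLaw (hψ : ψ ∈ potentials n) {E : Type*} [NormedAddCommGroup E]
    [NormedSpace ℝ E] (g : Vec n → E) :
    ∫ x, g x ∂(noiseLaw ψ) = ∫ x, (sqrtDensity ψ x ^ 2) • g x := by
  rw [noiseLaw, integral_tilted]
  simp_rw [sq_sqrtDensity hψ]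

lemma integrable_noiseLaw_iff (hψ : ψ ∈ potentials n) {E : Type*} [NormedAddCommGroup E]
    [NormedSpace ℝ E] (g : Vec n → E) :
    Integrable g (noiseLaw ψ) ↔ Integrable (fun x => (sqrtDensity ψ x ^ 2) • g x) := by
  have hZ : 0 < ∫ x, Real.exp (-ψ x) := integral_exp_pos hψ.2.2.1
  rw [noiseLaw, integrable_tilted_iff hψ.2.2.1]
  simp_rw [sq_sqrtDensity hψ, div_eq_inv_mul, mul_smul]
  rw [integrable_fun_smul_iff (inv_ne_zero hZ.ne')]

lemma integrable_sq_sqrtDensity (hψ : ψ ∈ potentials n) :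
    Integrable (fun x => sqrtDensity ψ x ^ 2) := by
  simp_rw [sq_sqrtDensity hψ]
  exact hψ.2.2.1.div_const _

lemma memLp_sqrtDensity (hψ : ψ ∈ potentials n) : MemLp (sqrtDensity ψ) 2 volume :=
  (memLp_two_iff_integrable_sq (continuous_sqrtDensity hψ).aestronglyMeasurable).2
    (integrable_sq_sqrtDensity hψ)

lemma memLp_sqrtDensity_smul (hψ : ψ ∈ potentials n) {g : Vec n → Vec n} (hgm : Measurable g)
    (hg : Integrable (fun x => ‖g x‖ ^ 2) (noiseLaw ψ)) :
    MemLp (fun x => sqrtDensity ψ x • g x) 2 volume := by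
  have hm : AEStronglyMeasurable (fun x => sqrtDensity ψ x • g x) volume :=
    ((continuous_sqrtDensity hψ).measurable.smul hgm).aestronglyMeasurable
  rw [memLp_two_iff_integrable_sq_norm hm]
  refine ((integrable_noiseLaw_iff hψ _).1 hg).congr (Eventually.of_forall fun x => ?_)
  simp only [norm_smul, mul_pow, smul_eq_mul, Real.norm_eq_abs, sq_abs]

lemma memLp_gradSqrtDensity (hψ : ψ ∈ potentials n) : MemLp (gradSqrtDensity ψ) 2 volume := by
  have := (memLp_sqrtDensity_smul hψ measurable_gradient hψ.2.2.2.2).const_smul (-(1 / 2 : ℝ))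
  refine this.ae_eq (Eventually.of_forall fun x => ?_)
  simp only [gradSqrtDensity, smul_smul, Pi.smul_apply]
  congr 1; ring

/-- The likelihood ratio of a translate has mean one. -/
lemma integrable_exp_neg_increment (hψ : ψ ∈ potentials n) (v : Vec n) :
    Integrable (fun x => Real.exp (-(ψ (x + v) - ψ x))) (noiseLaw ψ) ∧
    ∫ x, Real.exp (-(ψ (x + v) - ψ x)) ∂(noiseLaw ψ) = 1 := by
  have e : ∀ x, sqrtDensity ψ x ^ 2 • Real.exp (-(ψ (x + v) - ψ x)) = sqrtDensity ψ (x + v) ^ 2 := by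
    intro x
    rw [sqrtDensity_add v x, mul_pow, ← Real.exp_nat_mul, smul_eq_mul]
    congr 2; push_cast; ring
  constructor
  · rw [integrable_noiseLaw_iff hψ]
    simp_rw [e]
    exact (integrable_sq_sqrtDensity hψ).comp_add_right v
  · rw [integral_noiseLaw hψ]
    simp_rw [e]
    rw [integral_add_right_eq_self (fun x => sqrtDensity ψ x ^ 2) v]
    have := isProbabilityMeasure_noiseLaw hψ
    have h := integral_noiseLaw hψ (fun _ => (1 : ℝ))
    simpa using h.symm

/-- Contiguity: a translate of the noise charges a set `B` at most `exp K` times as much as the noise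
does, up to the event that the log-likelihood ratio exceeds `K`. -/
lemma noiseLaw_real_translate_le (hψ : ψ ∈ potentials n) (v : Vec n) {B : Set (Vec n)}
    (hB : MeasurableSet B) (K : ℝ) :
    (noiseLaw ψ).real {x | x + v ∈ B}
      ≤ Real.exp K * (noiseLaw ψ).real B + (noiseLaw ψ).real {x | K < ψ (x + v) - ψ x} := by
  have := isProbabilityMeasure_noiseLaw hψ
  have hcont := continuous_potential hψ
  have hmL : Measurable (fun x => ψ (x + v) - ψ x) := by fun_prop
  have hBv : MeasurableSet {x | x + v ∈ B} := (measurable_add_const v) hB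
  have h1 : (noiseLaw ψ).real {x | x + v ∈ B}
      ≤ (noiseLaw ψ).real ({x | x + v ∈ B} ∩ {x | ψ (x + v) - ψ x ≤ K})
        + (noiseLaw ψ).real {x | K < ψ (x + v) - ψ x} := by
    refine le_trans (measureReal_mono ?_) (measureReal_union_le _ _)
    intro x hx
    by_cases h : ψ (x + v) - ψ x ≤ K
    · exact Or.inl ⟨hx, h⟩
    · exact Or.inr (not_le.1 h)
  refine h1.trans (add_le_add_left ?_ _)
  have hS : MeasurableSet ({x | x + v ∈ B} ∩ {x | ψ (x + v) - ψ x ≤ K}) :=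
    hBv.inter (measurableSet_le hmL measurable_const)
  rw [← integral_indicator_one hS, ← integral_indicator_one hB, integral_noiseLaw hψ,
    integral_noiseLaw hψ, ← integral_const_mul,
    ← integral_add_right_eq_self (fun x => Real.exp K * (sqrtDensity ψ x ^ 2 •
      B.indicator (1 : Vec n → ℝ) x)) v]
  have hiB : Integrable (fun x => Real.exp K * (sqrtDensity ψ x ^ 2 •
      B.indicator (1 : Vec n → ℝ) x)) := by
    refine Integrable.const_mul ?_ _
    have := (integrable_sq_sqrtDensity hψ).indicator hB
    refine this.congr (Eventually.of_forall fun x => ?_)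
    by_cases hx : x ∈ B <;> simp [hx]
  have hiS : Integrable (fun x => sqrtDensity ψ x ^ 2 •
      ({x | x + v ∈ B} ∩ {x | ψ (x + v) - ψ x ≤ K}).indicator (1 : Vec n → ℝ) x) := by
    have := (integrable_sq_sqrtDensity hψ).indicator hS
    refine this.congr (Eventually.of_forall fun x => ?_)
    by_cases hx : x ∈ {x | x + v ∈ B} ∩ {x | ψ (x + v) - ψ x ≤ K}
    · simp only [Set.indicator_of_mem hx]; simp
    · simp only [Set.indicator_of_notMem hx]; simp
  refine integral_mono hiS (hiB.comp_add_right v) fun x => ?_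
  by_cases hx : x ∈ {x | x + v ∈ B} ∩ {x | ψ (x + v) - ψ x ≤ K}
  · have hx1 : x + v ∈ B := hx.1
    have hx2 : ψ (x + v) - ψ x ≤ K := hx.2
    simp only [Set.indicator_of_mem hx, Set.indicator_of_mem hx1, Pi.one_apply, smul_eq_mul,
      mul_one]
    rw [sqrtDensity_add v x, mul_pow, ← Real.exp_nat_mul]
    have : 1 ≤ Real.exp K * Real.exp ((2 : ℕ) * (-(ψ (x + v) - ψ x) / 2)) := by
      rw [← Real.exp_add]
      apply Real.one_le_exp
      push_cast; linarith
    nlinarith [sq_nonneg (sqrtDensity ψ x)]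
  · simp only [Set.indicator_of_notMem hx, smul_zero]
    have : 0 ≤ B.indicator (1 : Vec n → ℝ) (x + v) := Set.indicator_nonneg (by simp) _
    positivity

end NoiseLaw

/-! ### Auxiliary facts on integrals and product measures -/

lemma integral_mul_le_sqrt_mul_sqrt {Ω : Type*} [MeasurableSpace Ω] {m : Measure Ω} {a b : Ω → ℝ}
    (ha : MemLp a 2 m) (hb : MemLp b 2 m) :
    ∫ x, a x * b x ∂m ≤ Real.sqrt (∫ x, a x ^ 2 ∂m) * Real.sqrt (∫ x, b x ^ 2 ∂m) := by
  have h := integral_mul_norm_le_Lp_mul_Lq (μ := m) (f := a) (g := b) (p := 2) (q := 2)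
    (Real.HolderConjugate.two_two) (by simpa using ha) (by simpa using hb)
  have h0 : ∫ x, a x * b x ∂m ≤ ∫ x, ‖a x‖ * ‖b x‖ ∂m := by
    refine integral_mono (ha.integrable_mul hb) (ha.norm.integrable_mul hb.norm) fun x => ?_
    simp only [Real.norm_eq_abs, ← abs_mul]
    exact le_abs_self _
  refine h0.trans (h.trans (le_of_eq ?_))
  simp only [Real.norm_eq_abs, Real.rpow_two, sq_abs, Real.sqrt_eq_rpow]

lemma prod_real_eq_integral_symm {X Y : Type*} [MeasurableSpace X] [MeasurableSpace Y]
    (m : Measure X) (m' : Measure Y) [IsProbabilityMeasure m] [IsProbabilityMeasure m']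
    {S : Set (X × Y)} (hS : MeasurableSet S) :
    (m.prod m').real S = ∫ y, m.real {x | (x, y) ∈ S} ∂m' := by
  rw [measureReal_def, Measure.prod_apply_symm hS, ← integral_toReal]
  · rfl
  · exact (measurable_measure_prodMk_right hS).aemeasurable
  · exact Eventually.of_forall fun y => measure_lt_top _ _

lemma measurable_measureReal_section {X Y : Type*} [MeasurableSpace X] [MeasurableSpace Y]
    (m : Measure X) [IsProbabilityMeasure m] {S : Set (X × Y)} (hS : MeasurableSet S) :
    Measurable (fun y => m.real {x | (x, y) ∈ S}) :=
  (measurable_measure_prodMk_right hS).ennreal_toReal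

/-- Markov's inequality for the square. -/
lemma measureReal_le_integral_sq_div {Ω : Type*} [MeasurableSpace Ω] {m : Measure Ω}
    {a : Ω → ℝ} (ha : Integrable (fun x => a x ^ 2) m) {c : ℝ} (hc : 0 < c) :
    m.real {x | c ≤ |a x|} ≤ (∫ x, a x ^ 2 ∂m) / c ^ 2 := by
  rw [le_div_iff₀ (by positivity), mul_comm]
  refine le_trans (le_of_eq ?_) (mul_meas_ge_le_integral_of_nonneg
    (Eventually.of_forall fun x => sq_nonneg (a x)) ha (c ^ 2))
  congr 2
  ext x
  simp only [Set.mem_ofPred_eq]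
  rw [sq_le_sq, abs_of_pos hc]

/-! ### The Fisher information as a quadratic form -/

section Fisher

variable {n : ℕ} {ψ : Vec n → ℝ}

lemma memLp_gradient (hψ : ψ ∈ potentials n) : MemLp (gradient ψ) 2 (noiseLaw ψ) :=
  (memLp_two_iff_integrable_sq_norm measurable_gradient.aestronglyMeasurable).2 hψ.2.2.2.2

lemma memLp_inner_gradient (hψ : ψ ∈ potentials n) (v : Vec n) :
    MemLp (fun x => (inner ℝ v (gradient ψ x) : ℝ)) 2 (noiseLaw ψ) :=
  (memLp_gradient hψ).const_inner v

lemma memLp_gradient_apply (hψ : ψ ∈ potentials n) (i : Fin n) :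
    MemLp (fun x => gradient ψ x i) 2 (noiseLaw ψ) := by
  have := memLp_inner_gradient hψ (EuclideanSpace.single i (1 : ℝ))
  simpa only [EuclideanSpace.inner_single_left, map_one, one_mul] using this

lemma integral_sq_inner_gradient (hψ : ψ ∈ potentials n) (v : Vec n) :
    ∫ x, (inner ℝ v (gradient ψ x) : ℝ) ^ 2 ∂(noiseLaw ψ)
      = v.ofLp ⬝ᵥ (fisher ψ *ᵥ v.ofLp) := by
  have hij : ∀ i j, Integrable (fun x => v i * (v j * (gradient ψ x i * gradient ψ x j)))
      (noiseLaw ψ) := fun i j =>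
    (((memLp_gradient_apply hψ i).integrable_mul (memLp_gradient_apply hψ j)).const_mul _).const_mul _
  have e : ∀ x, (inner ℝ v (gradient ψ x) : ℝ) ^ 2
      = ∑ i, ∑ j, v i * (v j * (gradient ψ x i * gradient ψ x j)) := by
    intro x
    rw [sq, PiLp.inner_apply, Finset.sum_mul_sum]
    refine Finset.sum_congr rfl fun i _ => Finset.sum_congr rfl fun j _ => ?_
    simp only [RCLike.inner_apply, conj_trivial]
    ring
  simp_rw [e]
  rw [integral_finsetSum _ fun i _ => integrable_finsetSum _ fun j _ => hij i j]
  simp only [dotProduct, mulVec, Finset.mul_sum]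
  refine Finset.sum_congr rfl fun i _ => ?_
  rw [integral_finsetSum _ fun j _ => hij i j]
  refine Finset.sum_congr rfl fun j _ => ?_
  rw [integral_const_mul, integral_const_mul, fisher, Matrix.of_apply]
  ring

lemma abs_fisher_quadratic_sub_le (v : Vec n) :
    |v.ofLp ⬝ᵥ (fisher ψ *ᵥ v.ofLp) - ‖v‖ ^ 2| ≤ opNorm (fisher ψ - 1) * ‖v‖ ^ 2 := by
  have h1 : v.ofLp ⬝ᵥ (fisher ψ *ᵥ v.ofLp) - ‖v‖ ^ 2
      = inner ℝ v (Matrix.toEuclideanCLM (n := Fin n) (𝕜 := ℝ) (fisher ψ - 1) v) := by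
    rw [EuclideanSpace.inner_eq_star_dotProduct, Matrix.ofLp_toEuclideanCLM, star_trivial,
      Matrix.sub_mulVec, Matrix.one_mulVec, sub_dotProduct, dotProduct_comm,
      EuclideanSpace.real_norm_sq_eq]
    congr 1
    simp [dotProduct, sq]
  rw [h1]
  calc _ ≤ ‖v‖ * ‖Matrix.toEuclideanCLM (n := Fin n) (𝕜 := ℝ) (fisher ψ - 1) v‖ :=
        abs_real_inner_le_norm _ _
    _ ≤ ‖v‖ * (opNorm (fisher ψ - 1) * ‖v‖) :=
        mul_le_mul_of_nonneg_left (ContinuousLinearMap.le_opNorm _ _) (norm_nonneg _)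
    _ = _ := by ring

/-- The gradient of the potential, normalized by the square root of the dimension. -/
def score (ψ : Vec n → ℝ) (x : Vec n) : Vec n := (Real.sqrt n)⁻¹ • gradient ψ x

lemma measurable_score : Measurable (score ψ) := measurable_gradient.const_smul (Real.sqrt n)⁻¹

lemma gradient_eq_smul_score (hn : 0 < n) (x : Vec n) :
    gradient ψ x = Real.sqrt n • score ψ x := by
  have : Real.sqrt n ≠ 0 := (Real.sqrt_pos.2 (by exact_mod_cast hn)).ne'
  rw [score, smul_smul, mul_inv_cancel₀ this, one_smul]

lemma sq_norm_score (x : Vec n) : ‖score ψ x‖ ^ 2 = ‖gradient ψ x‖ ^ 2 / n := by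
  rw [score, norm_smul, mul_pow, norm_inv, Real.norm_eq_abs, abs_of_nonneg (Real.sqrt_nonneg _),
    inv_pow, Real.sq_sqrt (Nat.cast_nonneg _)]
  ring

lemma memLp_score (hψ : ψ ∈ potentials n) : MemLp (score ψ) 2 (noiseLaw ψ) :=
  (memLp_gradient hψ).const_smul (Real.sqrt n)⁻¹

lemma integrable_sq_norm_score (hψ : ψ ∈ potentials n) :
    Integrable (fun x => ‖score ψ x‖ ^ 2) (noiseLaw ψ) :=
  (memLp_score hψ).integrable_norm_pow (by norm_num)

lemma abs_integral_sq_norm_score_sub_one_le (hψ : ψ ∈ potentials n) (hn : 0 < n) :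
    |∫ x, ‖score ψ x‖ ^ 2 ∂(noiseLaw ψ) - 1| ≤ opNorm (fisher ψ - 1) := by
  have hn0 : (0 : ℝ) < n := by exact_mod_cast hn
  set e : Fin n → Vec n := fun i => EuclideanSpace.single i (1 : ℝ) with he
  have h1 : ∀ x, ‖score ψ x‖ ^ 2 = (∑ i, (inner ℝ (e i) (gradient ψ x) : ℝ) ^ 2) / n := by
    intro x
    rw [sq_norm_score, EuclideanSpace.real_norm_sq_eq]
    simp only [he, EuclideanSpace.inner_single_left, map_one, one_mul]
  simp_rw [h1]
  rw [integral_div, integral_finsetSum _ fun i _ => (memLp_inner_gradient hψ (e i)).integrable_sq]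
  simp_rw [integral_sq_inner_gradient hψ]
  have h2 : (∑ i, (e i).ofLp ⬝ᵥ (fisher ψ *ᵥ (e i).ofLp)) / n - 1
      = (∑ i, ((e i).ofLp ⬝ᵥ (fisher ψ *ᵥ (e i).ofLp) - ‖e i‖ ^ 2)) / n := by
    rw [Finset.sum_sub_distrib, sub_div]
    congr 1
    simp [he, hn0.ne']
  rw [h2, abs_div, abs_of_pos hn0, div_le_iff₀ hn0]
  calc _ ≤ ∑ i, |(e i).ofLp ⬝ᵥ (fisher ψ *ᵥ (e i).ofLp) - ‖e i‖ ^ 2| :=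
        Finset.abs_sum_le_sum_abs _ _
    _ ≤ ∑ _i : Fin n, opNorm (fisher ψ - 1) := by
        refine Finset.sum_le_sum fun i _ => (abs_fisher_quadratic_sub_le _).trans ?_
        simp [he]
    _ = _ := by simp [mul_comm]

/-- Independent copies of the score are nearly orthogonal. -/
lemma integral_integral_sq_inner_score_le (hψ : ψ ∈ potentials n) :
    ∫ y, (∫ x, (inner ℝ (score ψ y) (score ψ x) : ℝ) ^ 2 ∂(noiseLaw ψ)) ∂(noiseLaw ψ)
      ≤ (1 + opNorm (fisher ψ - 1)) / n * ∫ x, ‖score ψ x‖ ^ 2 ∂(noiseLaw ψ) := by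
  have := isProbabilityMeasure_noiseLaw hψ
  rw [← integral_const_mul]
  refine integral_mono_of_nonneg (Eventually.of_forall fun y => integral_nonneg fun x => sq_nonneg _)
    ((integrable_sq_norm_score hψ).const_mul _) (Eventually.of_forall fun y => ?_)
  simp only
  have e : ∀ x, (inner ℝ (score ψ y) (score ψ x) : ℝ) ^ 2
      = (n : ℝ)⁻¹ * (inner ℝ (score ψ y) (gradient ψ x) : ℝ) ^ 2 := by
    intro x
    rw [score.eq_def ψ x, inner_smul_right, mul_pow, inv_pow, Real.sq_sqrt (Nat.cast_nonneg _)]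
  simp_rw [e]
  rw [integral_const_mul, integral_sq_inner_gradient hψ]
  have h := (abs_le.1 (abs_fisher_quadratic_sub_le (ψ := ψ) (score ψ y))).2
  calc _ ≤ (n : ℝ)⁻¹ * ((1 + opNorm (fisher ψ - 1)) * ‖score ψ y‖ ^ 2) :=
        mul_le_mul_of_nonneg_left (by linarith) (by positivity)
    _ = _ := by ring

end Fisher

/-! ### Joint law of the noise and a random translation -/

section Joint

variable {n : ℕ} {ψ : Vec n → ℝ}

/-- The increment `ψ (x + v) - ψ x`, which is the log-likelihood ratio between the noise and its
translate. -/
def incr (ψ : Vec n → ℝ) (z : Vec n × Vec n) : ℝ := ψ (z.1 + z.2) - ψ z.1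

lemma measurable_incr (hψ : ψ ∈ potentials n) : Measurable (incr ψ) := by
  have := continuous_potential hψ
  unfold incr
  fun_prop

lemma integrable_exp_neg_incr (hψ : ψ ∈ potentials n) (m : Measure (Vec n))
    [IsProbabilityMeasure m] :
    Integrable (fun z => Real.exp (-incr ψ z)) ((noiseLaw ψ).prod m) ∧
    ∫ z, Real.exp (-incr ψ z) ∂((noiseLaw ψ).prod m) = 1 := by
  have := isProbabilityMeasure_noiseLaw hψ
  have hm : AEStronglyMeasurable (fun z => Real.exp (-incr ψ z)) ((noiseLaw ψ).prod m) :=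
    (measurable_incr hψ).neg.exp.aestronglyMeasurable
  have hi : Integrable (fun z => Real.exp (-incr ψ z)) ((noiseLaw ψ).prod m) := by
    rw [integrable_prod_iff' hm]
    refine ⟨Eventually.of_forall fun v => (integrable_exp_neg_increment hψ v).1, ?_⟩
    have : ∀ v, ∫ x, ‖Real.exp (-incr ψ (x, v))‖ ∂(noiseLaw ψ) = 1 := by
      intro v
      simp_rw [Real.norm_eq_abs, Real.abs_exp]
      exact (integrable_exp_neg_increment hψ v).2
    simp_rw [this]
    exact integrable_const _
  refine ⟨hi, ?_⟩
  rw [integral_prod_symm _ hi]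
  have : ∀ v, ∫ x, Real.exp (-incr ψ (x, v)) ∂(noiseLaw ψ) = 1 := fun v =>
    (integrable_exp_neg_increment hψ v).2
  simp_rw [this]
  simp

lemma memLp_exp_neg_half_incr (hψ : ψ ∈ potentials n) (m : Measure (Vec n))
    [IsProbabilityMeasure m] :
    MemLp (fun z => Real.exp (-incr ψ z / 2)) 2 ((noiseLaw ψ).prod m) := by
  have := isProbabilityMeasure_noiseLaw hψ
  have hm : AEStronglyMeasurable (fun z => Real.exp (-incr ψ z / 2)) ((noiseLaw ψ).prod m) :=
    ((measurable_incr hψ).neg.div_const 2).exp.aestronglyMeasurable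
  rw [memLp_two_iff_integrable_sq hm]
  refine (integrable_exp_neg_incr hψ m).1.congr (Eventually.of_forall fun z => ?_)
  simp only [← Real.exp_nat_mul]
  congr 1; push_cast; ring

lemma integral_sq_exp_neg_half_incr (hψ : ψ ∈ potentials n) (m : Measure (Vec n))
    [IsProbabilityMeasure m] :
    ∫ z, Real.exp (-incr ψ z / 2) ^ 2 ∂((noiseLaw ψ).prod m) = 1 := by
  rw [← (integrable_exp_neg_incr hψ m).2]
  congr 1; ext z
  rw [← Real.exp_nat_mul]
  congr 1; push_cast; ring

lemma integrable_exp_neg_half_incr (hψ : ψ ∈ potentials n) (m : Measure (Vec n))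
    [IsProbabilityMeasure m] :
    Integrable (fun z => Real.exp (-incr ψ z / 2)) ((noiseLaw ψ).prod m) := by
  have := isProbabilityMeasure_noiseLaw hψ
  exact (memLp_exp_neg_half_incr hψ m).integrable one_le_two

/-- A set of small probability carries little of the mass of the square root of the likelihood
ratio. -/
lemma setIntegral_exp_neg_half_incr_le (hψ : ψ ∈ potentials n) (m : Measure (Vec n))
    [IsProbabilityMeasure m] {S : Set (Vec n × Vec n)} (hS : MeasurableSet S) :
    ∫ z in S, Real.exp (-incr ψ z / 2) ∂((noiseLaw ψ).prod m)
      ≤ Real.sqrt (((noiseLaw ψ).prod m).real S) := by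
  have := isProbabilityMeasure_noiseLaw hψ
  have h := integral_mul_le_sqrt_mul_sqrt (memLp_exp_neg_half_incr hψ m)
    ((memLp_const (μ := (noiseLaw ψ).prod m) (p := 2) (1 : ℝ)).indicator hS)
  rw [integral_sq_exp_neg_half_incr hψ, Real.sqrt_one, one_mul] at h
  have e1 : ∀ z, Real.exp (-incr ψ z / 2) * S.indicator (fun _ => (1 : ℝ)) z
      = S.indicator (fun z => Real.exp (-incr ψ z / 2)) z := by
    intro z; by_cases hz : z ∈ S <;> simp [hz]
  have e2 : ∀ z, S.indicator (fun _ => (1 : ℝ)) z ^ 2 = S.indicator 1 z := by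
    intro z; by_cases hz : z ∈ S <;> simp [hz]
  simp_rw [e1, e2] at h
  rwa [integral_indicator hS, integral_indicator_one hS] at h

/-- Contiguity of the noise and its random translates, with the translation as a parameter. -/
lemma prod_real_translate_le (hψ : ψ ∈ potentials n) {Q : Type*} [MeasurableSpace Q]
    (m : Measure Q) [IsProbabilityMeasure m] {s : Q → Vec n} (hs : Measurable s)
    {B : Set (Vec n × Q)} (hB : MeasurableSet B) (K : ℝ) :
    ((noiseLaw ψ).prod m).real {z | (z.1 + s z.2, z.2) ∈ B}
      ≤ Real.exp K * ((noiseLaw ψ).prod m).real B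
        + ((noiseLaw ψ).prod m).real {z | K < incr ψ (z.1, s z.2)} := by
  have := isProbabilityMeasure_noiseLaw hψ
  have hS1 : MeasurableSet {z : Vec n × Q | (z.1 + s z.2, z.2) ∈ B} :=
    (show Measurable (fun z : Vec n × Q => (z.1 + s z.2, z.2)) by fun_prop) hB
  have hS2 : MeasurableSet {z : Vec n × Q | K < incr ψ (z.1, s z.2)} :=
    measurableSet_lt measurable_const ((measurable_incr hψ).comp (by fun_prop))
  rw [prod_real_eq_integral_symm _ _ hS1, prod_real_eq_integral_symm _ _ hS2,
    prod_real_eq_integral_symm _ _ hB, ← integral_const_mul]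
  have hb : ∀ {S : Set (Vec n × Q)}, MeasurableSet S →
      Integrable (fun q => (noiseLaw ψ).real {x | (x, q) ∈ S}) m := fun hS =>
    Integrable.of_bound (C := 1) (measurable_measureReal_section _ hS).aestronglyMeasurable
      (Eventually.of_forall fun q => by
        rw [Real.norm_eq_abs, abs_of_nonneg measureReal_nonneg]; exact measureReal_le_one)
  rw [← integral_add ((hb hB).const_mul _) (hb hS2)]
  refine integral_mono (hb hS1) (((hb hB).const_mul _).add (hb hS2)) fun q => ?_
  exact noiseLaw_real_translate_le hψ (s q) (B := {x | (x, q) ∈ B})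
    (measurable_prodMk_right hB) K

end Joint

/-! ### Affinity of the noise and its Gaussian translates -/

section Affinity

variable {n : ℕ} {ψ : Vec n → ℝ}

/-- Truncation of a vector to the unit ball. -/
def clip (u : Vec n) : Vec n := (max 1 ‖u‖)⁻¹ • u

lemma measurable_clip : Measurable (clip : Vec n → Vec n) := by
  unfold clip; fun_prop

lemma norm_clip_le (u : Vec n) : ‖clip u‖ ≤ 1 := by
  have h : 0 < max 1 ‖u‖ := lt_max_of_lt_left one_pos
  rw [clip, norm_smul, norm_inv, Real.norm_eq_abs, abs_of_pos h, inv_mul_le_one₀ h]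
  exact le_max_right _ _

lemma norm_sub_clip (u : Vec n) : ‖u - clip u‖ = max (‖u‖ - 1) 0 := by
  rcases le_total ‖u‖ 1 with h | h
  · simp [clip, h]
  · have h0 : 0 < ‖u‖ := by linarith
    have e : u - clip u = (1 - ‖u‖⁻¹) • u := by
      rw [clip, max_eq_right h, sub_smul, one_smul]
    have h1 : ‖u‖⁻¹ ≤ 1 := inv_le_one_of_one_le₀ h
    rw [e, norm_smul, Real.norm_eq_abs, abs_of_nonneg (by linarith), sub_mul, one_mul,
      inv_mul_cancel₀ h0.ne', max_eq_left (by linarith)]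

lemma inner_clip_clip_le (u u' : Vec n) : (inner ℝ (clip u) (clip u') : ℝ) ≤ 1 := by
  refine (real_inner_le_norm _ _).trans ?_
  nlinarith [norm_clip_le u, norm_clip_le u', norm_nonneg (clip u), norm_nonneg (clip u')]

lemma abs_inner_clip_clip_le (u u' : Vec n) : |(inner ℝ (clip u) (clip u') : ℝ)| ≤ 1 := by
  refine (abs_real_inner_le_norm _ _).trans ?_
  nlinarith [norm_clip_le u, norm_clip_le u', norm_nonneg (clip u), norm_nonneg (clip u')]

lemma sq_norm_clip_sub_le (u u' : Vec n) :
    ‖clip u - clip u'‖ ^ 2 ≤ 2 - 2 * (inner ℝ (clip u) (clip u') : ℝ) := by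
  rw [norm_sub_sq_real]
  nlinarith [norm_clip_le u, norm_clip_le u', norm_nonneg (clip u), norm_nonneg (clip u')]

/-- The Hellinger affinity of the noise and its translate by an independent Gaussian vector of
covariance `τ I`. -/
def affinity (ψ : Vec n → ℝ) (τ : ℝ) : ℝ :=
  ∫ z, Real.exp (-incr ψ z / 2) ∂((noiseLaw ψ).prod (gaussVec n τ))

/-- The affinity weighted by the correlation of the clipped scores at the two points. -/
def scoreAffinity (ψ : Vec n → ℝ) (τ : ℝ) : ℝ :=
  ∫ z, Real.exp (-incr ψ z / 2) * inner ℝ (clip (score ψ z.1)) (clip (score ψ (z.1 + z.2)))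
    ∂((noiseLaw ψ).prod (gaussVec n τ))

/-- The error made by clipping the score. -/
def clipError (ψ : Vec n → ℝ) : ℝ :=
  Real.sqrt (∫ x, ‖score ψ x - clip (score ψ x)‖ ^ 2 ∂(noiseLaw ψ)) *
    (Real.sqrt (∫ x, ‖score ψ x‖ ^ 2 ∂(noiseLaw ψ)) + 1)

lemma affinity_nonneg (τ : ℝ) : 0 ≤ affinity ψ τ := integral_nonneg fun _ => (Real.exp_pos _).le

lemma affinity_le_one (hψ : ψ ∈ potentials n) (τ : ℝ) : affinity ψ τ ≤ 1 := by
  have := isProbabilityMeasure_noiseLaw hψ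
  have h := setIntegral_exp_neg_half_incr_le hψ (gaussVec n τ) MeasurableSet.univ
  simpa [affinity] using h

lemma integral_prod_eq_lebesgue (hψ : ψ ∈ potentials n) (τ : ℝ) (g : Vec n × Vec n → ℝ)
    (hg : Integrable (fun z => Real.exp (-incr ψ z / 2) * g z) ((noiseLaw ψ).prod (gaussVec n τ))) :
    ∫ z, Real.exp (-incr ψ z / 2) * g z ∂((noiseLaw ψ).prod (gaussVec n τ))
      = ∫ v, (∫ x, sqrtDensity ψ x * sqrtDensity ψ (x + v) * g (x, v)) ∂(gaussVec n τ) := by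
  have := isProbabilityMeasure_noiseLaw hψ
  rw [integral_prod_symm _ hg]
  congr 1; ext v
  rw [integral_noiseLaw hψ]
  congr 1; ext x
  rw [sqrtDensity_add v x, smul_eq_mul, incr]
  ring

lemma affinity_eq_lebesgue (hψ : ψ ∈ potentials n) (τ : ℝ) :
    affinity ψ τ = ∫ v, (∫ x, sqrtDensity ψ x * sqrtDensity ψ (x + v)) ∂(gaussVec n τ) := by
  have := integral_prod_eq_lebesgue hψ τ (fun _ => 1)
    (by simpa using integrable_exp_neg_half_incr hψ (gaussVec n τ))
  simpa [affinity] using this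

lemma integrable_exp_mul_inner_clip (hψ : ψ ∈ potentials n) (τ : ℝ) :
    Integrable (fun z : Vec n × Vec n => Real.exp (-incr ψ z / 2) *
      inner ℝ (clip (score ψ z.1)) (clip (score ψ (z.1 + z.2))))
      ((noiseLaw ψ).prod (gaussVec n τ)) := by
  refine (integrable_exp_neg_half_incr hψ (gaussVec n τ)).mono' ?_ (Eventually.of_forall fun z => ?_)
  · have h1 : Measurable (fun z : Vec n × Vec n => clip (score ψ z.1)) :=
      measurable_clip.comp (measurable_score.comp measurable_fst)
    have h2 : Measurable (fun z : Vec n × Vec n => clip (score ψ (z.1 + z.2))) :=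
      measurable_clip.comp (measurable_score.comp (measurable_fst.add measurable_snd))
    exact (((measurable_incr hψ).neg.div_const 2).exp.mul
      (h1.inner (𝕜 := ℝ) h2)).aestronglyMeasurable
  · rw [norm_mul, Real.norm_eq_abs, Real.abs_exp]
    exact mul_le_of_le_one_right (Real.exp_pos _).le (abs_inner_clip_clip_le _ _)

lemma scoreAffinity_le_affinity (hψ : ψ ∈ potentials n) (τ : ℝ) :
    scoreAffinity ψ τ ≤ affinity ψ τ := by
  refine integral_mono (integrable_exp_mul_inner_clip hψ τ)
    (integrable_exp_neg_half_incr hψ (gaussVec n τ)) fun z => ?_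
  exact mul_le_of_le_one_right (Real.exp_pos _).le (inner_clip_clip_le _ _)

lemma integral_exp_mul_sq_norm_clip_sub_le (hψ : ψ ∈ potentials n) (τ : ℝ) :
    ∫ z, Real.exp (-incr ψ z / 2) *
        ‖clip (score ψ z.1) - clip (score ψ (z.1 + z.2))‖ ^ 2
        ∂((noiseLaw ψ).prod (gaussVec n τ))
      ≤ 2 * (affinity ψ τ - scoreAffinity ψ τ) := by
  have h1 := integrable_exp_neg_half_incr hψ (gaussVec n τ)
  have h2 := integrable_exp_mul_inner_clip hψ τ
  rw [affinity, scoreAffinity, ← integral_sub h1 h2, ← integral_const_mul]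
  refine integral_mono_of_nonneg (Eventually.of_forall fun z => by positivity)
    ((h1.sub h2).const_mul 2) (Eventually.of_forall fun z => ?_)
  have := mul_le_mul_of_nonneg_left (sq_norm_clip_sub_le (score ψ z.1) (score ψ (z.1 + z.2)))
    (Real.exp_pos (-incr ψ z / 2)).le
  simp only
  linarith

lemma affinity_zero (hψ : ψ ∈ potentials n) : affinity ψ 0 = 1 := by
  rw [affinity_eq_lebesgue hψ, gaussVec_zero, integral_dirac]
  simp only [add_zero]
  have := isProbabilityMeasure_noiseLaw hψ
  have h := integral_noiseLaw hψ (fun _ => (1 : ℝ))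
  simp only [integral_const, probReal_univ, smul_eq_mul, mul_one] at h
  rw [h]
  congr 1; ext x; ring

lemma integral_inner_le_sqrt_mul_sqrt {Ω : Type*} [MeasurableSpace Ω] {m : Measure Ω}
    {a b : Ω → Vec n} (ha : MemLp a 2 m) (hb : MemLp b 2 m) :
    ∫ x, (inner ℝ (a x) (b x) : ℝ) ∂m
      ≤ Real.sqrt (∫ x, ‖a x‖ ^ 2 ∂m) * Real.sqrt (∫ x, ‖b x‖ ^ 2 ∂m) := by
  refine le_trans ?_ (integral_mul_le_sqrt_mul_sqrt ha.norm hb.norm)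
  refine integral_mono ?_ (ha.norm.integrable_mul hb.norm) fun x => real_inner_le_norm _ _
  exact (ha.norm.integrable_mul hb.norm).mono' (ha.1.inner (𝕜 := ℝ) hb.1)
    (Eventually.of_forall fun x => abs_real_inner_le_norm _ _)

lemma integrable_inner_of_memLp {Ω : Type*} [MeasurableSpace Ω] {m : Measure Ω}
    {a b : Ω → Vec n} (ha : MemLp a 2 m) (hb : MemLp b 2 m) :
    Integrable (fun x => (inner ℝ (a x) (b x) : ℝ)) m :=
  (ha.norm.integrable_mul hb.norm).mono' (ha.1.inner (𝕜 := ℝ) hb.1)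
    (Eventually.of_forall fun x => abs_real_inner_le_norm _ _)

lemma integral_sq_norm_sqrtDensity_smul (hψ : ψ ∈ potentials n) (g : Vec n → Vec n) :
    ∫ x, ‖sqrtDensity ψ x • g x‖ ^ 2 = ∫ x, ‖g x‖ ^ 2 ∂(noiseLaw ψ) := by
  rw [integral_noiseLaw hψ]
  congr 1; ext x
  rw [norm_smul, mul_pow, Real.norm_eq_abs, sq_abs, smul_eq_mul]

lemma integrable_of_norm_le_one_noiseLaw (hψ : ψ ∈ potentials n) {g : Vec n → Vec n}
    (hg : Measurable g) (hb : ∀ x, ‖g x‖ ≤ 1) :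
    Integrable (fun x => ‖g x‖ ^ 2) (noiseLaw ψ) := by
  have := isProbabilityMeasure_noiseLaw hψ
  refine Integrable.of_bound (C := 1) (hg.norm.pow_const 2).aestronglyMeasurable
    (Eventually.of_forall fun x => ?_)
  rw [Real.norm_eq_abs, abs_of_nonneg (by positivity)]
  exact pow_le_one₀ (norm_nonneg _) (hb x)

/-- The affinity decreases under one heat step at most at the rate prescribed by the correlation of
the clipped scores. -/
lemma affinity_sub_le (hψ : ψ ∈ potentials n) (hn : 0 < n) {t h : ℝ} (ht : 0 ≤ t) (hh : 0 ≤ h) :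
    affinity ψ (t / n) - affinity ψ ((t + h) / n)
      ≤ h / 8 * (scoreAffinity ψ (t / n) + clipError ψ) := by
  have hprob := isProbabilityMeasure_noiseLaw hψ
  have hn0 : (0 : ℝ) < n := by exact_mod_cast hn
  have hτ : 0 ≤ t / n := by positivity
  set γ := gaussVec n (t / n)
  set f := sqrtDensity ψ
  set G : Vec n → Vec n := fun x => f x • score ψ x with hG
  set H : Vec n → Vec n := fun x => f x • clip (score ψ x) with hH
  have hGm : MemLp G 2 volume :=
    memLp_sqrtDensity_smul hψ measurable_score (integrable_sq_norm_score hψ)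
  have hHm : MemLp H 2 volume :=
    memLp_sqrtDensity_smul hψ (measurable_clip.comp measurable_score)
      (integrable_of_norm_le_one_noiseLaw hψ (measurable_clip.comp measurable_score)
        fun x => norm_clip_le _)
  have h1 := heat_autocorrelation_sub_le hτ (show 0 ≤ h / n by positivity) (memLp_sqrtDensity hψ)
    (memLp_gradSqrtDensity hψ) (sqrtDensity_add_sub hψ.1)
  rw [← affinity_eq_lebesgue hψ, ← affinity_eq_lebesgue hψ, ← add_div] at h1
  have e1 : ∀ x v : Vec n, (inner ℝ (gradSqrtDensity ψ x) (gradSqrtDensity ψ (x + v)) : ℝ)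
      = n / 4 * inner ℝ (G x) (G (x + v)) := by
    intro x v
    simp only [gradSqrtDensity, hG, gradient_eq_smul_score hn, inner_smul_left, inner_smul_right,
      conj_trivial]
    have : Real.sqrt n * Real.sqrt n = n := Real.mul_self_sqrt hn0.le
    linear_combination (f x * f (x + v) / 4 * inner ℝ (score ψ x) (score ψ (x + v))) * this
  simp_rw [e1, integral_const_mul] at h1
  have e2 : h / n / 2 * (n / 4 * ∫ v, (∫ x, (inner ℝ (G x) (G (x + v)) : ℝ)) ∂γ)
      = h / 8 * ∫ v, (∫ x, (inner ℝ (G x) (G (x + v)) : ℝ)) ∂γ := by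
    field_simp
    ring
  rw [e2] at h1
  refine h1.trans (mul_le_mul_of_nonneg_left ?_ (by positivity))
  -- Replace the score by its clipped version, uniformly in the translation.
  have hshift : ∀ {K : Vec n → Vec n} (v : Vec n), ∫ x, ‖K (x + v)‖ ^ 2 = ∫ x, ‖K x‖ ^ 2 :=
    fun {K} v => integral_add_right_eq_self (fun x => ‖K x‖ ^ 2) v
  have hGH : MemLp (fun x => G x - H x) 2 volume := hGm.sub hHm
  have eGH : ∫ x, ‖G x - H x‖ ^ 2 = ∫ x, ‖score ψ x - clip (score ψ x)‖ ^ 2 ∂(noiseLaw ψ) := by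
    rw [← integral_sq_norm_sqrtDensity_smul hψ]
    simp only [hG, hH, smul_sub, f]
  have eG : ∫ x, ‖G x‖ ^ 2 = ∫ x, ‖score ψ x‖ ^ 2 ∂(noiseLaw ψ) :=
    integral_sq_norm_sqrtDensity_smul hψ _
  have eH : ∫ x, ‖H x‖ ^ 2 ≤ 1 := by
    have : ∫ x, ‖H x‖ ^ 2 = ∫ x, ‖clip (score ψ x)‖ ^ 2 ∂(noiseLaw ψ) :=
      integral_sq_norm_sqrtDensity_smul hψ _
    rw [this]
    refine (integral_mono (integrable_of_norm_le_one_noiseLaw hψ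
      (measurable_clip.comp measurable_score) fun x => norm_clip_le _) (integrable_const 1)
      fun x => pow_le_one₀ (norm_nonneg _) (norm_clip_le _)).trans ?_
    simp
  have hv : ∀ v : Vec n, ∫ x, (inner ℝ (G x) (G (x + v)) : ℝ)
      ≤ (∫ x, (inner ℝ (H x) (H (x + v)) : ℝ)) + clipError ψ := by
    intro v
    have hGv := memLp_add_right hGm v
    have hGHv := memLp_add_right hGH v
    have hHv := memLp_add_right hHm v
    have e : ∀ x, (inner ℝ (G x) (G (x + v)) : ℝ)
        = inner ℝ (H x) (H (x + v)) + (inner ℝ (G x - H x) (G (x + v))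
          + inner ℝ (H x) (G (x + v) - H (x + v))) := by
      intro x; rw [inner_sub_left, inner_sub_right]; ring
    have j1 := integrable_inner_of_memLp hHm hHv
    have j2 := integrable_inner_of_memLp hGH hGv
    have j3 := integrable_inner_of_memLp hHm hGHv
    simp_rw [e]
    have j4 := integral_add j2 j3
    have j5 := integral_add j1 (j2.add j3)
    simp only [Pi.add_apply] at j5
    rw [j5, j4]
    have b2 := integral_inner_le_sqrt_mul_sqrt hGH hGv
    have b3 := integral_inner_le_sqrt_mul_sqrt hHm hGHv
    rw [hshift (K := G), eG, eGH] at b2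
    rw [hshift (K := fun x => G x - H x), eGH] at b3
    have b4 : Real.sqrt (∫ x, ‖H x‖ ^ 2) ≤ 1 := Real.sqrt_le_one.2 eH
    have b5 : Real.sqrt (∫ x, ‖H x‖ ^ 2) *
        Real.sqrt (∫ x, ‖score ψ x - clip (score ψ x)‖ ^ 2 ∂(noiseLaw ψ))
        ≤ Real.sqrt (∫ x, ‖score ψ x - clip (score ψ x)‖ ^ 2 ∂(noiseLaw ψ)) :=
      mul_le_of_le_one_left (Real.sqrt_nonneg _) b4
    rw [clipError]
    linarith
  have hint : ∀ {K : Vec n → Vec n}, MemLp K 2 volume →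
      Integrable (fun v => ∫ x, (inner ℝ (K x) (K (x + v)) : ℝ)) γ := by
    intro K hK
    have m1 := memLp_add_shift γ (s := fun _ => 0) (by fun_prop) hK
    have m2 := memLp_add_shift γ (s := fun v => v) (by fun_prop) hK
    have := (integrable_inner_of_memLp m1 m2).integral_prod_right
    simpa using this
  have h3 := integral_mono (hint hGm) ((hint hHm).add (integrable_const (clipError ψ))) hv
  have h4 := integral_add (hint hHm) (integrable_const (μ := γ) (clipError ψ))
  simp only [integral_const, probReal_univ, one_smul] at h4
  refine h3.trans (le_of_eq ?_)
  refine h4.trans ?_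
  congr 1
  rw [scoreAffinity, integral_prod_eq_lebesgue hψ _ _ (integrable_exp_mul_inner_clip hψ _)]
  congr 1; ext v
  congr 1; ext x
  simp only [hH, inner_smul_left, inner_smul_right, conj_trivial]
  ring

end Affinity

/-! ### Rigidity of the decay of the affinity -/

/-- A discrete Grönwall inequality: a sequence of functions losing per step `h` at most a fraction
`h / 8`, up to a vanishing error, decays at most like `exp (-s / 8)`. -/
lemma eventually_mul_exp_le_of_decay {κ : ℕ → ℝ → ℝ} {δ : ℕ → ℝ} (hδ : Tendsto δ atTop (𝓝 0))
    (h1 : ∀ k t, κ k t ≤ 1) (hpos : ∀ k t, 0 ≤ κ k t)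
    (hstep : ∀ k t h, 0 ≤ t → 0 ≤ h → κ k t - κ k (t + h) ≤ h / 8 * (κ k t + δ k))
    {t s : ℝ} (ht : 0 ≤ t) (hs : 0 ≤ s) {ε : ℝ} (hε : 0 < ε) :
    ∀ᶠ k in atTop, κ k t * Real.exp (-s / 8) - ε ≤ κ k (t + s) := by
  have hpow : Tendsto (fun m : ℕ => (1 + (-s / 8) / (m : ℝ)) ^ m) atTop (𝓝 (Real.exp (-s / 8))) :=
    Real.tendsto_one_add_div_pow_exp _
  obtain ⟨m, hm1, hm2, hm3⟩ : ∃ m : ℕ, 0 < m ∧ s / 8 ≤ m ∧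
      |(1 + (-s / 8) / (m : ℝ)) ^ m - Real.exp (-s / 8)| < ε / 2 := by
    have e1 := (Metric.tendsto_nhds.1 hpow (ε / 2) (by positivity))
    obtain ⟨m, hm⟩ := (((eventually_gt_atTop 0).and
      (tendsto_natCast_atTop_atTop.eventually_ge_atTop (s / 8))).and e1).exists
    exact ⟨m, hm.1.1, hm.1.2, by simpa [Real.dist_eq] using hm.2⟩
  have hm0 : (0 : ℝ) < m := by exact_mod_cast hm1
  set q : ℝ := 1 + (-s / 8) / (m : ℝ) with hq
  have hq0 : 0 ≤ q := by
    have : s / 8 / m ≤ 1 := by rw [div_le_one hm0]; exact hm2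
    rw [hq, neg_div, neg_div]; linarith
  have hq1 : q ≤ 1 := by
    have : 0 ≤ s / 8 / m := by positivity
    rw [hq, neg_div, neg_div]; linarith
  have hδ' : ∀ᶠ k in atTop, |δ k| * s < ε / 2 := by
    have : Tendsto (fun k => |δ k| * s) atTop (𝓝 0) := by simpa using hδ.abs.mul_const s
    exact this.eventually_lt_const (by positivity)
  filter_upwards [hδ'] with k hk
  have hind : ∀ j : ℕ, κ k t * q ^ j - j * (s / m) * |δ k| ≤ κ k (t + j * (s / m)) := by
    intro j
    induction j with
    | zero => simp
    | succ j ih =>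
      have hst := hstep k (t + j * (s / m)) (s / m) (by positivity) (by positivity)
      have e : t + (j + 1 : ℕ) * (s / m) = t + j * (s / m) + s / m := by push_cast; ring
      rw [e]
      have hqe : q = 1 - s / m / 8 := by rw [hq]; ring
      have hsm : 0 ≤ s / m := by positivity
      have h3 : q * (κ k t * q ^ j - j * (s / m) * |δ k|) ≤ q * κ k (t + j * (s / m)) :=
        mul_le_mul_of_nonneg_left ih hq0
      have h4 : q * κ k (t + j * (s / m)) - s / m / 8 * δ k ≤ κ k (t + j * (s / m) + s / m) := by
        rw [hqe]; linarith
      have h5 : s / m / 8 * δ k ≤ s / m * |δ k| := by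
        have := le_abs_self (δ k)
        have := abs_nonneg (δ k)
        nlinarith
      have h6 : q * (j * (s / m) * |δ k|) ≤ j * (s / m) * |δ k| :=
        mul_le_of_le_one_left (by positivity) hq1
      push_cast
      rw [pow_succ]
      nlinarith
  have h2 := hind m
  rw [mul_div_cancel₀ _ hm0.ne'] at h2
  have h3 : κ k t * q ^ m ≥ κ k t * Real.exp (-s / 8) - ε / 2 := by
    have hab := abs_lt.1 hm3
    nlinarith [h1 k t, hpos k t]
  nlinarith

/-- If the decay at time one is the extremal one, then so is the infinitesimal decay at all earlier
times: the two sides of `ρ ≤ κ` agree asymptotically. -/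
lemma eventually_sub_le_of_extremal_decay {κ ρ : ℕ → ℝ → ℝ} {δ : ℕ → ℝ}
    (hδ : Tendsto δ atTop (𝓝 0)) (h0 : ∀ k, κ k 0 = 1) (h1 : ∀ k t, κ k t ≤ 1)
    (hpos : ∀ k t, 0 ≤ κ k t) (hρ : ∀ k t, ρ k t ≤ κ k t)
    (hstep : ∀ k t h, 0 ≤ t → 0 ≤ h → κ k t - κ k (t + h) ≤ h / 8 * (ρ k t + δ k))
    (hext : ∀ ε > 0, ∀ᶠ k in atTop, κ k 1 ≤ Real.exp (-1 / 8) + ε)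
    {t : ℝ} (ht : 0 ≤ t) (ht1 : t < 1) {ε : ℝ} (hε : 0 < ε) :
    ∀ᶠ k in atTop, κ k t - ρ k t ≤ ε := by
  have hstep' : ∀ k t h, 0 ≤ t → 0 ≤ h → κ k t - κ k (t + h) ≤ h / 8 * (κ k t + δ k) := by
    intro k t h ht hh
    refine (hstep k t h ht hh).trans (mul_le_mul_of_nonneg_left ?_ (by positivity))
    linarith [hρ k t]
  obtain ⟨h, hh0, hht, hhε⟩ : ∃ h : ℝ, 0 < h ∧ h ≤ 1 - t ∧ h ≤ ε :=
    ⟨min (1 - t) ε, lt_min (by linarith) hε, min_le_left _ _, min_le_right _ _⟩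
  have hε1 : 0 < ε * h / 128 := by positivity
  have hsum : t + h + (1 - t - h) = 1 := by ring
  -- Running the decay estimate from `t + h` to `1` bounds `κ (t + h)` from above; running it from `0`
  -- to `t` bounds `κ t` from below. The two leave no room for `ρ t` to be smaller than `κ t`.
  have A := eventually_mul_exp_le_of_decay hδ h1 hpos hstep' (t := t + h) (s := 1 - t - h)
    (by linarith) (by linarith) hε1
  have B := eventually_mul_exp_le_of_decay hδ h1 hpos hstep' (t := 0) (s := t) le_rfl ht hε1
  have hδ' : ∀ᶠ k in atTop, δ k < ε * h / 128 := hδ.eventually_lt_const hε1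
  filter_upwards [A, B, hext _ hε1, hδ'] with k hA hB hC hD
  rw [hsum] at hA
  rw [h0, one_mul, zero_add] at hB
  set ε1 := ε * h / 128 with hε1def
  have hst := hstep k t h ht hh0.le
  have hupper : κ k (t + h) ≤ Real.exp (-(t + h) / 8) + 6 * ε1 := by
    have e1 : Real.exp (-(1 - t - h) / 8) * Real.exp ((1 - t - h) / 8) = 1 := by
      rw [← Real.exp_add, ← Real.exp_zero]; congr 1; ring
    have e2 : Real.exp (-1 / 8) * Real.exp ((1 - t - h) / 8) = Real.exp (-(t + h) / 8) := by
      rw [← Real.exp_add]; congr 1; ring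
    have e3 : Real.exp ((1 - t - h) / 8) ≤ 3 := by
      have : Real.exp ((1 - t - h) / 8) ≤ Real.exp 1 := Real.exp_le_exp.2 (by linarith)
      have := Real.exp_one_lt_d9
      linarith
    have e4 : κ k (t + h) * Real.exp (-(1 - t - h) / 8) ≤ Real.exp (-1 / 8) + 2 * ε1 := by
      linarith
    have e5 := mul_le_mul_of_nonneg_right e4 (Real.exp_pos ((1 - t - h) / 8)).le
    rw [mul_assoc, e1, add_mul, e2] at e5
    nlinarith
  have hexp : Real.exp (-(t + h) / 8) = Real.exp (-t / 8) * Real.exp (-(h / 8)) := by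
    rw [← Real.exp_add]; congr 1; ring
  have hq : Real.exp (-(h / 8)) ≤ 1 - h / 8 + (h / 8) ^ 2 := by
    have := Real.abs_exp_sub_one_sub_id_le (x := -(h / 8))
      (by rw [abs_neg, abs_of_pos (by positivity)]; linarith)
    have := (abs_le.1 this).2
    nlinarith
  have ht8 : Real.exp (-t / 8) ≤ 1 := Real.exp_le_one_iff.2 (by linarith)
  have ht8' := Real.exp_pos (-t / 8)
  have hfin : h / 8 * (κ k t - ρ k t) ≤ (h / 8) ^ 2 + 8 * ε1 := by
    have hk8 : (1 - h / 8) * (Real.exp (-t / 8) - ε1) ≤ (1 - h / 8) * κ k t :=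
      mul_le_mul_of_nonneg_left hB (by linarith)
    have e1 : Real.exp (-t / 8) * Real.exp (-(h / 8)) ≤
        Real.exp (-t / 8) * (1 - h / 8) + (h / 8) ^ 2 := by
      nlinarith [sq_nonneg (h / 8)]
    have e2 : h / 8 * δ k ≤ ε1 := by nlinarith
    nlinarith
  have hpos8 : 0 < h / 8 := by positivity
  refine le_of_mul_le_mul_left (hfin.trans ?_) hpos8
  rw [hε1def]
  nlinarith

/-! ### Kolmogorov-Smirnov closeness -/

section KolmogorovSmirnov

variable {Ω : Type*} [MeasurableSpace Ω] {P : Measure Ω} [IsProbabilityMeasure P] {f g : Ω → ℝ}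

lemma abs_real_le_sub_le_ksDist (s : ℝ) :
    |P.real {x | f x ≤ s} - P.real {x | g x ≤ s}| ≤ ksDist P f g := by
  refine le_ciSup (f := fun s : ℝ => |P.real {x | f x ≤ s} - P.real {x | g x ≤ s}|) ⟨1, ?_⟩ s
  rintro _ ⟨s, rfl⟩
  rw [abs_le]
  constructor <;> linarith [measureReal_nonneg (μ := P) (s := {x | f x ≤ s}),
    measureReal_nonneg (μ := P) (s := {x | g x ≤ s}),
    measureReal_le_one (μ := P) (s := {x | f x ≤ s}),
    measureReal_le_one (μ := P) (s := {x | g x ≤ s})]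

lemma tendsto_real_le_nhdsGT (hf : Measurable f) (s : ℝ) :
    Tendsto (fun r => P.real {x | f x ≤ r}) (𝓝[>] s) (𝓝 (P.real {x | f x ≤ s})) := by
  have := Measure.isProbabilityMeasure_map (μ := P) hf.aemeasurable
  have e : ∀ r, P.real {x | f x ≤ r} = cdf (P.map f) r := by
    intro r
    rw [cdf_eq_real, map_measureReal_apply hf measurableSet_Iic]
    rfl
  simp_rw [e]
  exact ((cdf (P.map f)).right_continuous s).mono_left (nhdsWithin_mono _ Set.Ioi_subset_Ici_self)

/-- By right continuity, distribution functions need only be compared at rational points. -/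
lemma abs_real_le_sub_le_of_forall_rat (hf : Measurable f) (hg : Measurable g) {a : ℝ}
    (h : ∀ q : ℚ, |P.real {x | f x ≤ q} - P.real {x | g x ≤ q}| ≤ a) (s : ℝ) :
    |P.real {x | f x ≤ s} - P.real {x | g x ≤ s}| ≤ a := by
  have ht := ((tendsto_real_le_nhdsGT (P := P) hf s).sub (tendsto_real_le_nhdsGT (P := P) hg s)).abs
  refine le_of_tendsto_of_frequently ht ?_
  rw [frequently_nhdsWithin_iff]
  rw [Metric.nhds_basis_ball.frequently_iff]
  intro ε hε
  obtain ⟨q, hq1, hq2⟩ := exists_rat_btwn (show s < s + ε by linarith)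
  refine ⟨q, ?_, h q, hq1⟩
  rw [Metric.mem_ball, Real.dist_eq, abs_lt]
  constructor <;> linarith

/-- Truncated exponential moments are stable under small changes of the distribution function. -/
lemma integral_min_exp_le_of_abs_real_le_sub_le (hf : Measurable f) (hg : Measurable g) {a M : ℝ}
    (hM : 0 ≤ M) (h : ∀ s, |P.real {x | f x ≤ s} - P.real {x | g x ≤ s}| ≤ a) :
    ∫ x, min (Real.exp (-f x / 2)) M ∂P ≤ ∫ x, min (Real.exp (-g x / 2)) M ∂P + M * a := by
  have key : ∀ {f : Ω → ℝ}, Measurable f → ∫ x, min (Real.exp (-f x / 2)) M ∂P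
      = ∫ t in Set.Ioc 0 M, P.real {x | f x ≤ -2 * Real.log t} := by
    intro f hf
    have hi : Integrable (fun x => min (Real.exp (-f x / 2)) M) P :=
      Integrable.of_bound (C := M) ((hf.neg.div_const 2).exp.min
        measurable_const).aestronglyMeasurable (Eventually.of_forall fun x => by
          rw [Real.norm_eq_abs, abs_of_nonneg (le_min (Real.exp_pos _).le hM)]
          exact min_le_right _ _)
    rw [Integrable.integral_eq_integral_Ioc_meas_le hi
      (Eventually.of_forall fun x => le_min (Real.exp_pos _).le hM)
      (Eventually.of_forall fun x => min_le_right _ _)]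
    refine setIntegral_congr_fun measurableSet_Ioc fun t ht => ?_
    congr 1
    ext x
    simp only [Set.mem_ofPred_eq, le_min_iff, ht.2, and_true]
    rw [← Real.log_le_iff_le_exp ht.1]
    constructor <;> intro h <;> linarith
  have hint : ∀ {f : Ω → ℝ}, Measurable f → IntegrableOn
      (fun t => P.real {x | f x ≤ -2 * Real.log t}) (Set.Ioc 0 M) := by
    intro f hf
    refine Measure.integrableOn_of_bounded (M := 1) (by simp) ?_ (Eventually.of_forall fun t => ?_)
    · have hmono : Monotone (fun r => P.real {x | f x ≤ r}) := fun r r' hr =>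
        measureReal_mono (fun x hx => le_trans hx hr)
      exact (hmono.measurable.comp (by fun_prop : Measurable fun t => -2 * Real.log t)).aestronglyMeasurable
    · rw [Real.norm_eq_abs, abs_of_nonneg measureReal_nonneg]; exact measureReal_le_one
  rw [key hf, key hg]
  have hc : ∫ _t in Set.Ioc (0 : ℝ) M, a = M * a := by simp [hM]
  rw [← hc, ← integral_add (hint hg) (by simp)]
  refine integral_mono (hint hf) ((hint hg).add (by simp)) fun t => ?_
  have := (abs_le.1 (h (-2 * Real.log t))).2
  linarith

end KolmogorovSmirnov

/-! ### The affinity of the noise and a fixed translate -/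

section ShiftAffinity

variable {n : ℕ} {ψ : Vec n → ℝ}

/-- The Hellinger affinity of the noise and its translate by `v`. -/
def shiftAffinity (ψ : Vec n → ℝ) (v : Vec n) : ℝ :=
  ∫ x, Real.exp (-(ψ (x + v) - ψ x) / 2) ∂(noiseLaw ψ)

lemma shiftAffinity_nonneg (v : Vec n) : 0 ≤ shiftAffinity ψ v :=
  integral_nonneg fun _ => (Real.exp_pos _).le

lemma sq_exp_neg_half (y : ℝ) : Real.exp (-y / 2) ^ 2 = Real.exp (-y) := by
  rw [← Real.exp_nat_mul]; congr 1; push_cast; ring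

lemma integrable_exp_neg_half_increment (hψ : ψ ∈ potentials n) (v : Vec n) :
    Integrable (fun x => Real.exp (-(ψ (x + v) - ψ x) / 2)) (noiseLaw ψ) := by
  have := isProbabilityMeasure_noiseLaw hψ
  have hc := continuous_potential hψ
  have hm : AEStronglyMeasurable (fun x => Real.exp (-(ψ (x + v) - ψ x) / 2)) (noiseLaw ψ) :=
    (by fun_prop : Continuous fun x => Real.exp (-(ψ (x + v) - ψ x) / 2)).aestronglyMeasurable
  refine MemLp.integrable (q := 2) one_le_two ((memLp_two_iff_integrable_sq hm).2 ?_)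
  simp_rw [sq_exp_neg_half]
  exact (integrable_exp_neg_increment hψ v).1

lemma shiftAffinity_le_one (hψ : ψ ∈ potentials n) (v : Vec n) : shiftAffinity ψ v ≤ 1 := by
  have := isProbabilityMeasure_noiseLaw hψ
  have h := integrable_exp_neg_increment hψ v
  have : shiftAffinity ψ v ≤ ∫ x, (1 + Real.exp (-(ψ (x + v) - ψ x))) / 2 ∂(noiseLaw ψ) := by
    refine integral_mono (integrable_exp_neg_half_increment hψ v)
      (((integrable_const 1).add h.1).div_const 2) fun x => ?_
    simp only [← sq_exp_neg_half]
    nlinarith [sq_nonneg (Real.exp (-(ψ (x + v) - ψ x) / 2) - 1)]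
  rw [integral_div, integral_add (integrable_const 1) h.1, h.2] at this
  simpa using this

lemma affinity_eq_integral_shiftAffinity (hψ : ψ ∈ potentials n) (τ : ℝ) :
    affinity ψ τ = ∫ v, shiftAffinity ψ v ∂(gaussVec n τ) := by
  have := isProbabilityMeasure_noiseLaw hψ
  rw [affinity, integral_prod_symm _ (integrable_exp_neg_half_incr hψ (gaussVec n τ))]
  rfl

lemma measurable_shiftAffinity (hψ : ψ ∈ potentials n) : Measurable (shiftAffinity ψ) := by
  have := isProbabilityMeasure_noiseLaw hψ
  have hc := continuous_potential hψ
  have hm : Measurable (fun z : Vec n × Vec n => Real.exp (-(ψ (z.2 + z.1) - ψ z.2) / 2)) := by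
    fun_prop
  exact (hm.stronglyMeasurable.integral_prod_right' (ν := noiseLaw ψ)).measurable

/-- Lengthening a translation by a factor slightly above one cannot increase the affinity much. -/
lemma shiftAffinity_smul_le (hψ : ψ ∈ potentials n) (v : Vec n) {s : ℝ} (h1 : 1 ≤ s)
    (h2 : s ≤ 2) : shiftAffinity ψ (s • v) ≤ shiftAffinity ψ v + (s - 1) := by
  have h := integrable_exp_neg_increment hψ v
  have hh := integrable_exp_neg_half_increment hψ v
  have : shiftAffinity ψ (s • v) ≤ ∫ x, ((2 - s) * Real.exp (-(ψ (x + v) - ψ x) / 2)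
      + (s - 1) * Real.exp (-(ψ (x + v) - ψ x))) ∂(noiseLaw ψ) := by
    refine integral_mono (integrable_exp_neg_half_increment hψ _)
      ((hh.const_mul _).add (h.1.const_mul _)) fun x => ?_
    have e1 : Real.exp (-(ψ (x + s • v) - ψ x) / 2)
        ≤ Real.exp ((2 - s) * (-(ψ (x + v) - ψ x) / 2) + (s - 1) * (-(ψ (x + v) - ψ x))) := by
      refine Real.exp_le_exp.2 ?_
      linarith [mul_increment_le hψ.1 x v h1]
    refine e1.trans ?_
    have := convexOn_exp.2 (Set.mem_univ (-(ψ (x + v) - ψ x) / 2))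
      (Set.mem_univ (-(ψ (x + v) - ψ x))) (show 0 ≤ 2 - s by linarith)
      (show 0 ≤ s - 1 by linarith) (by ring)
    simpa only [smul_eq_mul] using this
  rw [integral_add (hh.const_mul _) (h.1.const_mul _), integral_const_mul, integral_const_mul,
    h.2] at this
  have hA := shiftAffinity_nonneg (ψ := ψ) v
  have e : ∫ x, Real.exp (-(ψ (x + v) - ψ x) / 2) ∂(noiseLaw ψ) = shiftAffinity ψ v := rfl
  rw [e] at this
  nlinarith

/-- If the likelihood projection in direction `v` is close to the linear statistic
`⟪v, ∇ψ⟫`, the affinity is controlled by a truncated exponential moment of the latter. -/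
lemma shiftAffinity_le_of_ks (hψ : ψ ∈ potentials n) {v : Vec n} {a q M : ℝ}
    (hM : 0 < M) (hq : q ≤ v.ofLp ⬝ᵥ (fisher ψ *ᵥ v.ofLp))
    (hq2 : v.ofLp ⬝ᵥ (fisher ψ *ᵥ v.ofLp) ≤ 2)
    (h : ∀ s, |(noiseLaw ψ).real {x | likelihoodProj ψ v x ≤ s}
      - (noiseLaw ψ).real {x | (inner ℝ v (gradient ψ x) : ℝ) ≤ s}| ≤ a) :
    shiftAffinity ψ v ≤ Real.exp (-q / 4) *
      (∫ x, min (Real.exp (-(inner ℝ v (gradient ψ x) : ℝ) / 2)) M ∂(noiseLaw ψ)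
        + M * a + Real.exp 2 / M) := by
  have := isProbabilityMeasure_noiseLaw hψ
  have hc := continuous_potential hψ
  set Q := v.ofLp ⬝ᵥ (fisher ψ *ᵥ v.ofLp) with hQ
  have hmp : Measurable (likelihoodProj ψ v) := by unfold likelihoodProj; fun_prop
  have hmg : Measurable (fun x => (inner ℝ v (gradient ψ x) : ℝ)) :=
    measurable_const.inner (𝕜 := ℝ) measurable_gradient
  have h1 := integral_min_exp_le_of_abs_real_le_sub_le hmp hmg hM.le h
  have hie := integrable_exp_neg_increment hψ v
  have hih := integrable_exp_neg_half_increment hψ v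
  have e1 : ∀ x, Real.exp (-(likelihoodProj ψ v x) / 2)
      = Real.exp (Q / 4) * Real.exp (-(ψ (x + v) - ψ x) / 2) := by
    intro x; rw [← Real.exp_add, likelihoodProj]; congr 1; ring
  have e2 : ∀ x, Real.exp (-(likelihoodProj ψ v x) / 2) ^ 2
      = Real.exp (Q / 2) * Real.exp (-(ψ (x + v) - ψ x)) := by
    intro x; rw [sq_exp_neg_half, ← Real.exp_add, likelihoodProj]; congr 1; ring
  have hmin : Integrable (fun x => min (Real.exp (-(likelihoodProj ψ v x) / 2)) M)
      (noiseLaw ψ) :=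
    Integrable.of_bound (C := M) ((hmp.neg.div_const 2).exp.min
        measurable_const).aestronglyMeasurable (Eventually.of_forall fun x => by
          rw [Real.norm_eq_abs, abs_of_nonneg (le_min (Real.exp_pos _).le hM.le)]
          exact min_le_right _ _)
  have h2 : ∫ x, Real.exp (-(likelihoodProj ψ v x) / 2) ∂(noiseLaw ψ)
      ≤ ∫ x, (min (Real.exp (-(likelihoodProj ψ v x) / 2)) M
        + Real.exp (Q / 2) * Real.exp (-(ψ (x + v) - ψ x)) / M) ∂(noiseLaw ψ) := by
    refine integral_mono ?_ (hmin.add ((hie.1.const_mul _).div_const _)) fun x => ?_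
    · simp_rw [e1]; exact hih.const_mul _
    · simp only
      rw [← e2]
      set y := Real.exp (-(likelihoodProj ψ v x) / 2)
      have hy : 0 < y := Real.exp_pos _
      rcases le_total y M with hyM | hyM
      · rw [min_eq_left hyM]; have : 0 ≤ y ^ 2 / M := by positivity
        linarith
      · rw [min_eq_right hyM]
        have : y ≤ y ^ 2 / M := by rw [le_div_iff₀ hM]; nlinarith
        linarith
  rw [integral_add hmin ((hie.1.const_mul _).div_const _), integral_div, integral_const_mul, hie.2,
    mul_one] at h2
  have h3 : shiftAffinity ψ v
      = Real.exp (-Q / 4) * ∫ x, Real.exp (-(likelihoodProj ψ v x) / 2) ∂(noiseLaw ψ) := by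
    simp_rw [e1]
    rw [integral_const_mul, ← mul_assoc, ← Real.exp_add, shiftAffinity]
    simp [show -Q / 4 + Q / 4 = 0 by ring]
  rw [h3]
  have h4 : Real.exp (Q / 2) / M ≤ Real.exp 2 / M := by
    gcongr; linarith
  have h5 : 0 ≤ ∫ x, Real.exp (-(likelihoodProj ψ v x) / 2) ∂(noiseLaw ψ) :=
    integral_nonneg fun _ => (Real.exp_pos _).le
  exact mul_le_mul (Real.exp_le_exp.2 (by linarith)) (by linarith) h5 (Real.exp_pos _).le

end ShiftAffinity

/-! ### The affinity at the critical scale -/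

section Critical

variable {n : ℕ} {ψ : Vec n → ℝ}

lemma measurable_direction : Measurable (fun v : Vec n => ‖v‖⁻¹ • v) := by fun_prop

lemma integral_direction (hn : 0 < n) {τ : ℝ} (hτ : 0 < τ) {g : Vec n → ℝ} (hg : Measurable g) :
    ∫ v, g (‖v‖⁻¹ • v) ∂(gaussVec n τ) = ∫ v, g v ∂(sphereUnif n) := by
  rw [← gaussVec_map_direction hn hτ, integral_map measurable_direction.aemeasurable
    hg.aestronglyMeasurable]

lemma integral_exp_inner_gaussVec {τ : ℝ} (hτ : 0 < τ) (b : Vec n) :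
    Integrable (fun v => Real.exp (inner ℝ b v)) (gaussVec n τ) ∧
      ∫ v, Real.exp (inner ℝ b v) ∂(gaussVec n τ) = Real.exp (τ * ‖b‖ ^ 2 / 2) := by
  have h := integral_gaussVec_exp_inner_mul hτ b (fun _ => 1)
  simp only [mul_one, integral_const, probReal_univ, smul_eq_mul] at h
  refine ⟨?_, h⟩
  by_contra hni
  rw [integral_undef hni] at h
  exact (Real.exp_pos _).ne h

/-- A truncated exponential moment in a uniform direction is bounded by the corresponding Gaussian
exponential moment, by symmetry and monotonicity of `cosh`. -/
lemma integral_min_exp_direction_le {τ : ℝ} (hτ : 0 < τ) (b : Vec n) {M : ℝ} (hM : 0 ≤ M) :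
    ∫ v, min (Real.exp (-(inner ℝ (‖v‖⁻¹ • v) b : ℝ) / 2)) M ∂(gaussVec n τ)
      ≤ M * (gaussVec n τ).real {v | ‖v‖ < 1} + Real.exp (τ * ‖b‖ ^ 2 / 8) := by
  set γ := gaussVec n τ with hγ
  set D : Vec n → ℝ := fun v => inner ℝ (‖v‖⁻¹ • v) b with hD
  have hDm : Measurable D := measurable_direction.inner (𝕜 := ℝ) measurable_const
  have hi : ∀ s : ℝ, Integrable (fun v => min (Real.exp (s * D v / 2)) M) γ := fun s =>
    Integrable.of_bound (C := M) (by fun_prop) (Eventually.of_forall fun x => by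
      rw [Real.norm_eq_abs, abs_of_nonneg (le_min (Real.exp_pos _).le hM)]
      exact min_le_right _ _)
  have hsym : ∫ v, min (Real.exp (-1 * D v / 2)) M ∂γ = ∫ v, min (Real.exp (1 * D v / 2)) M ∂γ := by
    conv_lhs => rw [hγ, ← gaussVec_map_neg (n := n) hτ.le]
    rw [integral_map (by fun_prop) (by fun_prop)]
    simp only [hD, norm_neg, smul_neg, inner_neg_left, neg_mul, one_mul, neg_neg]
    rfl
  have e1 := integral_exp_inner_gaussVec hτ ((1 / 2 : ℝ) • b)
  have e2 := integral_exp_inner_gaussVec hτ ((-1 / 2 : ℝ) • b)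
  have hms : MeasurableSet {v : Vec n | ‖v‖ < 1} := measurableSet_lt (by fun_prop) (by fun_prop)
  have hind : Integrable ({v : Vec n | ‖v‖ < 1}.indicator (fun _ => 2 * M)) γ :=
    (integrable_const _).indicator hms
  have hle : ∫ v, (min (Real.exp (-1 * D v / 2)) M + min (Real.exp (1 * D v / 2)) M) ∂γ
      ≤ ∫ v, ({v : Vec n | ‖v‖ < 1}.indicator (fun _ => 2 * M) v
        + (Real.exp (inner ℝ ((1 / 2 : ℝ) • b) v) + Real.exp (inner ℝ ((-1 / 2 : ℝ) • b) v))) ∂γ := by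
    refine integral_mono ((hi _).fun_add (hi _)) (hind.fun_add (e1.1.fun_add e2.1)) fun v => ?_
    simp only
    by_cases hv : ‖v‖ < 1
    · rw [Set.indicator_of_mem (show v ∈ {v : Vec n | ‖v‖ < 1} from hv)]
      have := min_le_right (Real.exp (-1 * D v / 2)) M
      have := min_le_right (Real.exp (1 * D v / 2)) M
      have := Real.exp_pos (inner ℝ ((1 / 2 : ℝ) • b) v)
      have := Real.exp_pos (inner ℝ ((-1 / 2 : ℝ) • b) v)
      linarith
    · rw [Set.indicator_of_notMem (show v ∉ {v : Vec n | ‖v‖ < 1} from hv), zero_add]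
      push Not at hv
      set y : ℝ := inner ℝ b v with hy
      have hDy : D v = ‖v‖⁻¹ * y := by
        change (inner ℝ (‖v‖⁻¹ • v) b : ℝ) = _
        rw [hy, real_inner_smul_left, real_inner_comm]
      have habs : |D v / 2| ≤ |y / 2| := by
        rw [hDy, mul_div_assoc, abs_mul, abs_of_nonneg (by positivity)]
        exact mul_le_of_le_one_left (abs_nonneg _) (inv_le_one_of_one_le₀ hv)
      have hcosh := Real.cosh_le_cosh.2 habs
      rw [Real.cosh_eq, Real.cosh_eq] at hcosh
      have i1 : (inner ℝ ((1 / 2 : ℝ) • b) v : ℝ) = y / 2 := by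
        rw [real_inner_smul_left]; ring
      have i2 : (inner ℝ ((-1 / 2 : ℝ) • b) v : ℝ) = -(y / 2) := by
        rw [real_inner_smul_left]; ring
      rw [i1, i2]
      have k1 := min_le_left (Real.exp (-1 * D v / 2)) M
      have k2 := min_le_left (Real.exp (1 * D v / 2)) M
      have j1 : -1 * D v / 2 = -(D v / 2) := by ring
      have j2 : 1 * D v / 2 = D v / 2 := by ring
      rw [j1] at k1
      rw [j2] at k2
      rw [j1, j2]
      linarith
  rw [integral_add (hi _) (hi _), hsym, integral_add hind (e1.1.fun_add e2.1),
    integral_add e1.1 e2.1, e1.2, e2.2, integral_indicator hms, ← hsym] at hle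
  have n1 : τ * ‖(1 / 2 : ℝ) • b‖ ^ 2 / 2 = τ * ‖b‖ ^ 2 / 8 := by
    rw [norm_smul, mul_pow]; norm_num; ring
  have n2 : τ * ‖(-1 / 2 : ℝ) • b‖ ^ 2 / 2 = τ * ‖b‖ ^ 2 / 8 := by
    rw [norm_smul, mul_pow]; norm_num; ring
  rw [n1, n2] at hle
  simp only [neg_mul, one_mul, MeasureTheory.setIntegral_const, smul_eq_mul] at hle
  have : γ.real {v : Vec n | ‖v‖ < 1} * (2 * M) = 2 * (M * γ.real {v : Vec n | ‖v‖ < 1}) := by ring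
  linarith

/-- Bound for the affinity at scale `T` by the exponential moment of a standard Gaussian variable,
up to explicit error terms. -/
lemma affinity_le_of_ks (hψ : ψ ∈ potentials n) (hn : 0 < n) {T a q M r η : ℝ} (hT : 0 < T)
    (hM : 0 < M) (hη : 0 ≤ η) (hη1 : η ≤ 1) (ha : 0 ≤ a) {S : Set (Vec n)} (hS : MeasurableSet S)
    (hks : ∀ v ∈ S, q ≤ v.ofLp ⬝ᵥ (fisher ψ *ᵥ v.ofLp) ∧ v.ofLp ⬝ᵥ (fisher ψ *ᵥ v.ofLp) ≤ 2 ∧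
      ∀ s, |(noiseLaw ψ).real {x | likelihoodProj ψ v x ≤ s}
        - (noiseLaw ψ).real {x | (inner ℝ v (gradient ψ x) : ℝ) ≤ s}| ≤ a) :
    affinity ψ (T / n) ≤ η + (gaussVec n (T / n)).real {v | ‖v‖ < 1 ∨ 1 + η < ‖v‖}
      + (sphereUnif n).real Sᶜ + Real.exp (-q / 4) *
        (M * (gaussVec n (T / n)).real {v | ‖v‖ < 1} + M * (noiseLaw ψ).real {x | r < ‖score ψ x‖}
          + Real.exp (T * r ^ 2 / 8) + M * a + Real.exp 2 / M) := by
  have hP := isProbabilityMeasure_noiseLaw hψ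
  have hn0 : (0 : ℝ) < n := by exact_mod_cast hn
  have hτ : 0 < T / n := by positivity
  set γ := gaussVec n (T / n) with hγ
  have hσ : IsProbabilityMeasure (sphereUnif n) := by
    rw [← gaussVec_map_direction hn hτ]
    exact Measure.isProbabilityMeasure_map measurable_direction.aemeasurable
  set g : Vec n → ℝ := fun v =>
    ∫ x, min (Real.exp (-(inner ℝ v (gradient ψ x) : ℝ) / 2)) M ∂(noiseLaw ψ) with hg
  have hm2 : Measurable (fun z : Vec n × Vec n =>
      min (Real.exp (-(inner ℝ z.1 (gradient ψ z.2) : ℝ) / 2)) M) := by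
    have : Measurable (fun z : Vec n × Vec n => (inner ℝ z.1 (gradient ψ z.2) : ℝ)) :=
      measurable_fst.inner (𝕜 := ℝ) (measurable_gradient.comp measurable_snd)
    fun_prop
  have hgm : Measurable g :=
    (hm2.stronglyMeasurable.integral_prod_right' (ν := noiseLaw ψ)).measurable
  have hmin0 : ∀ y : ℝ, 0 ≤ min (Real.exp y) M := fun y => le_min (Real.exp_pos _).le hM.le
  have hg0 : ∀ v, 0 ≤ g v := fun v => integral_nonneg fun x => hmin0 _
  have hgM : ∀ v, g v ≤ M := by
    intro v
    have : g v ≤ ∫ _x, M ∂(noiseLaw ψ) := by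
      refine integral_mono_of_nonneg (Eventually.of_forall fun x => hmin0 _)
        (integrable_const _) (Eventually.of_forall fun x => min_le_right _ _)
    simpa using this
  set C := Real.exp (-q / 4) with hC
  have hC0 : 0 < C := Real.exp_pos _
  set bad : Set (Vec n) := {v | ‖v‖ < 1 ∨ 1 + η < ‖v‖} with hbad
  have hbadm : MeasurableSet bad :=
    (measurableSet_lt measurable_norm measurable_const).union
      (measurableSet_lt measurable_const measurable_norm)
  have hpt : ∀ v, shiftAffinity ψ v ≤ η + bad.indicator (fun _ => (1 : ℝ)) v
      + Sᶜ.indicator (fun _ => (1 : ℝ)) (‖v‖⁻¹ • v)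
      + C * (g (‖v‖⁻¹ • v) + (M * a + Real.exp 2 / M)) := by
    intro v
    have hrest : 0 ≤ C * (g (‖v‖⁻¹ • v) + (M * a + Real.exp 2 / M)) := by
      have := hg0 (‖v‖⁻¹ • v); positivity
    have hind : (0 : ℝ) ≤ Sᶜ.indicator (fun _ => (1 : ℝ)) (‖v‖⁻¹ • v) :=
      Set.indicator_nonneg (fun _ _ => zero_le_one) _
    by_cases hv : v ∈ bad
    · rw [Set.indicator_of_mem hv]
      linarith [shiftAffinity_le_one hψ v]
    · rw [Set.indicator_of_notMem hv]
      have hv' : 1 ≤ ‖v‖ ∧ ‖v‖ ≤ 1 + η := by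
        rw [hbad, Set.mem_ofPred_eq] at hv; push Not at hv; exact hv
      have hne : ‖v‖ ≠ 0 := by linarith [hv'.1]
      have h1 : shiftAffinity ψ v ≤ shiftAffinity ψ (‖v‖⁻¹ • v) + η := by
        have := shiftAffinity_smul_le hψ (‖v‖⁻¹ • v) hv'.1 (by linarith)
        rw [smul_smul, mul_inv_cancel₀ hne, one_smul] at this
        linarith [hv'.2]
      by_cases hs : ‖v‖⁻¹ • v ∈ S
      · rw [Set.indicator_of_notMem (by simpa using hs)]
        obtain ⟨k1, k2, k3⟩ := hks _ hs
        have := shiftAffinity_le_of_ks hψ hM k1 k2 k3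
        rw [add_assoc] at this
        change _ ≤ C * (g (‖v‖⁻¹ • v) + _) at this
        linarith
      · rw [Set.indicator_of_mem (by simpa using hs)]
        linarith [shiftAffinity_le_one hψ (‖v‖⁻¹ • v)]
  have hgi : Integrable (fun v => g (‖v‖⁻¹ • v)) γ :=
    Integrable.of_bound (C := M) (hgm.comp measurable_direction).aestronglyMeasurable
      (Eventually.of_forall fun v => by
        rw [Real.norm_eq_abs, abs_of_nonneg (hg0 _)]; exact hgM _)
  have hb1 : Integrable (bad.indicator (fun _ => (1 : ℝ))) γ := (integrable_const _).indicator hbadm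
  have hSm : Measurable (Sᶜ.indicator (fun _ => (1 : ℝ))) := measurable_const.indicator hS.compl
  have hb2 : Integrable (fun v : Vec n => Sᶜ.indicator (fun _ => (1 : ℝ)) (‖v‖⁻¹ • v)) γ :=
    Integrable.of_bound (C := 1) (hSm.comp measurable_direction).aestronglyMeasurable
      (Eventually.of_forall fun v => by
        by_cases hs : ‖v‖⁻¹ • v ∈ Sᶜ <;> simp [hs, Set.indicator])
  have hAi : Integrable (shiftAffinity ψ) γ :=
    Integrable.of_bound (C := 1) (measurable_shiftAffinity hψ).aestronglyMeasurable
      (Eventually.of_forall fun v => by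
        rw [Real.norm_eq_abs, abs_of_nonneg (shiftAffinity_nonneg _)]
        exact shiftAffinity_le_one hψ v)
  have hint := integral_mono hAi ((((integrable_const η).fun_add hb1).fun_add hb2).fun_add
    ((hgi.fun_add (integrable_const (M * a + Real.exp 2 / M))).const_mul C)) hpt
  rw [← affinity_eq_integral_shiftAffinity hψ] at hint
  rw [integral_add (((integrable_const η).fun_add hb1).fun_add hb2)
    ((hgi.fun_add (integrable_const (M * a + Real.exp 2 / M))).const_mul C),
    integral_add ((integrable_const η).fun_add hb1) hb2,
    integral_add (integrable_const η) hb1, integral_const_mul,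
    integral_add hgi (integrable_const _), integral_direction hn hτ hSm,
    integral_indicator hbadm, integral_indicator hS.compl] at hint
  simp only [integral_const, probReal_univ, smul_eq_mul, one_mul, mul_one,
    measureReal_restrict_apply_univ] at hint
  have hfub : ∫ v, g (‖v‖⁻¹ • v) ∂γ = ∫ x, (∫ v, min (Real.exp
      (-(inner ℝ (‖v‖⁻¹ • v) (gradient ψ x) : ℝ) / 2)) M ∂γ) ∂(noiseLaw ψ) := by
    simp only [hg]
    refine integral_integral_swap (f := fun v x => min (Real.exp
      (-(inner ℝ (‖v‖⁻¹ • v) (gradient ψ x) : ℝ) / 2)) M) ?_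
    refine Integrable.of_bound (C := M) ?_ (Eventually.of_forall fun z => ?_)
    · exact (hm2.comp (by fun_prop : Measurable fun z : Vec n × Vec n =>
        (‖z.1‖⁻¹ • z.1, z.2))).aestronglyMeasurable
    · simp only [Function.uncurry]
      rw [Real.norm_eq_abs, abs_of_nonneg (hmin0 _)]
      exact min_le_right _ _
  have hRm : MeasurableSet {x | r < ‖score ψ x‖} :=
    measurableSet_lt measurable_const measurable_score.norm
  have hgle : ∫ v, g (‖v‖⁻¹ • v) ∂γ ≤ M * γ.real {v | ‖v‖ < 1}
      + M * (noiseLaw ψ).real {x | r < ‖score ψ x‖} + Real.exp (T * r ^ 2 / 8) := by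
    rw [hfub]
    have hpx : ∀ x, ∫ v, min (Real.exp (-(inner ℝ (‖v‖⁻¹ • v) (gradient ψ x) : ℝ) / 2)) M ∂γ
        ≤ M * γ.real {v | ‖v‖ < 1} + {x | r < ‖score ψ x‖}.indicator (fun _ => M) x
          + Real.exp (T * r ^ 2 / 8) := by
      intro x
      have hmr : 0 ≤ M * γ.real {v | ‖v‖ < 1} := by positivity
      have he := Real.exp_pos (T * r ^ 2 / 8)
      by_cases hx : r < ‖score ψ x‖
      · rw [Set.indicator_of_mem (show x ∈ {x | r < ‖score ψ x‖} from hx)]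
        have : ∫ v, min (Real.exp (-(inner ℝ (‖v‖⁻¹ • v) (gradient ψ x) : ℝ) / 2)) M ∂γ
            ≤ ∫ _v, M ∂γ :=
          integral_mono_of_nonneg (Eventually.of_forall fun x => hmin0 _)
            (integrable_const _) (Eventually.of_forall fun x => min_le_right _ _)
        simp only [integral_const, probReal_univ, smul_eq_mul, one_mul] at this
        linarith
      · rw [Set.indicator_of_notMem (show x ∉ {x | r < ‖score ψ x‖} from hx), add_zero]
        refine (integral_min_exp_direction_le hτ (gradient ψ x) hM.le).trans ?_
        refine add_le_add le_rfl (Real.exp_le_exp.2 ?_)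
        push Not at hx
        have h2 : ‖gradient ψ x‖ ^ 2 = n * ‖score ψ x‖ ^ 2 := by
          rw [sq_norm_score]; field_simp
        have h3 : ‖score ψ x‖ ^ 2 ≤ r ^ 2 := pow_le_pow_left₀ (norm_nonneg _) hx 2
        rw [h2]
        have : T / n * (n * ‖score ψ x‖ ^ 2) / 8 = T * ‖score ψ x‖ ^ 2 / 8 := by field_simp
        rw [this]
        gcongr
    have hi1 : Integrable ({x | r < ‖score ψ x‖}.indicator (fun _ => M)) (noiseLaw ψ) :=
      (integrable_const _).indicator hRm
    have := integral_mono_of_nonneg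
      (Eventually.of_forall fun x => integral_nonneg fun v => hmin0 _)
      (((integrable_const (M * γ.real {v | ‖v‖ < 1})).fun_add hi1).fun_add
        (integrable_const (Real.exp (T * r ^ 2 / 8)))) (Eventually.of_forall hpx)
    rw [integral_add ((integrable_const _).fun_add hi1) (integrable_const _),
      integral_add (integrable_const _) hi1, integral_indicator hRm] at this
    simp only [integral_const, probReal_univ, smul_eq_mul, one_mul,
      measureReal_restrict_apply_univ] at this
    linarith
  have := mul_le_mul_of_nonneg_left hgle hC0.le
  nlinarith

end Critical

/-! ### Asymptotically regular sequences of potentials -/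

/-- Sequences of potentials, in dimensions tending to infinity, for which the hypotheses of the
central limit theorem hold: in most directions the likelihood projection is close to the linear
statistic `⟪v, ∇ψ⟫`, the normalized score has norm close to one, and the Fisher information is
close to the identity. -/
structure AsympRegular (d : ℕ → ℕ) (ψ : (k : ℕ) → Vec (d k) → ℝ) : Prop where
  mem : ∀ k, ψ k ∈ potentials (d k)
  pos : ∀ k, 0 < d k
  dim : Tendsto d atTop atTop
  ks : ∀ a > 0, ∀ᶠ k in atTop, 1 - a ≤ (sphereUnif (d k)).real
    {v | ksDist (noiseLaw (ψ k)) (likelihoodProj (ψ k) v)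
      (fun x => inner ℝ v (gradient (ψ k) x)) ≤ a}
  norm_score : ∀ ε > 0,
    Tendsto (fun k => (noiseLaw (ψ k)).real {x | ε ≤ |‖score (ψ k) x‖ - 1|}) atTop (𝓝 0)
  fisher : Tendsto (fun k => opNorm (fisher (ψ k) - 1)) atTop (𝓝 0)

lemma opNorm_nonneg {n : ℕ} (A : Matrix (Fin n) (Fin n) ℝ) : 0 ≤ opNorm A := norm_nonneg _

lemma isProbabilityMeasure_sphereUnif {n : ℕ} (hn : 0 < n) :
    IsProbabilityMeasure (sphereUnif n) := by
  rw [← gaussVec_map_direction hn one_pos]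
  exact Measure.isProbabilityMeasure_map measurable_direction.aemeasurable

lemma sphereUnif_compl_sphere (n : ℕ) : (sphereUnif n) (Metric.sphere (0 : Vec n) 1)ᶜ = 0 := by
  rw [sphereUnif, Measure.map_apply measurable_subtype_coe Metric.isClosed_sphere.measurableSet.compl]
  have : (Subtype.val : Metric.sphere (0 : Vec n) 1 → Vec n) ⁻¹' (Metric.sphere 0 1)ᶜ = ∅ := by
    ext x; simp
  rw [this, measure_empty]

lemma integral_sq_norm_sub_clip_le {n : ℕ} {ψ : Vec n → ℝ} (hψ : ψ ∈ potentials n) {δ : ℝ}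
    (hδ : 0 < δ) :
    ∫ x, ‖score ψ x - clip (score ψ x)‖ ^ 2 ∂(noiseLaw ψ)
      ≤ (∫ x, ‖score ψ x‖ ^ 2 ∂(noiseLaw ψ) - 1) + 2 * δ
        + (noiseLaw ψ).real {x | δ ≤ |‖score ψ x‖ - 1|} := by
  have := isProbabilityMeasure_noiseLaw hψ
  set R : Set (Vec n) := {x | δ ≤ |‖score ψ x‖ - 1|} with hR
  have hms : MeasurableSet R :=
    measurableSet_le measurable_const (measurable_score.norm.sub_const 1).abs
  have hi := integrable_sq_norm_score hψ
  have hi2 : Integrable (R.indicator (fun _ => (1 : ℝ))) (noiseLaw ψ) :=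
    (integrable_const _).indicator hms
  have hi3 : Integrable (fun x => ‖score ψ x‖ ^ 2 - 1) (noiseLaw ψ) := hi.sub (integrable_const 1)
  have hi4 : Integrable (fun x => ‖score ψ x‖ ^ 2 - 1 + 2 * δ) (noiseLaw ψ) :=
    hi3.fun_add (integrable_const _)
  have hpt : ∀ x, ‖score ψ x - clip (score ψ x)‖ ^ 2
      ≤ ‖score ψ x‖ ^ 2 - 1 + 2 * δ + R.indicator (fun _ => (1 : ℝ)) x := by
    intro x
    rw [norm_sub_clip]
    have hr0 : 0 ≤ ‖score ψ x‖ := norm_nonneg _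
    by_cases hx : x ∈ R
    · rw [Set.indicator_of_mem hx]
      generalize ‖score ψ x‖ = r at *
      rcases le_total (r - 1) 0 with h0 | h0
      · rw [max_eq_right h0]; nlinarith
      · rw [max_eq_left h0]; nlinarith
    · rw [Set.indicator_of_notMem hx]
      have hx' : |‖score ψ x‖ - 1| < δ := not_le.1 hx
      have := abs_lt.1 hx'
      generalize ‖score ψ x‖ = r at *
      rcases le_total (r - 1) 0 with h0 | h0
      · rw [max_eq_right h0]; nlinarith
      · rw [max_eq_left h0]; nlinarith
  refine (integral_mono_of_nonneg (Eventually.of_forall fun x => sq_nonneg _) (hi4.fun_add hi2)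
    (Eventually.of_forall hpt)).trans (le_of_eq ?_)
  rw [integral_add hi4 hi2, integral_add hi3 (integrable_const _),
    integral_sub hi (integrable_const 1), integral_indicator hms]
  simp

namespace AsympRegular

variable {d : ℕ → ℕ} {ψ : (k : ℕ) → Vec (d k) → ℝ}

lemma isProbabilityMeasure (h : AsympRegular d ψ) (k : ℕ) :
    IsProbabilityMeasure (noiseLaw (ψ k)) := isProbabilityMeasure_noiseLaw (h.mem k)

lemma tendsto_integral_sq_norm_score (h : AsympRegular d ψ) :
    Tendsto (fun k => ∫ x, ‖score (ψ k) x‖ ^ 2 ∂(noiseLaw (ψ k))) atTop (𝓝 1) := by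
  rw [tendsto_iff_norm_sub_tendsto_zero]
  exact squeeze_zero (fun _ => norm_nonneg _)
    (fun k => abs_integral_sq_norm_score_sub_one_le (h.mem k) (h.pos k)) h.fisher

lemma tendsto_integral_sq_norm_sub_clip (h : AsympRegular d ψ) :
    Tendsto (fun k => ∫ x, ‖score (ψ k) x - clip (score (ψ k) x)‖ ^ 2 ∂(noiseLaw (ψ k)))
      atTop (𝓝 0) := by
  have hb := fun (δ : ℝ) (hδ : 0 < δ) k => integral_sq_norm_sub_clip_le (h.mem k) hδ
  rw [Metric.tendsto_nhds]
  intro ε hε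
  have e1 : Tendsto (fun k => (∫ x, ‖score (ψ k) x‖ ^ 2 ∂(noiseLaw (ψ k)) - 1) + 2 * (ε / 4)
        + (noiseLaw (ψ k)).real {x | ε / 4 ≤ |‖score (ψ k) x‖ - 1|}) atTop
        (𝓝 ((1 - 1) + 2 * (ε / 4) + 0)) :=
    ((h.tendsto_integral_sq_norm_score.sub_const 1).add_const _).add
      (h.norm_score (ε / 4) (by positivity))
  filter_upwards [e1.eventually_lt_const (show (1 - 1) + 2 * (ε / 4) + 0 < ε by linarith)] with k hk
  rw [Real.dist_eq, sub_zero, abs_of_nonneg (integral_nonneg fun _ => sq_nonneg _)]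
  exact (hb (ε / 4) (by positivity) k).trans_lt hk

lemma tendsto_clipError (h : AsympRegular d ψ) :
    Tendsto (fun k => clipError (ψ k)) atTop (𝓝 0) := by
  have h1 := (Real.continuous_sqrt.tendsto 0).comp h.tendsto_integral_sq_norm_sub_clip
  have h2 := (Real.continuous_sqrt.tendsto 1).comp h.tendsto_integral_sq_norm_score
  have := h1.mul (h2.add_const 1)
  rw [Real.sqrt_zero, zero_mul] at this
  exact this

/-- In most directions, uniform closeness of the likelihood projection and the linear statistic. -/
lemma eventually_exists_directions (h : AsympRegular d ψ) {a : ℝ} (ha : 0 < a) :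
    ∀ᶠ k in atTop, ∃ S : Set (Vec (d k)), MeasurableSet S ∧ (sphereUnif (d k)).real Sᶜ ≤ a ∧
      ∀ v ∈ S, ‖v‖ = 1 ∧ |v.ofLp ⬝ᵥ (GDP.fisher (ψ k) *ᵥ v.ofLp) - 1| ≤ a ∧
        ∀ s, |(noiseLaw (ψ k)).real {x | likelihoodProj (ψ k) v x ≤ s}
          - (noiseLaw (ψ k)).real {x | (inner ℝ v (gradient (ψ k) x) : ℝ) ≤ s}| ≤ a := by
  filter_upwards [h.ks a ha, h.fisher.eventually_le_const ha] with k hk hf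
  have := h.isProbabilityMeasure k
  have := isProbabilityMeasure_sphereUnif (h.pos k)
  have hc := continuous_potential (h.mem k)
  have hm1 : ∀ v, Measurable (likelihoodProj (ψ k) v) := by
    intro v; unfold likelihoodProj; fun_prop
  have hm2 : ∀ v : Vec (d k), Measurable (fun x => (inner ℝ v (gradient (ψ k) x) : ℝ)) :=
    fun v => measurable_const.inner (𝕜 := ℝ) measurable_gradient
  have hq : Continuous fun v : Vec (d k) => v.ofLp ⬝ᵥ (GDP.fisher (ψ k) *ᵥ v.ofLp) := by
    fun_prop
  set S₀ : Set (Vec (d k)) := {v | ∀ q : ℚ,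
    |(noiseLaw (ψ k)).real {x | likelihoodProj (ψ k) v x ≤ q}
          - (noiseLaw (ψ k)).real {x | (inner ℝ v (gradient (ψ k) x) : ℝ) ≤ q}| ≤ a} with hS₀
  have hS₀m : MeasurableSet S₀ := by
    rw [hS₀, Set.ofPred_forall]
    refine MeasurableSet.iInter fun q => ?_
    have k1 : MeasurableSet {z : Vec (d k) × Vec (d k) | likelihoodProj (ψ k) z.2 z.1 ≤ q} := by
      refine measurableSet_le ?_ measurable_const
      have := hq.comp (continuous_snd (X := Vec (d k)) (Y := Vec (d k)))
      unfold likelihoodProj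
      exact Continuous.measurable (((hc.comp (continuous_fst.add continuous_snd)).sub
        (hc.comp continuous_fst)).sub (this.const_mul (1 / 2)))
    have k2 : MeasurableSet {z : Vec (d k) × Vec (d k) |
        (inner ℝ z.2 (gradient (ψ k) z.1) : ℝ) ≤ q} :=
      measurableSet_le (measurable_snd.inner (𝕜 := ℝ) (measurable_gradient.comp measurable_fst))
        measurable_const
    exact measurableSet_le ((measurable_measureReal_section (noiseLaw (ψ k)) k1).sub
      (measurable_measureReal_section (noiseLaw (ψ k)) k2)).abs measurable_const
  refine ⟨S₀ ∩ Metric.sphere 0 1, hS₀m.inter Metric.isClosed_sphere.measurableSet, ?_, ?_⟩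
  · have hle : 1 - a ≤ (sphereUnif (d k)).real S₀ := by
      refine hk.trans (measureReal_mono fun v hv q => ?_)
      exact (abs_real_le_sub_le_ksDist _).trans hv
    rw [Set.compl_inter]
    refine (measureReal_union_le _ _).trans ?_
    have e0 : (sphereUnif (d k)).real (Metric.sphere (0 : Vec (d k)) 1)ᶜ = 0 := by
      rw [measureReal_def, sphereUnif_compl_sphere, ENNReal.toReal_zero]
    rw [e0, measureReal_compl hS₀m, probReal_univ]
    linarith
  · rintro v ⟨hv, hv1⟩
    have hv1' : ‖v‖ = 1 := by simpa using hv1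
    refine ⟨hv1', ?_, fun s => abs_real_le_sub_le_of_forall_rat (hm1 v) (hm2 v) hv s⟩
    have := abs_fisher_quadratic_sub_le (ψ := ψ k) v
    rw [hv1'] at this
    simp only [one_pow, mul_one] at this
    exact this.trans hf

/-- The affinity at the critical scale is asymptotically at most the affinity `exp (-1/8)` of
Gaussian laws with means at distance one. -/
lemma eventually_affinity_one_le (h : AsympRegular d ψ) {ε : ℝ} (hε : 0 < ε) :
    ∀ᶠ k in atTop, affinity (ψ k) (1 / d k) ≤ Real.exp (-1 / 8) + ε := by
  -- The affinity is estimated at the scale `(1 + e) ^ 2`, where the Gaussian vector is typically longer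
  -- than one; the truncation level `e⁻¹` is far below the inverse of the errors, which are `e ^ 2`.
  set B : ℝ → ℝ := fun e => 3 * e + e + e + Real.exp (-(1 - e) / 4) *
    (e + e + Real.exp ((1 + e) ^ 2 * (1 + e) ^ 2 / 8) + e + Real.exp 2 * e) with hB
  have hcont : Continuous fun e => Real.exp (((1 + e) ^ 2 - 1) / 8) * (B e + e) := by
    rw [hB]; fun_prop
  have h0 : Real.exp (((1 + (0 : ℝ)) ^ 2 - 1) / 8) * (B 0 + 0) = Real.exp (-1 / 8) := by
    simp only [hB]
    have : Real.exp (-1 / 8) = Real.exp (-1 / 4) * Real.exp (1 / 8) := by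
      rw [← Real.exp_add]; norm_num
    rw [this]; norm_num
  obtain ⟨e, he0, he1, he⟩ : ∃ e : ℝ, 0 < e ∧ e ≤ 1 / 3 ∧
      Real.exp (((1 + e) ^ 2 - 1) / 8) * (B e + e) < Real.exp (-1 / 8) + ε := by
    have ht : Tendsto (fun e => Real.exp (((1 + e) ^ 2 - 1) / 8) * (B e + e)) (𝓝[>] 0)
        (𝓝 (Real.exp (-1 / 8))) := by
      rw [← h0]; exact (hcont.tendsto 0).mono_left nhdsWithin_le_nhds
    have e1 := ht.eventually_lt_const (show Real.exp (-1 / 8) < Real.exp (-1 / 8) + ε by linarith)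
    have e2 : ∀ᶠ e : ℝ in 𝓝[>] 0, e ∈ Set.Ioc (0 : ℝ) (1 / 3) :=
      Ioc_mem_nhdsGT (by norm_num)
    obtain ⟨e, h1, h2⟩ := (e1.and e2).exists
    exact ⟨e, h2.1, h2.2, h1⟩
  have hT : (0 : ℝ) < (1 + e) ^ 2 := by positivity
  have hnorm := (tendsto_gaussVec_norm_sq h.dim hT (show 0 < 2 * e by positivity)).eventually_le_const
    (show 0 < e ^ 2 by positivity)
  have hsc := (h.norm_score e he0).eventually_le_const (show 0 < e ^ 2 by positivity)
  have hdec := eventually_mul_exp_le_of_decay (κ := fun k t => affinity (ψ k) (t / d k))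
    h.tendsto_clipError (fun k t => affinity_le_one (h.mem k) _) (fun k t => affinity_nonneg _)
    (fun k t s ht hs => (affinity_sub_le (h.mem k) (h.pos k) ht hs).trans
      (mul_le_mul_of_nonneg_left (add_le_add_left (scoreAffinity_le_affinity (h.mem k) _) _)
        (by positivity))) (t := 1) (s := (1 + e) ^ 2 - 1) zero_le_one (by nlinarith) he0
  filter_upwards [hnorm, hsc, hdec, h.eventually_exists_directions (show 0 < e ^ 2 by positivity)]
    with k k1 k2 k3 k4
  obtain ⟨S, hS, hSa, hks⟩ := k4
  have := h.isProbabilityMeasure k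
  have he2 : e ^ 2 ≤ e := by nlinarith
  have hmain := affinity_le_of_ks (h.mem k) (h.pos k) (T := (1 + e) ^ 2) (a := e ^ 2)
    (q := 1 - e) (M := e⁻¹) (r := 1 + e) (η := 3 * e) hT (by positivity) (by positivity)
    (by linarith) (by positivity) hS (fun v hv => by
      obtain ⟨_, g2, g3⟩ := hks v hv
      have := abs_le.1 g2
      exact ⟨by linarith, by linarith, g3⟩)
  have b1 : (gaussVec (d k) ((1 + e) ^ 2 / d k)).real {v | ‖v‖ < 1 ∨ 1 + 3 * e < ‖v‖} ≤ e ^ 2 := by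
    refine (measureReal_mono fun v hv => ?_).trans k1
    have hv0 := norm_nonneg v
    rw [Set.mem_ofPred_eq, le_abs]
    rcases hv with hv | hv
    · right; nlinarith
    · left; nlinarith
  have b2 : (gaussVec (d k) ((1 + e) ^ 2 / d k)).real {v | ‖v‖ < 1} ≤ e ^ 2 :=
    (measureReal_mono fun v hv => Or.inl hv).trans b1
  have b3 : (noiseLaw (ψ k)).real {x | 1 + e < ‖score (ψ k) x‖} ≤ e ^ 2 := by
    refine (measureReal_mono fun x hx => ?_).trans k2
    rw [Set.mem_ofPred_eq, le_abs]
    rw [Set.mem_ofPred_eq] at hx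
    left; linarith
  have hinv : e⁻¹ * e ^ 2 = e := by field_simp
  have hle : affinity (ψ k) ((1 + e) ^ 2 / d k) ≤ B e := by
    refine hmain.trans ?_
    have i1 := mul_le_mul_of_nonneg_left b2 (show 0 ≤ e⁻¹ by positivity)
    have i2 := mul_le_mul_of_nonneg_left b3 (show 0 ≤ e⁻¹ by positivity)
    rw [hinv] at i1 i2
    have i3 : Real.exp 2 / e⁻¹ = Real.exp 2 * e := by rw [div_inv_eq_mul]
    rw [hB, i3, hinv]
    simp only
    gcongr
    · linarith
    · linarith
  have hfin : affinity (ψ k) (1 / d k) * Real.exp (-((1 + e) ^ 2 - 1) / 8) ≤ B e + e := by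
    have e1 : (1 : ℝ) + ((1 + e) ^ 2 - 1) = (1 + e) ^ 2 := by ring
    simp only [e1] at k3
    linarith
  have hx := mul_le_mul_of_nonneg_left hfin (Real.exp_pos (((1 + e) ^ 2 - 1) / 8)).le
  have e3 : Real.exp (((1 + e) ^ 2 - 1) / 8) *
      (affinity (ψ k) (1 / d k) * Real.exp (-((1 + e) ^ 2 - 1) / 8)) = affinity (ψ k) (1 / d k) := by
    rw [mul_left_comm, ← Real.exp_add]
    have : ((1 + e) ^ 2 - 1) / 8 + -((1 + e) ^ 2 - 1) / 8 = 0 := by ring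
    rw [this, Real.exp_zero, mul_one]
  rw [e3] at hx
  linarith

/-- Below the critical scale, the scores at the two points are asymptotically aligned. -/
lemma eventually_affinity_sub_scoreAffinity_le (h : AsympRegular d ψ) {t : ℝ} (ht : 0 ≤ t)
    (ht1 : t < 1) {ε : ℝ} (hε : 0 < ε) :
    ∀ᶠ k in atTop, affinity (ψ k) (t / d k) - scoreAffinity (ψ k) (t / d k) ≤ ε :=
  eventually_sub_le_of_extremal_decay (κ := fun k t => affinity (ψ k) (t / d k))
    (ρ := fun k t => scoreAffinity (ψ k) (t / d k)) h.tendsto_clipError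
    (fun k => by simpa using affinity_zero (h.mem k)) (fun k t => affinity_le_one (h.mem k) _)
    (fun k t => affinity_nonneg _) (fun k t => scoreAffinity_le_affinity (h.mem k) _)
    (fun k t s ht hs => affinity_sub_le (h.mem k) (h.pos k) ht hs)
    (fun _ hε => h.eventually_affinity_one_le hε) ht ht1 hε

/-- The Gaussian lower bound on the affinity. -/
lemma eventually_exp_sub_le_affinity (h : AsympRegular d ψ) {t : ℝ} (ht : 0 ≤ t) {ε : ℝ}
    (hε : 0 < ε) : ∀ᶠ k in atTop, Real.exp (-t / 8) - ε ≤ affinity (ψ k) (t / d k) := by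
  have := eventually_mul_exp_le_of_decay (κ := fun k t => affinity (ψ k) (t / d k))
    h.tendsto_clipError (fun k t => affinity_le_one (h.mem k) _) (fun k t => affinity_nonneg _)
    (fun k t s ht hs => (affinity_sub_le (h.mem k) (h.pos k) ht hs).trans
      (mul_le_mul_of_nonneg_left (add_le_add_left (scoreAffinity_le_affinity (h.mem k) _) _)
        (by positivity))) (t := 0) (s := t) le_rfl ht hε
  filter_upwards [this] with k hk
  have e : affinity (ψ k) (0 / d k) = 1 := by rw [zero_div]; exact affinity_zero (h.mem k)
  simp only [e, zero_add, one_mul] at hk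
  exact hk

end AsympRegular

/-! ### Linearization of the log-likelihood ratio by Gaussian translation -/

section Linearization

variable {n : ℕ} {ψ : Vec n → ℝ}

/-- A set that is unlikely for a Gaussian vector remains unlikely after a translation by a vector of
the Cameron-Martin space. -/
lemma gaussVec_real_add_mem_le {τ : ℝ} (hτ : 0 < τ) (b : Vec n) {B : Set (Vec n)}
    (hB : MeasurableSet B) :
    (gaussVec n τ).real {v | v + τ • b ∈ B}
      ≤ Real.exp (τ * ‖b‖ ^ 2 / 2) * Real.sqrt ((gaussVec n τ).real B) := by
  have h := integral_gaussVec_exp_inner_mul hτ b (B.indicator (fun _ => (1 : ℝ)))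
  have hB' : MeasurableSet {v | v + τ • b ∈ B} :=
    (show Measurable (fun v : Vec n => v + τ • b) by fun_prop) hB
  have e1 : ∀ v, B.indicator (fun _ => (1 : ℝ)) (v + τ • b)
      = {v | v + τ • b ∈ B}.indicator (fun _ => (1 : ℝ)) v := fun v => rfl
  simp_rw [e1] at h
  rw [integral_indicator hB'] at h
  simp only [integral_const, smul_eq_mul, mul_one, measureReal_restrict_apply_univ] at h
  have h2 := integral_exp_inner_gaussVec hτ ((2 : ℝ) • b)
  have e2 : ∀ v, Real.exp (inner ℝ ((2 : ℝ) • b) v) = Real.exp (inner ℝ b v) ^ 2 := by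
    intro v; rw [real_inner_smul_left, ← Real.exp_nat_mul]; norm_num
  simp_rw [e2] at h2
  have m1 : MemLp (fun v => Real.exp (inner ℝ b v)) 2 (gaussVec n τ) :=
    (memLp_two_iff_integrable_sq (by fun_prop)).2 h2.1
  have m2 : MemLp (B.indicator (fun _ => (1 : ℝ))) 2 (gaussVec n τ) :=
    (memLp_const 1).indicator hB
  have h3 := integral_mul_le_sqrt_mul_sqrt m1 m2
  have e3 : ∀ v, B.indicator (fun _ => (1 : ℝ)) v ^ 2 = B.indicator (fun _ => (1 : ℝ)) v := by
    intro v; by_cases hv : v ∈ B <;> simp [hv]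
  simp_rw [e3] at h3
  rw [integral_indicator hB, h2.2, h] at h3
  simp only [integral_const, smul_eq_mul, mul_one, measureReal_restrict_apply_univ] at h3
  have e4 : Real.sqrt (Real.exp (τ * ‖(2 : ℝ) • b‖ ^ 2 / 2))
      = Real.exp (τ * ‖b‖ ^ 2 / 2) * Real.exp (τ * ‖b‖ ^ 2 / 2) := by
    rw [norm_smul, mul_pow, ← Real.exp_add, ← Real.exp_half]
    norm_num
    ring
  rw [e4, mul_assoc] at h3
  exact le_of_mul_le_mul_left h3 (Real.exp_pos _)

/-- The translation by which the linear statistic `-⟪v, ∇ψ x⟫ / 2` tilts the law of `v`. -/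
def tiltShift (ψ : Vec n → ℝ) (τ : ℝ) (x : Vec n) : Vec n := τ • (-(1 / 2 : ℝ)) • gradient ψ x

lemma measurable_tiltShift (τ : ℝ) : Measurable (tiltShift ψ τ) :=
  (measurable_gradient.const_smul (-(1 / 2 : ℝ))).const_smul τ

lemma gaussVec_ae_differentiableAt (hψ : ψ ∈ potentials n) {τ : ℝ} (hτ : 0 < τ) (y : Vec n) :
    ∀ᵐ v ∂(gaussVec n τ), DifferentiableAt ℝ ψ (y + v) :=
  (gaussVec_absolutelyContinuous hτ).ae_le
    ((measurePreserving_add_left volume y).quasiMeasurePreserving.ae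
      (ae_differentiableAt_of_convexOn hψ.1))

lemma inner_gradient_gradient (hn : 0 < n) (x y : Vec n) :
    (inner ℝ (gradient ψ x) (gradient ψ y) : ℝ) = n * inner ℝ (score ψ x) (score ψ y) := by
  have hn0 : (0 : ℝ) ≤ n := Nat.cast_nonneg _
  rw [gradient_eq_smul_score hn x, gradient_eq_smul_score hn y, real_inner_smul_left,
    real_inner_smul_right, ← mul_assoc, Real.mul_self_sqrt hn0]

/-- The translated points at which the scores at both ends of the increment are aligned. -/
def alignedSet (ψ : Vec n → ℝ) (τ c : ℝ) (R : Set (Vec n)) : Set (Vec n × Vec n) :=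
  {z | z.1 ∈ R ∧ c ≤ inner ℝ (score ψ z.1) (score ψ (z.1 + (z.2 + tiltShift ψ τ z.1)))}

lemma measurableSet_alignedSet (τ c : ℝ) {R : Set (Vec n)} (hR : MeasurableSet R) :
    MeasurableSet (alignedSet ψ τ c R) := by
  have h1 : Measurable (fun z : Vec n × Vec n => z.1 + (z.2 + tiltShift ψ τ z.1)) := by
    have := (measurable_tiltShift (ψ := ψ) τ).comp (measurable_fst : Measurable (Prod.fst : Vec n × Vec n → Vec n))
    exact measurable_fst.add (measurable_snd.add this)
  exact (measurable_fst hR).inter (measurableSet_le measurable_const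
    ((measurable_score.comp measurable_fst).inner (𝕜 := ℝ) (measurable_score.comp h1)))

/-- Lower bound for the cross term between `exp (-L / 2)` and `exp (-⟪v, ∇ψ x⟫ / 2)`, at a fixed base
point `x`: the second factor tilts the Gaussian law of `v` and so shifts it by `tiltShift ψ τ x`, and
convexity bounds the effect of the shift on the increment `L` by the inner product of the scores at
the two ends. -/
lemma integral_alignedSet_section_le (hψ : ψ ∈ potentials n) (hn : 0 < n) {t c r : ℝ}
    (ht : 0 < t) (hr : 0 ≤ r) (x : Vec n) (hx : r ≤ ‖score ψ x‖)
    (hi : Integrable (fun v => Real.exp (-(inner ℝ v (gradient ψ x) : ℝ) / 2) *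
      Real.exp (-(ψ (x + v) - ψ x) / 2)) (gaussVec n (t / n))) :
    Real.exp (t * r ^ 2 / 8 + t * c / 4) * ∫ v,
      {v | c ≤ (inner ℝ (score ψ x) (score ψ (x + (v + tiltShift ψ (t / n) x))) : ℝ)}.indicator
        (fun v => Real.exp (-(ψ (x + v) - ψ x) / 2)) v ∂(gaussVec n (t / n))
      ≤ ∫ v, Real.exp (-(inner ℝ v (gradient ψ x) : ℝ) / 2) *
        Real.exp (-(ψ (x + v) - ψ x) / 2) ∂(gaussVec n (t / n)) := by
  have hn0 : (0 : ℝ) < n := by exact_mod_cast hn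
  have hτ : 0 < t / n := by positivity
  set τ := t / n with hτdef
  set b : Vec n := (-(1 / 2 : ℝ)) • gradient ψ x with hb
  have e1 : ∀ v, Real.exp (-(inner ℝ v (gradient ψ x) : ℝ) / 2) = Real.exp (inner ℝ b v) := by
    intro v; rw [hb, real_inner_smul_left, real_inner_comm]; congr 1; ring
  simp_rw [e1] at hi ⊢
  have hcm := integral_gaussVec_exp_inner_mul hτ b (fun v => Real.exp (-(ψ (x + v) - ψ x) / 2))
  have hpos : 0 < ∫ v, Real.exp (inner ℝ b v) * Real.exp (-(ψ (x + v) - ψ x) / 2)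
      ∂(gaussVec n τ) := by
    simp_rw [← Real.exp_add] at hi ⊢
    exact integral_exp_pos hi
  have hi2 : Integrable (fun v => Real.exp (-(ψ (x + (v + τ • b)) - ψ x) / 2)) (gaussVec n τ) := by
    by_contra hni
    rw [hcm, integral_undef hni, mul_zero] at hpos
    exact lt_irrefl _ hpos
  rw [hcm, Real.exp_add, mul_assoc]
  have hnb : τ * ‖b‖ ^ 2 / 2 = t * ‖score ψ x‖ ^ 2 / 8 := by
    rw [hb, norm_smul, mul_pow, sq_norm_score, hτdef]
    norm_num
    field_simp
    ring
  rw [hnb, ← integral_const_mul]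
  have hrr : r ^ 2 ≤ ‖score ψ x‖ ^ 2 := pow_le_pow_left₀ hr hx 2
  refine mul_le_mul (Real.exp_le_exp.2 (by gcongr)) ?_ ?_ (Real.exp_pos _).le
  · refine integral_mono_of_nonneg (Eventually.of_forall fun v =>
      mul_nonneg (Real.exp_pos _).le (Set.indicator_nonneg (fun _ _ => (Real.exp_pos _).le) _)) hi2 ?_
    filter_upwards [gaussVec_ae_differentiableAt hψ hτ (x + τ • b)] with v hv
    have e2 : x + τ • b + v = x + (v + τ • b) := by abel
    rw [e2] at hv
    by_cases hmem : c ≤ (inner ℝ (score ψ x) (score ψ (x + (v + tiltShift ψ τ x))) : ℝ)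
    · rw [Set.indicator_of_mem (by exact hmem), ← Real.exp_add]
      refine Real.exp_le_exp.2 ?_
      have hconv := inner_gradient_le_sub hψ.1 hv (-(τ • b))
      have e3 : x + (v + τ • b) + -(τ • b) = x + v := by abel
      have e4 : -(τ • b) = (τ / 2) • gradient ψ x := by
        rw [hb, smul_smul, ← neg_smul]; congr 1; ring
      rw [e3, e4, real_inner_smul_left, inner_gradient_gradient hn] at hconv
      have e5 : tiltShift ψ τ x = τ • b := rfl
      rw [e5] at hmem
      have e6 : τ / 2 * (n * (inner ℝ (score ψ x) (score ψ (x + (v + τ • b))) : ℝ))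
          = t / 2 * inner ℝ (score ψ x) (score ψ (x + (v + τ • b))) := by
        rw [hτdef]; field_simp
      rw [e6] at hconv
      have := mul_le_mul_of_nonneg_left hmem (show 0 ≤ t / 2 by positivity)
      linarith
    · rw [Set.indicator_of_notMem (by exact hmem), mul_zero]
      exact (Real.exp_pos _).le
  · exact integral_nonneg fun v =>
      mul_nonneg (Real.exp_pos _).le (Set.indicator_nonneg (fun _ _ => (Real.exp_pos _).le) _)

/-- The increment linearized at the base point. -/
def linStat (ψ : Vec n → ℝ) (z : Vec n × Vec n) : ℝ := inner ℝ z.2 (gradient ψ z.1)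

lemma measurable_linStat : Measurable (linStat ψ) :=
  measurable_snd.inner (𝕜 := ℝ) (measurable_gradient.comp measurable_fst)

lemma integral_exp_neg_linStat (x : Vec n) {τ : ℝ} (hτ : 0 < τ) :
    Integrable (fun v => Real.exp (-linStat ψ (x, v))) (gaussVec n τ) ∧
    ∫ v, Real.exp (-linStat ψ (x, v)) ∂(gaussVec n τ)
      = Real.exp (τ * ‖gradient ψ x‖ ^ 2 / 2) := by
  have h := integral_exp_inner_gaussVec hτ (-gradient ψ x)
  have e : ∀ v, Real.exp (-linStat ψ (x, v)) = Real.exp (inner ℝ (-gradient ψ x) v) := by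
    intro v; rw [linStat, inner_neg_left, real_inner_comm]
  simp_rw [e]
  rwa [norm_neg] at h

lemma integrable_indicator_exp_neg_linStat (hψ : ψ ∈ potentials n) (hn : 0 < n) {t r : ℝ}
    (ht : 0 < t) {R : Set (Vec n)} (hR : MeasurableSet R) (hR2 : ∀ x ∈ R, ‖score ψ x‖ ≤ r) :
    Integrable (fun z => R.indicator (fun _ => (1 : ℝ)) z.1 * Real.exp (-linStat ψ z))
      ((noiseLaw ψ).prod (gaussVec n (t / n))) ∧
    ∫ z, R.indicator (fun _ => (1 : ℝ)) z.1 * Real.exp (-linStat ψ z)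
      ∂((noiseLaw ψ).prod (gaussVec n (t / n))) ≤ Real.exp (t * r ^ 2 / 2) := by
  have := isProbabilityMeasure_noiseLaw hψ
  have hn0 : (0 : ℝ) < n := by exact_mod_cast hn
  have hτ : 0 < t / n := by positivity
  have hIm : Measurable (R.indicator (fun _ => (1 : ℝ))) := measurable_const.indicator hR
  have hm : AEStronglyMeasurable (fun z : Vec n × Vec n =>
      R.indicator (fun _ => (1 : ℝ)) z.1 * Real.exp (-linStat ψ z))
      ((noiseLaw ψ).prod (gaussVec n (t / n))) :=
    ((hIm.comp measurable_fst).mul measurable_linStat.neg.exp).aestronglyMeasurable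
  have hval : ∀ x, ∫ v, R.indicator (fun _ => (1 : ℝ)) x * Real.exp (-linStat ψ (x, v))
      ∂(gaussVec n (t / n)) ≤ Real.exp (t * r ^ 2 / 2) := by
    intro x
    rw [integral_const_mul, (integral_exp_neg_linStat x hτ).2]
    by_cases hx : x ∈ R
    · rw [Set.indicator_of_mem hx, one_mul]
      refine Real.exp_le_exp.2 ?_
      have h1 : ‖score ψ x‖ ^ 2 ≤ r ^ 2 := pow_le_pow_left₀ (norm_nonneg _) (hR2 x hx) 2
      rw [sq_norm_score] at h1
      have : t / n * ‖gradient ψ x‖ ^ 2 / 2 = t * (‖gradient ψ x‖ ^ 2 / n) / 2 := by ring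
      rw [this]; gcongr
    · rw [Set.indicator_of_notMem hx, zero_mul]; exact (Real.exp_pos _).le
  have hnn : ∀ x v, 0 ≤ R.indicator (fun _ => (1 : ℝ)) x * Real.exp (-linStat ψ (x, v)) :=
    fun x v => mul_nonneg (Set.indicator_nonneg (fun _ _ => zero_le_one) _) (Real.exp_pos _).le
  have hi : Integrable (fun z => R.indicator (fun _ => (1 : ℝ)) z.1 * Real.exp (-linStat ψ z))
      ((noiseLaw ψ).prod (gaussVec n (t / n))) := by
    rw [integrable_prod_iff hm]
    refine ⟨Eventually.of_forall fun x =>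
      (integral_exp_neg_linStat x hτ).1.const_mul (R.indicator (fun _ => (1 : ℝ)) x), ?_⟩
    refine Integrable.of_bound (C := Real.exp (t * r ^ 2 / 2)) hm.norm.integral_prod_right'
      (Eventually.of_forall fun x => ?_)
    simp only [Real.norm_eq_abs]
    simp_rw [abs_of_nonneg (hnn x _)]
    rw [abs_of_nonneg (integral_nonneg (hnn x))]
    exact hval x
  refine ⟨hi, ?_⟩
  rw [integral_prod _ hi]
  have h2 := integral_mono_of_nonneg (μ := noiseLaw ψ)
    (Eventually.of_forall fun x => integral_nonneg (hnn x))
    (integrable_const (Real.exp (t * r ^ 2 / 2))) (Eventually.of_forall hval)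
  simpa using h2

/-- The bound on the cross term, integrated over the base points in `R`. -/
lemma setIntegral_alignedSet_le (hψ : ψ ∈ potentials n) (hn : 0 < n) {t c r : ℝ}
    (ht : 0 < t) (hr : 0 ≤ r) {R : Set (Vec n)} (hR : MeasurableSet R)
    (hR1 : ∀ x ∈ R, r ≤ ‖score ψ x‖)
    (hi : Integrable (fun z => R.indicator (fun _ => (1 : ℝ)) z.1 *
      (Real.exp (-linStat ψ z / 2) * Real.exp (-incr ψ z / 2)))
      ((noiseLaw ψ).prod (gaussVec n (t / n)))) :
    Real.exp (t * r ^ 2 / 8 + t * c / 4) * ∫ z in alignedSet ψ (t / n) c R,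
        Real.exp (-incr ψ z / 2) ∂((noiseLaw ψ).prod (gaussVec n (t / n)))
      ≤ ∫ z, R.indicator (fun _ => (1 : ℝ)) z.1 *
        (Real.exp (-linStat ψ z / 2) * Real.exp (-incr ψ z / 2))
        ∂((noiseLaw ψ).prod (gaussVec n (t / n))) := by
  have := isProbabilityMeasure_noiseLaw hψ
  have hA := measurableSet_alignedSet (ψ := ψ) (t / n) c hR
  have hi1 := (integrable_exp_neg_half_incr hψ (gaussVec n (t / n))).indicator hA
  rw [← integral_indicator hA, integral_prod _ hi1, integral_prod _ hi, ← integral_const_mul]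
  refine integral_mono_ae (hi1.integral_prod_left.const_mul _) hi.integral_prod_left ?_
  filter_upwards [hi.prod_right_ae] with x hx
  by_cases hxR : x ∈ R
  · have key := integral_alignedSet_section_le hψ hn (c := c) ht hr x (hR1 x hxR)
      (by simp only [Set.indicator_of_mem hxR, one_mul] at hx; exact hx)
    simp only [Set.indicator_of_mem hxR, one_mul]
    refine le_trans (le_of_eq ?_) key
    congr 2
    ext v
    simp only [Set.indicator, alignedSet, Set.mem_ofPred_eq, hxR, true_and]
    rfl
  · have z1 : ∀ v, (alignedSet ψ (t / n) c R).indicator (fun z => Real.exp (-incr ψ z / 2)) (x, v)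
        = 0 := fun v => Set.indicator_of_notMem (fun h => hxR h.1) _
    simp only [z1, Set.indicator_of_notMem hxR, zero_mul, integral_zero, mul_zero, le_refl]

/-- If the scores at `x` and `x + v` are aligned with high probability, they remain so after the
Cameron-Martin shift of `v`. -/
lemma prod_real_alignedSet_compl_le (hψ : ψ ∈ potentials n) (hn : 0 < n) {t c r : ℝ}
    (ht : 0 < t) {R : Set (Vec n)} (hR : MeasurableSet R) (hR2 : ∀ x ∈ R, ‖score ψ x‖ ≤ r) :
    ((noiseLaw ψ).prod (gaussVec n (t / n))).real (alignedSet ψ (t / n) c R)ᶜ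
      ≤ (noiseLaw ψ).real Rᶜ + Real.exp (t * r ^ 2 / 8) *
        Real.sqrt (((noiseLaw ψ).prod (gaussVec n (t / n))).real
          {z | z.1 ∈ R ∧ (inner ℝ (score ψ z.1) (score ψ (z.1 + z.2)) : ℝ) < c}) := by
  have := isProbabilityMeasure_noiseLaw hψ
  have hn0 : (0 : ℝ) < n := by exact_mod_cast hn
  have hτ : 0 < t / n := by positivity
  set P := noiseLaw ψ
  set γ := gaussVec n (t / n)
  set B : Set (Vec n × Vec n) :=
    {z | z.1 ∈ R ∧ (inner ℝ (score ψ z.1) (score ψ (z.1 + z.2)) : ℝ) < c} with hB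
  have hBm : MeasurableSet B := (measurable_fst hR).inter (measurableSet_lt
    ((measurable_score.comp measurable_fst).inner (𝕜 := ℝ)
      (measurable_score.comp (measurable_fst.add measurable_snd))) measurable_const)
  set B' : Set (Vec n × Vec n) := {z | (z.1, z.2 + tiltShift ψ (t / n) z.1) ∈ B} with hB'
  have hB'm : MeasurableSet B' := by
    have : Measurable (fun z : Vec n × Vec n => (z.1, z.2 + tiltShift ψ (t / n) z.1)) :=
      measurable_fst.prodMk (measurable_snd.add ((measurable_tiltShift _).comp measurable_fst))
    exact this hBm
  have hsub : (alignedSet ψ (t / n) c R)ᶜ ⊆ (Rᶜ ×ˢ Set.univ) ∪ B' := by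
    intro z hz
    by_cases hzR : z.1 ∈ R
    · right
      refine ⟨hzR, ?_⟩
      by_contra hcon
      exact hz ⟨hzR, not_lt.1 hcon⟩
    · left; exact ⟨hzR, trivial⟩
  refine (measureReal_mono hsub).trans ((measureReal_union_le _ _).trans ?_)
  have e1 : (P.prod γ).real (Rᶜ ×ˢ Set.univ) = P.real Rᶜ := by
    rw [measureReal_prod_prod, probReal_univ, mul_one]
  rw [e1]
  refine add_le_add le_rfl ?_
  have prodreal : ∀ {S : Set (Vec n × Vec n)}, MeasurableSet S →
      (P.prod γ).real S = ∫ x, γ.real {v | (x, v) ∈ S} ∂P := by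
    intro S hS
    rw [measureReal_def, Measure.prod_apply hS, ← integral_toReal]
    · rfl
    · exact (measurable_measure_prodMk_left hS).aemeasurable
    · exact Eventually.of_forall fun y => measure_lt_top _ _
  have hsm : ∀ {S : Set (Vec n × Vec n)}, MeasurableSet S →
      Measurable (fun x => γ.real {v | (x, v) ∈ S}) :=
    fun hS => (measurable_measure_prodMk_left hS).ennreal_toReal
  have hbd : ∀ (S : Set (Vec n × Vec n)) x, ‖γ.real {v | (x, v) ∈ S}‖ ≤ 1 := fun S x => by
    rw [Real.norm_eq_abs, abs_of_nonneg measureReal_nonneg]; exact measureReal_le_one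
  have hpt : ∀ x, γ.real {v | (x, v) ∈ B'}
      ≤ Real.exp (t * r ^ 2 / 8) * Real.sqrt (γ.real {v | (x, v) ∈ B}) := by
    intro x
    by_cases hx : x ∈ R
    · have := gaussVec_real_add_mem_le hτ (-(1 / 2 : ℝ) • gradient ψ x)
        (B := {v | (x, v) ∈ B}) (measurable_prodMk_left hBm)
      refine this.trans ?_
      gcongr ?_ * _
      refine Real.exp_le_exp.2 ?_
      have h1 : ‖score ψ x‖ ^ 2 ≤ r ^ 2 := pow_le_pow_left₀ (norm_nonneg _) (hR2 x hx) 2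
      rw [sq_norm_score] at h1
      have : t / n * ‖-(1 / 2 : ℝ) • gradient ψ x‖ ^ 2 / 2 = t * (‖gradient ψ x‖ ^ 2 / n) / 8 := by
        rw [norm_smul, mul_pow]; norm_num; ring
      rw [this]; gcongr
    · have : {v | (x, v) ∈ B'} = ∅ := by
        ext v; simp only [Set.mem_ofPred_eq, Set.mem_empty_iff_false, iff_false]
        exact fun h => hx h.1
      rw [this, measureReal_empty]; positivity
  rw [prodreal hB'm]
  have hi1 : Integrable (fun x => γ.real {v | (x, v) ∈ B}) P :=
    Integrable.of_bound (C := 1) (hsm hBm).aestronglyMeasurable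
      (Eventually.of_forall (hbd B))
  have hsq : MemLp (fun x => Real.sqrt (γ.real {v | (x, v) ∈ B})) 2 P := by
    refine (memLp_two_iff_integrable_sq (hsm hBm).sqrt.aestronglyMeasurable).2 ?_
    simp_rw [Real.sq_sqrt measureReal_nonneg]
    exact hi1
  have h1 : ∫ x, γ.real {v | (x, v) ∈ B'} ∂P
      ≤ ∫ x, Real.exp (t * r ^ 2 / 8) * Real.sqrt (γ.real {v | (x, v) ∈ B}) ∂P :=
    integral_mono_of_nonneg (Eventually.of_forall fun x => measureReal_nonneg)
      ((hsq.integrable one_le_two).const_mul _) (Eventually.of_forall hpt)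
  refine h1.trans ?_
  rw [integral_const_mul]
  gcongr
  have h2 := integral_mul_le_sqrt_mul_sqrt hsq (memLp_const (1 : ℝ))
  simp only [mul_one, one_pow, integral_const, probReal_univ, smul_eq_mul, Real.sqrt_one] at h2
  simp_rw [Real.sq_sqrt measureReal_nonneg] at h2
  rwa [prodreal hBm]

/-- Mean square comparison of the square roots of the likelihood ratio and of its Gaussian
approximation. -/
lemma integral_sq_exp_incr_sub_exp_linStat_le (hψ : ψ ∈ potentials n) (hn : 0 < n)
    {t c r r' : ℝ} (ht : 0 < t) (hr : 0 ≤ r) {R : Set (Vec n)} (hR : MeasurableSet R)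
    (hR1 : ∀ x ∈ R, r ≤ ‖score ψ x‖) (hR2 : ∀ x ∈ R, ‖score ψ x‖ ≤ r') :
    Integrable (fun z => (R.indicator (fun _ => (1 : ℝ)) z.1 *
      (Real.exp (-incr ψ z / 2) - Real.exp (-linStat ψ z / 2 - t / 4))) ^ 2)
      ((noiseLaw ψ).prod (gaussVec n (t / n))) ∧
    ∫ z, (R.indicator (fun _ => (1 : ℝ)) z.1 *
      (Real.exp (-incr ψ z / 2) - Real.exp (-linStat ψ z / 2 - t / 4))) ^ 2
      ∂((noiseLaw ψ).prod (gaussVec n (t / n)))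
      ≤ 1 + Real.exp (t * (r' ^ 2 - 1) / 2)
        - 2 * Real.exp (t * (r ^ 2 / 8 + c / 4 - 1 / 4)) * (affinity ψ (t / n)
          - Real.sqrt (((noiseLaw ψ).prod (gaussVec n (t / n))).real
            (alignedSet ψ (t / n) c R)ᶜ)) := by
  have := isProbabilityMeasure_noiseLaw hψ
  set J := (noiseLaw ψ).prod (gaussVec n (t / n)) with hJ
  set I : Vec n × Vec n → ℝ := fun z => R.indicator (fun _ => (1 : ℝ)) z.1 with hI
  have hIm : Measurable I := (measurable_const.indicator hR).comp measurable_fst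
  have hI2 : ∀ z, I z ^ 2 = I z := by
    intro z; by_cases hz : z.1 ∈ R <;> simp [hI, hz]
  have hI01 : ∀ z, 0 ≤ I z ∧ I z ≤ 1 := by
    intro z; by_cases hz : z.1 ∈ R <;> simp [hI, hz]
  obtain ⟨hl1, hl2⟩ := integrable_indicator_exp_neg_linStat hψ hn ht hR hR2
  obtain ⟨he1, he2⟩ := integrable_exp_neg_incr hψ (gaussVec n (t / n))
  have m1 : MemLp (fun z => Real.exp (-incr ψ z / 2)) 2 J := memLp_exp_neg_half_incr hψ _
  have m2 : MemLp (fun z => I z * Real.exp (-linStat ψ z / 2)) 2 J := by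
    have hm : Measurable (fun z => I z * Real.exp (-linStat ψ z / 2)) :=
      hIm.mul (measurable_linStat.neg.div_const 2).exp
    refine (memLp_two_iff_integrable_sq hm.aestronglyMeasurable).2 ?_
    refine hl1.congr (Eventually.of_forall fun z => ?_)
    simp only [mul_pow, hI2, sq_exp_neg_half]
    rfl
  -- Expand the square; only the cross term needs a lower bound.
  have hcross : Integrable (fun z => I z *
      (Real.exp (-linStat ψ z / 2) * Real.exp (-incr ψ z / 2))) J :=
    (m2.integrable_mul m1).congr (Eventually.of_forall fun z => by
      simp only [Pi.mul_apply]; ring)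
  have hlow := setIntegral_alignedSet_le hψ hn (c := c) ht hr hR hR1 hcross
  have hA := measurableSet_alignedSet (ψ := ψ) (t / n) c hR
  have hsplit := integral_add_compl hA (integrable_exp_neg_half_incr hψ (gaussVec n (t / n)))
  have hcompl := setIntegral_exp_neg_half_incr_le hψ (gaussVec n (t / n)) hA.compl
  have hge : affinity ψ (t / n) - Real.sqrt (J.real (alignedSet ψ (t / n) c R)ᶜ)
      ≤ ∫ z in alignedSet ψ (t / n) c R, Real.exp (-incr ψ z / 2) ∂J := by
    have : affinity ψ (t / n) = ∫ z, Real.exp (-incr ψ z / 2) ∂J := rfl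
    rw [this, ← hsplit]; linarith
  have hexp : ∀ z, (I z * (Real.exp (-incr ψ z / 2) - Real.exp (-linStat ψ z / 2 - t / 4))) ^ 2
      = I z * Real.exp (-incr ψ z) + Real.exp (-t / 2) * (I z * Real.exp (-linStat ψ z))
        - 2 * Real.exp (-t / 4) * (I z * (Real.exp (-linStat ψ z / 2) *
          Real.exp (-incr ψ z / 2))) := by
    intro z
    have a1 : Real.exp (-linStat ψ z / 2 - t / 4)
        = Real.exp (-t / 4) * Real.exp (-linStat ψ z / 2) := by
      rw [← Real.exp_add]; congr 1; ring
    have a2 : Real.exp (-t / 2) = Real.exp (-t / 4) ^ 2 := by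
      rw [← Real.exp_nat_mul]; congr 1; push_cast; ring
    rw [a1, a2, mul_pow, hI2, ← sq_exp_neg_half (incr ψ z), ← sq_exp_neg_half (linStat ψ z)]
    ring
  have i1 : Integrable (fun z => I z * Real.exp (-incr ψ z)) J := by
    refine he1.mono' (hIm.mul (measurable_incr hψ).neg.exp).aestronglyMeasurable
      (Eventually.of_forall fun z => ?_)
    rw [norm_mul, Real.norm_eq_abs, Real.norm_eq_abs, Real.abs_exp, abs_of_nonneg (hI01 z).1]
    exact mul_le_of_le_one_left (Real.exp_pos _).le (hI01 z).2
  have i12 := i1.fun_add (hl1.const_mul (Real.exp (-t / 2)))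
  have i3 := hcross.const_mul (2 * Real.exp (-t / 4))
  have hfun : (fun z => (I z * (Real.exp (-incr ψ z / 2) - Real.exp (-linStat ψ z / 2 - t / 4))) ^ 2)
      = fun z => I z * Real.exp (-incr ψ z) + Real.exp (-t / 2) * (I z * Real.exp (-linStat ψ z))
        - 2 * Real.exp (-t / 4) * (I z * (Real.exp (-linStat ψ z / 2) *
          Real.exp (-incr ψ z / 2))) := funext hexp
  rw [hfun]
  refine ⟨i12.sub i3, ?_⟩
  rw [integral_sub i12 i3, integral_add i1 (hl1.const_mul _), integral_const_mul,
    integral_const_mul]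
  have b1 : ∫ z, I z * Real.exp (-incr ψ z) ∂J ≤ 1 := by
    rw [← he2]
    exact integral_mono i1 he1 fun z => mul_le_of_le_one_left (Real.exp_pos _).le (hI01 z).2
  have b2 : Real.exp (-t / 2) * ∫ z, I z * Real.exp (-linStat ψ z) ∂J
      ≤ Real.exp (t * (r' ^ 2 - 1) / 2) := by
    have := mul_le_mul_of_nonneg_left hl2 (Real.exp_pos (-t / 2)).le
    rw [← Real.exp_add] at this
    have e : -t / 2 + t * r' ^ 2 / 2 = t * (r' ^ 2 - 1) / 2 := by ring
    rwa [e] at this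
  have b3 : Real.exp (t * (r ^ 2 / 8 + c / 4 - 1 / 4)) * (affinity ψ (t / n)
      - Real.sqrt (J.real (alignedSet ψ (t / n) c R)ᶜ)) ≤ Real.exp (-t / 4) *
      ∫ z, I z * (Real.exp (-linStat ψ z / 2) * Real.exp (-incr ψ z / 2)) ∂J := by
    have e : Real.exp (t * (r ^ 2 / 8 + c / 4 - 1 / 4))
        = Real.exp (-t / 4) * Real.exp (t * r ^ 2 / 8 + t * c / 4) := by
      rw [← Real.exp_add]; congr 1; ring
    rw [e, mul_assoc]
    gcongr
    exact (mul_le_mul_of_nonneg_left hge (Real.exp_pos _).le).trans hlow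
  linarith

end Linearization

/-! ### Propagation of the linearization to all scales -/

lemma tendsto_zero_of_forall_eventually_le {x : ℕ → ℝ} (h0 : ∀ k, 0 ≤ x k)
    (h : ∀ ε > 0, ∀ᶠ k in atTop, x k ≤ ε) : Tendsto x atTop (𝓝 0) := by
  rw [Metric.tendsto_nhds]
  intro ε hε
  filter_upwards [h (ε / 2) (by positivity)] with k hk
  rw [Real.dist_eq, sub_zero, abs_of_nonneg (h0 k)]
  linarith

/-- The joint law of the noise and of an independent Gaussian translation of covariance `(t/n) I`. -/
abbrev joint {n : ℕ} (ψ : Vec n → ℝ) (t : ℝ) : Measure (Vec n × Vec n) :=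
  (noiseLaw ψ).prod (gaussVec n (t / n))

section Propagation

variable {d : ℕ → ℕ} {ψ : (k : ℕ) → Vec (d k) → ℝ}

/-- Uniform upper tightness of the increments of the potentials at scale `t`. -/
def TightIncr (d : ℕ → ℕ) (ψ : (k : ℕ) → Vec (d k) → ℝ) (t : ℝ) : Prop :=
  ∀ ε > 0, ∃ K, ∀ᶠ k in atTop, (joint (ψ k) t).real {z | K < incr (ψ k) z} ≤ ε

/-- The score at the translated point is asymptotically the score at the original one. -/
def StableScore (d : ℕ → ℕ) (ψ : (k : ℕ) → Vec (d k) → ℝ) (t : ℝ) : Prop :=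
  ∀ ε > 0, Tendsto (fun k => (joint (ψ k) t).real
    {z | ε ≤ ‖score (ψ k) (z.1 + z.2) - score (ψ k) z.1‖}) atTop (𝓝 0)

/-- The increment of the potential is asymptotically its linearization plus the constant `t / 2`. -/
def LinearIncr (d : ℕ → ℕ) (ψ : (k : ℕ) → Vec (d k) → ℝ) (t : ℝ) : Prop :=
  ∀ ε > 0, Tendsto (fun k => (joint (ψ k) t).real
    {z | ε ≤ |incr (ψ k) z - linStat (ψ k) z - t / 2|}) atTop (𝓝 0)

lemma measurableSet_lt_incr {n : ℕ} {ψ : Vec n → ℝ} (hψ : ψ ∈ potentials n) (K : ℝ) :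
    MeasurableSet {z | K < incr ψ z} := measurableSet_lt measurable_const (measurable_incr hψ)

/-- Contiguity along a sequence of random translations. -/
lemma tendsto_translate (hψ : ∀ k, ψ k ∈ potentials (d k)) {Q : ℕ → Type*}
    [∀ k, MeasurableSpace (Q k)] (m : (k : ℕ) → Measure (Q k)) [∀ k, IsProbabilityMeasure (m k)]
    {s : (k : ℕ) → Q k → Vec (d k)} (hs : ∀ k, Measurable (s k))
    (hC : ∀ ε > 0, ∃ K, ∀ᶠ k in atTop,
      ((noiseLaw (ψ k)).prod (m k)).real {z | K < incr (ψ k) (z.1, s k z.2)} ≤ ε)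
    {B : (k : ℕ) → Set (Vec (d k) × Q k)} (hB : ∀ k, MeasurableSet (B k))
    (h0 : Tendsto (fun k => ((noiseLaw (ψ k)).prod (m k)).real (B k)) atTop (𝓝 0)) :
    Tendsto (fun k => ((noiseLaw (ψ k)).prod (m k)).real {z | (z.1 + s k z.2, z.2) ∈ B k})
      atTop (𝓝 0) := by
  refine tendsto_zero_of_forall_eventually_le (fun _ => measureReal_nonneg) fun ε hε => ?_
  obtain ⟨K, hK⟩ := hC (ε / 2) (by positivity)
  have hK0 := Real.exp_pos K
  filter_upwards [hK, h0.eventually_le_const (show 0 < ε / (2 * Real.exp K) by positivity)]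
    with k k1 k2
  refine (prod_real_translate_le (hψ k) (m k) (hs k) (hB k) K).trans ?_
  have := mul_le_mul_of_nonneg_left k2 hK0.le
  have e : Real.exp K * (ε / (2 * Real.exp K)) = ε / 2 := by field_simp
  linarith

lemma TightIncr.tendsto_add_mem (hψ : ∀ k, ψ k ∈ potentials (d k)) {t : ℝ} (hC : TightIncr d ψ t)
    {B : (k : ℕ) → Set (Vec (d k))} (hB : ∀ k, MeasurableSet (B k))
    (h0 : Tendsto (fun k => (noiseLaw (ψ k)).real (B k)) atTop (𝓝 0)) :
    Tendsto (fun k => (joint (ψ k) t).real {z | z.1 + z.2 ∈ B k}) atTop (𝓝 0) := by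
  refine tendsto_translate (Q := fun k => Vec (d k)) hψ (fun k => gaussVec (d k) (t / d k))
    (s := fun k v => v) (fun k => measurable_id) hC
    (B := fun k => {z | z.1 ∈ B k}) (fun k => measurable_fst (hB k)) ?_
  refine h0.congr fun k => ?_
  have e : {z : Vec (d k) × Vec (d k) | z.1 ∈ B k} = B k ×ˢ Set.univ := by ext z; simp
  rw [e, measureReal_prod_prod, probReal_univ, mul_one]

namespace AsympRegular

/-- Tightness below the critical scale: by convexity it reduces to unit translations. -/
lemma tightIncr_of_lt_one (h : AsympRegular d ψ) {t : ℝ} (ht : 0 < t) (ht1 : t < 1) :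
    TightIncr d ψ t := by
  intro ε hε
  refine ⟨2 + 8 / ε, ?_⟩
  have ha : 0 < min 1 (ε / 4) := lt_min one_pos (by positivity)
  filter_upwards [h.eventually_exists_directions ha,
    (tendsto_gaussVec_norm_sq h.dim ht (show 0 < 1 - t by linarith)).eventually_le_const
      (show 0 < ε / 4 by positivity)] with k k1 k2
  obtain ⟨S, hS, hSa, hks⟩ := k1
  have hP := h.isProbabilityMeasure k
  have hn0 : (0 : ℝ) < d k := by exact_mod_cast h.pos k
  have hτ : 0 < t / d k := by positivity
  set K := 2 + 8 / ε with hK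
  have hK0 : 1 < K := by have : 0 < 8 / ε := by positivity
                         linarith
  set γ := gaussVec (d k) (t / d k) with hγ
  set P := noiseLaw (ψ k) with hPdef
  have hc := continuous_potential (h.mem k)
  -- For unit vectors, compare with the linear statistic and use Chebyshev's inequality.
  have hdir : ∀ v ∈ S, P.real {x | K < ψ k (x + v) - ψ k x} ≤ ε / 2 := by
    intro v hv
    obtain ⟨_, h2, h3⟩ := hks v hv
    have h2' := abs_le.1 h2
    have hmin1 := min_le_left 1 (ε / 4)
    have hmin2 := min_le_right 1 (ε / 4)
    have hmp : Measurable (likelihoodProj (ψ k) v) := by unfold likelihoodProj; fun_prop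
    have hmg : Measurable (fun x => (inner ℝ v (gradient (ψ k) x) : ℝ)) :=
      measurable_const.inner (𝕜 := ℝ) measurable_gradient
    have s1 : P.real {x | K < ψ k (x + v) - ψ k x}
        ≤ P.real {x | likelihoodProj (ψ k) v x ≤ K - 1}ᶜ := by
      refine measureReal_mono fun x hx => ?_
      simp only [Set.mem_compl_iff, Set.mem_ofPred_eq, not_le, likelihoodProj] at hx ⊢
      linarith
    have s2 : P.real {x | (inner ℝ v (gradient (ψ k) x) : ℝ) ≤ K - 1}ᶜ
        ≤ P.real {x | K - 1 ≤ |(inner ℝ v (gradient (ψ k) x) : ℝ)|} := by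
      refine measureReal_mono fun x hx => ?_
      simp only [Set.mem_compl_iff, Set.mem_ofPred_eq, not_le] at hx ⊢
      exact hx.le.trans (le_abs_self _)
    have s3 := measureReal_le_integral_sq_div (memLp_inner_gradient (h.mem k) v).integrable_sq
      (show 0 < K - 1 by linarith)
    rw [integral_sq_inner_gradient (h.mem k)] at s3
    have s4 : (v.ofLp ⬝ᵥ (GDP.fisher (ψ k) *ᵥ v.ofLp)) / (K - 1) ^ 2 ≤ ε / 4 := by
      rw [div_le_iff₀ (by nlinarith)]
      have e8 : ε / 4 * (8 / ε) = 2 := by field_simp; norm_num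
      have e9 : 8 / ε ≤ (K - 1) ^ 2 := by
        have : 0 < 8 / ε := by positivity
        rw [hK]; nlinarith
      have := mul_le_mul_of_nonneg_left e9 (show 0 ≤ ε / 4 by positivity)
      linarith
    have s5 := abs_le.1 (h3 (K - 1))
    rw [measureReal_compl (measurableSet_le hmp measurable_const), probReal_univ] at s1
    rw [measureReal_compl (measurableSet_le hmg measurable_const), probReal_univ] at s2
    linarith [s5.1]
  set N : Set (Vec (d k)) := {v | 1 < ‖v‖} with hN
  have hNm : MeasurableSet N := measurableSet_lt measurable_const measurable_norm
  have hNle : γ.real N ≤ ε / 4 := by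
    refine (measureReal_mono fun v hv => ?_).trans k2
    rw [hN, Set.mem_ofPred_eq] at hv
    rw [Set.mem_ofPred_eq, le_abs]
    left; nlinarith
  have hpt : ∀ v, P.real {x | (x, v) ∈ {z | K < incr (ψ k) z}}
      ≤ N.indicator (fun _ => (1 : ℝ)) v + Sᶜ.indicator (fun _ => (1 : ℝ)) (‖v‖⁻¹ • v) + ε / 2 := by
    intro v
    have i1 : (0 : ℝ) ≤ N.indicator (fun _ => (1 : ℝ)) v :=
      Set.indicator_nonneg (fun _ _ => zero_le_one) _
    have i2 : (0 : ℝ) ≤ Sᶜ.indicator (fun _ => (1 : ℝ)) (‖v‖⁻¹ • v) :=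
      Set.indicator_nonneg (fun _ _ => zero_le_one) _
    have hle1 : P.real {x | (x, v) ∈ {z | K < incr (ψ k) z}} ≤ 1 := measureReal_le_one
    by_cases hv : v ∈ N
    · rw [Set.indicator_of_mem hv]; linarith
    by_cases hv2 : ‖v‖⁻¹ • v ∈ S
    · have hv1 : ‖v‖ ≤ 1 := not_lt.1 hv
      refine le_trans ?_ ((hdir _ hv2).trans (by linarith))
      refine measureReal_mono fun x hx => ?_
      rw [Set.mem_ofPred_eq, Set.mem_ofPred_eq, incr] at hx
      rw [Set.mem_ofPred_eq]
      have hsm := increment_le_mul (h.mem k).1 x (‖v‖⁻¹ • v) (norm_nonneg v) hv1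
      have hvv : ‖v‖ • ‖v‖⁻¹ • v = v := by
        rcases eq_or_ne v 0 with rfl | hv0
        · simp
        · rw [smul_smul, mul_inv_cancel₀ (norm_ne_zero_iff.2 hv0), one_smul]
      rw [hvv] at hsm
      simp only at hx
      have : 0 < ψ k (x + ‖v‖⁻¹ • v) - ψ k x := by
        by_contra hcon
        push Not at hcon
        have := mul_nonpos_of_nonneg_of_nonpos (norm_nonneg v) hcon
        linarith
      nlinarith
    · rw [Set.indicator_of_mem (show ‖v‖⁻¹ • v ∈ Sᶜ from hv2)]; linarith
  have hSm : Measurable (Sᶜ.indicator (fun _ => (1 : ℝ))) := measurable_const.indicator hS.compl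
  have hi1 : Integrable (N.indicator (fun _ => (1 : ℝ))) γ := (integrable_const _).indicator hNm
  have hi2 : Integrable (fun v : Vec (d k) => Sᶜ.indicator (fun _ => (1 : ℝ)) (‖v‖⁻¹ • v)) γ :=
    Integrable.of_bound (C := 1) (hSm.comp measurable_direction).aestronglyMeasurable
      (Eventually.of_forall fun v => by
        by_cases hs : ‖v‖⁻¹ • v ∈ Sᶜ <;> simp [hs, Set.indicator])
  rw [prod_real_eq_integral_symm _ _ (measurableSet_lt_incr (h.mem k) K)]
  refine (integral_mono_of_nonneg (Eventually.of_forall fun v => measureReal_nonneg)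
    ((hi1.fun_add hi2).fun_add (integrable_const (ε / 2))) (Eventually.of_forall hpt)).trans ?_
  rw [integral_add (hi1.fun_add hi2) (integrable_const _), integral_add hi1 hi2,
    integral_indicator hNm, integral_direction (h.pos k) hτ hSm, integral_indicator hS.compl]
  simp only [integral_const, probReal_univ, smul_eq_mul, one_mul, mul_one,
    measureReal_restrict_apply_univ]
  have := min_le_right 1 (ε / 4)
  linarith

/-- Below the critical scale the score is stable under the random translation. -/
lemma stableScore_of_lt_one (h : AsympRegular d ψ) {t : ℝ} (ht : 0 < t) (ht1 : t < 1) :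
    StableScore d ψ t := by
  have hC := h.tightIncr_of_lt_one ht ht1
  intro ε hε
  have hPbad := h.norm_score (ε / 3) (by positivity)
  have hbadm : ∀ k, MeasurableSet {x | ε / 3 ≤ |‖score (ψ k) x‖ - 1|} := fun k =>
    measurableSet_le measurable_const (measurable_score.norm.sub_const 1).abs
  have hshift := hC.tendsto_add_mem h.mem hbadm hPbad
  have hbase : Tendsto (fun k => (joint (ψ k) t).real
      {z | z.1 ∈ {x | ε / 3 ≤ |‖score (ψ k) x‖ - 1|}}) atTop (𝓝 0) := by
    refine hPbad.congr fun k => ?_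
    have := h.isProbabilityMeasure k
    have e : {z : Vec (d k) × Vec (d k) | z.1 ∈ {x | ε / 3 ≤ |‖score (ψ k) x‖ - 1|}}
        = {x | ε / 3 ≤ |‖score (ψ k) x‖ - 1|} ×ˢ Set.univ := by ext z; simp
    rw [e, measureReal_prod_prod, probReal_univ, mul_one]
  -- The gap between the affinity and its score-weighted version controls the clipped scores, weighted
  -- by `exp (-L / 2)`; the weight is bounded below where the increment `L` is bounded above.
  have hclip : Tendsto (fun k => (joint (ψ k) t).real {z | ε / 3 ≤
      ‖clip (score (ψ k) z.1) - clip (score (ψ k) (z.1 + z.2))‖}) atTop (𝓝 0) := by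
    refine tendsto_zero_of_forall_eventually_le (fun _ => measureReal_nonneg) fun η hη => ?_
    obtain ⟨K, hK⟩ := hC (η / 2) (by positivity)
    set c := Real.exp (-K / 2) * (ε / 3) ^ 2 with hcdef
    have hc : 0 < c := by positivity
    filter_upwards [hK, h.eventually_affinity_sub_scoreAffinity_le ht.le ht1
      (show 0 < c * η / 4 by positivity)] with k k1 k2
    have hP := h.isProbabilityMeasure k
    have hm1 : Measurable (fun z : Vec (d k) × Vec (d k) =>
        ‖clip (score (ψ k) z.1) - clip (score (ψ k) (z.1 + z.2))‖) :=
      ((measurable_clip.comp (measurable_score.comp measurable_fst)).sub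
        (measurable_clip.comp (measurable_score.comp (measurable_fst.add measurable_snd)))).norm
    have hbound := integral_exp_mul_sq_norm_clip_sub_le (h.mem k) (t / d k)
    set F : Vec (d k) × Vec (d k) → ℝ := fun z => Real.exp (-incr (ψ k) z / 2) *
      ‖clip (score (ψ k) z.1) - clip (score (ψ k) (z.1 + z.2))‖ ^ 2 with hF
    have hF0 : ∀ z, 0 ≤ F z := fun z => by positivity
    have hFi : Integrable F (joint (ψ k) t) := by
      refine ((integrable_exp_neg_half_incr (h.mem k) (gaussVec (d k) (t / d k))).const_mul 4).mono'
        (((measurable_incr (h.mem k)).neg.div_const 2).exp.mul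
          (hm1.pow_const 2)).aestronglyMeasurable (Eventually.of_forall fun z => ?_)
      rw [Real.norm_eq_abs, abs_of_nonneg (hF0 z), mul_comm]
      refine mul_le_mul_of_nonneg_left ?_ (Real.exp_pos _).le
      have := norm_sub_le (clip (score (ψ k) z.1)) (clip (score (ψ k) (z.1 + z.2)))
      have g1 := norm_clip_le (score (ψ k) z.1)
      have g2 := norm_clip_le (score (ψ k) (z.1 + z.2))
      nlinarith [norm_nonneg (clip (score (ψ k) z.1) - clip (score (ψ k) (z.1 + z.2)))]
    have hmk := mul_meas_ge_le_integral_of_nonneg (Eventually.of_forall hF0) hFi c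
    have hsub : {z | ε / 3 ≤ ‖clip (score (ψ k) z.1) - clip (score (ψ k) (z.1 + z.2))‖}
        ⊆ {z | K < incr (ψ k) z} ∪ {z | c ≤ F z} := by
      intro z hz
      by_cases hzK : K < incr (ψ k) z
      · left; exact hzK
      · right
        rw [Set.mem_ofPred_eq] at hz ⊢
        rw [hF, hcdef]
        refine mul_le_mul (Real.exp_le_exp.2 (by linarith [not_lt.1 hzK]))
          (pow_le_pow_left₀ (by positivity) hz 2) (by positivity) (Real.exp_pos _).le
    refine (measureReal_mono hsub).trans ((measureReal_union_le _ _).trans ?_)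
    have : c * (joint (ψ k) t).real {z | c ≤ F z} ≤ c * (η / 2) := by
      refine hmk.trans (hbound.trans ?_)
      linarith
    have := le_of_mul_le_mul_left this hc
    linarith
  have hsum := (hbase.add hshift).add hclip
  rw [add_zero, add_zero] at hsum
  refine squeeze_zero (fun _ => measureReal_nonneg) (fun k => ?_) hsum
  have := h.isProbabilityMeasure k
  refine le_trans ?_ ((measureReal_union_le _ _).trans
    (add_le_add (measureReal_union_le _ _) le_rfl))
  refine measureReal_mono fun z hz => ?_
  by_contra hcon
  simp only [Set.mem_union, Set.mem_ofPred_eq, not_or, not_le] at hcon hz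
  obtain ⟨⟨c1, c2⟩, c3⟩ := hcon
  have g1 : ‖score (ψ k) z.1 - clip (score (ψ k) z.1)‖ < ε / 3 := by
    rw [norm_sub_clip]; exact max_lt ((le_abs_self _).trans_lt c1) (by positivity)
  have g2 : ‖score (ψ k) (z.1 + z.2) - clip (score (ψ k) (z.1 + z.2))‖ < ε / 3 := by
    rw [norm_sub_clip]; exact max_lt ((le_abs_self _).trans_lt c2) (by positivity)
  have e : score (ψ k) (z.1 + z.2) - score (ψ k) z.1
      = (score (ψ k) (z.1 + z.2) - clip (score (ψ k) (z.1 + z.2)))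
        - (score (ψ k) z.1 - clip (score (ψ k) z.1))
        - (clip (score (ψ k) z.1) - clip (score (ψ k) (z.1 + z.2))) := by abel
  rw [e] at hz
  have := norm_sub_le ((score (ψ k) (z.1 + z.2) - clip (score (ψ k) (z.1 + z.2)))
        - (score (ψ k) z.1 - clip (score (ψ k) z.1)))
        (clip (score (ψ k) z.1) - clip (score (ψ k) (z.1 + z.2)))
  have := norm_sub_le (score (ψ k) (z.1 + z.2) - clip (score (ψ k) (z.1 + z.2)))
        (score (ψ k) z.1 - clip (score (ψ k) z.1))
  linarith

/-- Tightness of the linear statistic. -/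
lemma exists_linStat_le (h : AsympRegular d ψ) {t : ℝ} (ht : 0 < t) {ε : ℝ} (hε : 0 < ε) :
    ∃ K > 0, ∀ᶠ k in atTop, (joint (ψ k) t).real {z | K ≤ |linStat (ψ k) z|} ≤ ε := by
  refine ⟨1 + 2 * t / ε, by positivity, ?_⟩
  filter_upwards [h.tendsto_integral_sq_norm_score.eventually_le_const one_lt_two] with k hk
  have hP := h.isProbabilityMeasure k
  have hn0 : (0 : ℝ) < d k := by exact_mod_cast h.pos k
  have hτ : 0 < t / d k := by positivity
  have hval : ∀ x, ∫ v, linStat (ψ k) (x, v) ^ 2 ∂(gaussVec (d k) (t / d k))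
      = t * ‖score (ψ k) x‖ ^ 2 := by
    intro x
    simp only [linStat]
    rw [integral_sq_inner_gaussVec hτ.le, sq_norm_score]; ring
  have hi : Integrable (fun z => linStat (ψ k) z ^ 2) (joint (ψ k) t) := by
    rw [integrable_prod_iff (measurable_linStat.pow_const 2).aestronglyMeasurable]
    refine ⟨Eventually.of_forall fun x =>
      (integrable_sq_inner_gaussVec hτ.le (gradient (ψ k) x)).integrable_sq, ?_⟩
    have e : ∀ x v, ‖linStat (ψ k) (x, v) ^ 2‖ = linStat (ψ k) (x, v) ^ 2 := fun x v => by
      rw [Real.norm_eq_abs, abs_of_nonneg (sq_nonneg _)]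
    simp_rw [e, hval]
    exact (integrable_sq_norm_score (h.mem k)).const_mul t
  have hint : ∫ z, linStat (ψ k) z ^ 2 ∂(joint (ψ k) t) ≤ 2 * t := by
    rw [integral_prod _ hi]
    simp_rw [hval]
    rw [integral_const_mul]
    nlinarith
  set K := 1 + 2 * t / ε with hK
  have hK1 : 0 < 2 * t / ε := by positivity
  refine (measureReal_le_integral_sq_div hi (show 0 < K by linarith)).trans ?_
  rw [div_le_iff₀ (by nlinarith)]
  have e8 : ε * (2 * t / ε) = 2 * t := by field_simp
  have e9 : 2 * t / ε ≤ K ^ 2 := by rw [hK]; nlinarith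
  have := mul_le_mul_of_nonneg_left e9 hε.le
  linarith

/-- Two translations can be performed one after the other. -/
lemma stableScore_add (h : AsympRegular d ψ) {t t' : ℝ} (ht : 0 < t) (ht' : 0 < t')
    (hH : StableScore d ψ t) (hH' : StableScore d ψ t') (hC : TightIncr d ψ t) :
    StableScore d ψ (t + t') := by
  intro ε hε
  have hn0 : ∀ k, (0 : ℝ) < d k := fun k => by exact_mod_cast h.pos k
  have hprob : ∀ k, IsProbabilityMeasure (noiseLaw (ψ k)) := h.isProbabilityMeasure
  set γ : (k : ℕ) → Measure (Vec (d k)) := fun k => gaussVec (d k) (t / d k) with hγ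
  set γ' : (k : ℕ) → Measure (Vec (d k)) := fun k => gaussVec (d k) (t' / d k) with hγ'
  have hmS : ∀ k, Measurable fun z : Vec (d k) × Vec (d k) =>
      ‖score (ψ k) (z.1 + z.2) - score (ψ k) z.1‖ := fun k =>
    ((measurable_score.comp (measurable_fst.add measurable_snd)).sub
      (measurable_score.comp measurable_fst)).norm
  set A : (k : ℕ) → ℝ → Set (Vec (d k) × Vec (d k)) := fun k ε =>
    {z | ε ≤ ‖score (ψ k) (z.1 + z.2) - score (ψ k) z.1‖} with hA
  have hAm : ∀ k ε, MeasurableSet (A k ε) := fun k ε => measurableSet_le measurable_const (hmS k)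
  set m : (k : ℕ) → Measure (Vec (d k) × Vec (d k)) := fun k => (γ k).prod (γ' k) with hm
  have hmprob : ∀ k, IsProbabilityMeasure (m k) := fun k => by rw [hm]; infer_instance
  have hfst : ∀ k, ((noiseLaw (ψ k)).prod (m k)).map (fun z => (z.1, z.2.1)) = joint (ψ k) t := by
    intro k
    have h1 : (m k).map Prod.fst = γ k := by
      rw [hm]; simp
    have := Measure.map_prod_map (noiseLaw (ψ k)) (m k) measurable_id
      (measurable_fst : Measurable (Prod.fst : Vec (d k) × Vec (d k) → Vec (d k)))
    rw [h1, Measure.map_id] at this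
    exact this.symm
  have hsnd : ∀ k, ((noiseLaw (ψ k)).prod (m k)).map (fun z => (z.1, z.2.2)) = joint (ψ k) t' := by
    intro k
    have h1 : (m k).map Prod.snd = γ' k := by
      rw [hm]; simp
    have := Measure.map_prod_map (noiseLaw (ψ k)) (m k) measurable_id
      (measurable_snd : Measurable (Prod.snd : Vec (d k) × Vec (d k) → Vec (d k)))
    rw [h1, Measure.map_id] at this
    exact this.symm
  have hsum : ∀ k, ((noiseLaw (ψ k)).prod (m k)).map (fun z => (z.1, z.2.1 + z.2.2))
      = joint (ψ k) (t + t') := by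
    intro k
    have h1 : (m k).map (fun q => q.1 + q.2) = gaussVec (d k) ((t + t') / d k) := by
      rw [add_div, gaussVec_add_eq_map (by have := hn0 k; positivity)
        (by have := hn0 k; positivity)]
    have := Measure.map_prod_map (noiseLaw (ψ k)) (m k) measurable_id
      (show Measurable (fun q : Vec (d k) × Vec (d k) => q.1 + q.2) by fun_prop)
    rw [h1, Measure.map_id] at this
    exact this.symm
  have c1 : ∀ ε > 0, ∃ K, ∀ᶠ k in atTop,
      ((noiseLaw (ψ k)).prod (m k)).real {z | K < incr (ψ k) (z.1, z.2.1)} ≤ ε := by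
    intro ε hε
    obtain ⟨K, hK⟩ := hC ε hε
    refine ⟨K, hK.mono fun k hk => ?_⟩
    rw [← hfst k, map_measureReal_apply (by fun_prop) (measurableSet_lt_incr (h.mem k) K)] at hk
    exact hk
  have c2 : Tendsto (fun k => ((noiseLaw (ψ k)).prod (m k)).real
      {z | (z.1, z.2.1) ∈ A k (ε / 2)}) atTop (𝓝 0) := by
    refine (hH (ε / 2) (by positivity)).congr fun k => ?_
    rw [← hfst k, map_measureReal_apply (by fun_prop) (hAm k _)]
    rfl
  have c3 : Tendsto (fun k => ((noiseLaw (ψ k)).prod (m k)).real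
      {z | (z.1, z.2.2) ∈ A k (ε / 2)}) atTop (𝓝 0) := by
    refine (hH' (ε / 2) (by positivity)).congr fun k => ?_
    rw [← hsnd k, map_measureReal_apply (by fun_prop) (hAm k _)]
    rfl
  -- By contiguity, the second translation may start from the point reached by the first one.
  have c4 := tendsto_translate (Q := fun k => Vec (d k) × Vec (d k)) h.mem m
    (s := fun k q => q.1) (fun k => measurable_fst) c1
    (B := fun k => {z | (z.1, z.2.2) ∈ A k (ε / 2)})
    (fun k => (show Measurable (fun z : Vec (d k) × Vec (d k) × Vec (d k) => (z.1, z.2.2))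
      by fun_prop) (hAm k _)) c3
  have c5 := c2.add c4
  rw [add_zero] at c5
  refine squeeze_zero (fun _ => measureReal_nonneg) (fun k => ?_) c5
  refine le_trans ?_ (measureReal_union_le _ _)
  rw [← hsum k, map_measureReal_apply (by fun_prop) (hAm k ε)]
  refine measureReal_mono fun z hz => ?_
  by_contra hcon
  simp only [hA, Set.mem_preimage, Set.mem_union, Set.mem_ofPred_eq, not_or, not_le] at hcon hz
  have e : score (ψ k) (z.1 + (z.2.1 + z.2.2)) - score (ψ k) z.1
      = (score (ψ k) (z.1 + z.2.1 + z.2.2) - score (ψ k) (z.1 + z.2.1))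
        + (score (ψ k) (z.1 + z.2.1) - score (ψ k) z.1) := by
    rw [add_assoc]; abel
  rw [e] at hz
  have := norm_add_le (score (ψ k) (z.1 + z.2.1 + z.2.2) - score (ψ k) (z.1 + z.2.1))
    (score (ψ k) (z.1 + z.2.1) - score (ψ k) z.1)
  linarith [hcon.1, hcon.2]

end AsympRegular

end Propagation

section LinearIncrement

variable {d : ℕ → ℕ} {ψ : (k : ℕ) → Vec (d k) → ℝ}

/-- Closeness of exponentials gives closeness of the exponents, as long as one of them is bounded
above. -/
lemma abs_sub_lt_of_abs_exp_neg_sub_lt {p q R ε : ℝ} (hq : q ≤ R)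
    (h : |Real.exp (-p) - Real.exp (-q)| < Real.exp (-R) * (1 - Real.exp (-ε))) :
    |p - q| < ε := by
  have hR : Real.exp (-R) ≤ Real.exp (-q) := Real.exp_le_exp.2 (by linarith)
  have h1 : 0 < 1 - Real.exp (-ε) := by
    by_contra hcon
    have := mul_nonpos_of_nonneg_of_nonpos (Real.exp_pos (-R)).le (not_lt.1 hcon)
    linarith [abs_nonneg (Real.exp (-p) - Real.exp (-q))]
  have h2 := abs_lt.1 (h.trans_le (mul_le_mul_of_nonneg_right hR h1.le))
  have hsym : 2 - Real.exp (-ε) ≤ Real.exp ε := by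
    linarith [Real.add_one_le_exp ε, Real.add_one_le_exp (-ε)]
  have h3 : Real.exp (-q) * Real.exp (-ε) < Real.exp (-p) := by nlinarith [h2.1]
  have h4 : Real.exp (-p) < Real.exp (-q) * Real.exp ε := by
    have := mul_le_mul_of_nonneg_left hsym (Real.exp_pos (-q)).le
    nlinarith [h2.2]
  rw [← Real.exp_add, Real.exp_lt_exp] at h3 h4
  rw [abs_lt]
  constructor <;> linarith

namespace AsympRegular

/-- Once the score is stable under the translation, the square roots of the likelihood ratio and of
its Gaussian approximation are close in mean square: both have second moment about one, and the cross
term is bounded below by the Gaussian lower bound on the affinity. -/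
lemma linearIncr_of_stableScore (h : AsympRegular d ψ) {t : ℝ} (ht : 0 < t)
    (hH : StableScore d ψ t) : LinearIncr d ψ t := by
  intro ε hε
  refine tendsto_zero_of_forall_eventually_le (fun _ => measureReal_nonneg) fun η hη => ?_
  obtain ⟨K, hK0, hK⟩ := h.exists_linStat_le ht (show 0 < η / 4 by positivity)
  set ρ := Real.exp (-(K / 2 + t / 4)) * (1 - Real.exp (-(ε / 2))) with hρdef
  have hρ : 0 < ρ := by
    have : Real.exp (-(ε / 2)) < 1 := by
      have := Real.exp_lt_exp.2 (show -(ε / 2) < 0 by linarith)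
      rwa [Real.exp_zero] at this
    have : 0 < 1 - Real.exp (-(ε / 2)) := by linarith
    positivity
  set B : ℝ → ℝ := fun δ => 1 + Real.exp (t * ((1 + δ) ^ 2 - 1) / 2)
    - 2 * Real.exp (t * ((1 - δ) ^ 2 / 8 + (1 - 3 * δ) / 4 - 1 / 4)) * (Real.exp (-t / 8) - δ) with hB
  have hBc : Continuous B := by rw [hB]; fun_prop
  have hB0 : B 0 = 0 := by
    simp only [hB]
    have : Real.exp (t * ((1 - 0) ^ 2 / 8 + (1 - 3 * 0) / 4 - 1 / 4)) * Real.exp (-t / 8) = 1 := by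
      rw [← Real.exp_add]
      have : t * ((1 - 0) ^ 2 / 8 + (1 - 3 * 0) / 4 - 1 / 4) + -t / 8 = 0 := by ring
      rw [this, Real.exp_zero]
    have h2 : Real.exp (t * ((1 + 0) ^ 2 - 1) / 2) = 1 := by norm_num
    rw [sub_zero (Real.exp (-t / 8)), mul_assoc, this, h2]; norm_num
  obtain ⟨δ, hδ0, hδ1, hδ⟩ : ∃ δ : ℝ, 0 < δ ∧ δ ≤ 1 ∧ B δ < ρ ^ 2 * (η / 4) := by
    have ht' : Tendsto B (𝓝[>] 0) (𝓝 0) := by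
      have := hBc.tendsto 0
      rw [hB0] at this
      exact this.mono_left nhdsWithin_le_nhds
    have e1 := ht'.eventually_lt_const (show 0 < ρ ^ 2 * (η / 4) by positivity)
    have e2 : ∀ᶠ e : ℝ in 𝓝[>] 0, e ∈ Set.Ioc (0 : ℝ) 1 := Ioc_mem_nhdsGT one_pos
    obtain ⟨δ, h1, h2⟩ := (e1.and e2).exists
    exact ⟨δ, h2.1, h2.2, h1⟩
  set R : (k : ℕ) → Set (Vec (d k)) := fun k => {x | 1 - δ ≤ ‖score (ψ k) x‖ ∧
    ‖score (ψ k) x‖ ≤ 1 + δ} with hR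
  have hRm : ∀ k, MeasurableSet (R k) := fun k =>
    (measurableSet_le measurable_const measurable_score.norm).inter
      (measurableSet_le measurable_score.norm measurable_const)
  have hprob := h.isProbabilityMeasure
  have hRc : Tendsto (fun k => (noiseLaw (ψ k)).real (R k)ᶜ) atTop (𝓝 0) := by
    refine squeeze_zero (fun _ => measureReal_nonneg) (fun k => measureReal_mono fun x hx => ?_)
      (h.norm_score δ hδ0)
    rw [Set.mem_ofPred_eq]
    by_contra hcon
    have := abs_lt.1 (not_le.1 hcon)
    exact hx ⟨by linarith, by linarith⟩
  have halign : Tendsto (fun k => (joint (ψ k) t).real {z | z.1 ∈ R k ∧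
      (inner ℝ (score (ψ k) z.1) (score (ψ k) (z.1 + z.2)) : ℝ) < 1 - 3 * δ}) atTop (𝓝 0) := by
    refine squeeze_zero (fun _ => measureReal_nonneg) (fun k => measureReal_mono fun z hz => ?_)
      (hH δ hδ0)
    rw [Set.mem_ofPred_eq]
    by_contra hcon
    obtain ⟨⟨h1, h2⟩, h3⟩ := hz
    have e : (inner ℝ (score (ψ k) z.1) (score (ψ k) (z.1 + z.2)) : ℝ)
        = ‖score (ψ k) z.1‖ ^ 2
          + inner ℝ (score (ψ k) z.1) (score (ψ k) (z.1 + z.2) - score (ψ k) z.1) := by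
      rw [inner_sub_right, real_inner_self_eq_norm_sq]; ring
    have h4 := (abs_le.1 (abs_real_inner_le_norm (score (ψ k) z.1)
      (score (ψ k) (z.1 + z.2) - score (ψ k) z.1))).1
    have h5 : ‖score (ψ k) z.1‖ * ‖score (ψ k) (z.1 + z.2) - score (ψ k) z.1‖ ≤ (1 + δ) * δ :=
      mul_le_mul h2 (not_le.1 hcon).le (norm_nonneg _) (by positivity)
    have h6 : (1 - δ) ^ 2 ≤ ‖score (ψ k) z.1‖ ^ 2 := pow_le_pow_left₀ (by linarith) h1 2
    rw [e] at h3
    nlinarith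
  have hGc : Tendsto (fun k => Real.sqrt ((joint (ψ k) t).real
      (alignedSet (ψ k) (t / d k) (1 - 3 * δ) (R k))ᶜ)) atTop (𝓝 0) := by
    have e1 : Tendsto (fun k => Real.sqrt ((noiseLaw (ψ k)).real (R k)ᶜ
        + Real.exp (t * (1 + δ) ^ 2 / 8) * Real.sqrt ((joint (ψ k) t).real {z | z.1 ∈ R k ∧
      (inner ℝ (score (ψ k) z.1) (score (ψ k) (z.1 + z.2)) : ℝ) < 1 - 3 * δ}))) atTop (𝓝 0) := by
      have e2 := (hRc.add ((halign.sqrt).const_mul (Real.exp (t * (1 + δ) ^ 2 / 8)))).sqrt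
      simpa using e2
    refine squeeze_zero (fun _ => Real.sqrt_nonneg _) (fun k => Real.sqrt_le_sqrt ?_) e1
    exact prod_real_alignedSet_compl_le (h.mem k) (h.pos k) ht (hRm k) (fun x hx => hx.2)
  filter_upwards [hK, hRc.eventually_le_const (show 0 < η / 4 by positivity),
    hGc.eventually_le_const (show 0 < δ / 2 by positivity),
    h.eventually_exp_sub_le_affinity ht.le (show 0 < δ / 2 by positivity)] with k k1 k2 k3 k4
  obtain ⟨m1, m2⟩ := integral_sq_exp_incr_sub_exp_linStat_le (h.mem k) (h.pos k)
    (c := 1 - 3 * δ) (r := 1 - δ) (r' := 1 + δ) ht (by linarith) (hRm k) (fun x hx => hx.1)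
    (fun x hx => hx.2)
  set F : Vec (d k) × Vec (d k) → ℝ := fun z => (R k).indicator (fun _ => (1 : ℝ)) z.1 *
      (Real.exp (-incr (ψ k) z / 2) - Real.exp (-linStat (ψ k) z / 2 - t / 4)) with hF
  have hmk := measureReal_le_integral_sq_div m1 hρ
  have hFle : ∫ z, F z ^ 2 ∂(joint (ψ k) t) ≤ ρ ^ 2 * (η / 4) := by
    refine (m2.trans ?_).trans hδ.le
    simp only [hB]
    have : Real.exp (-t / 8) - δ ≤ affinity (ψ k) (t / d k) - Real.sqrt ((joint (ψ k) t).real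
      (alignedSet (ψ k) (t / d k) (1 - 3 * δ) (R k))ᶜ) := by linarith
    have := mul_le_mul_of_nonneg_left this (show 0 ≤ 2 * Real.exp
      (t * ((1 - δ) ^ 2 / 8 + (1 - 3 * δ) / 4 - 1 / 4)) by positivity)
    linarith
  have hbad : (joint (ψ k) t).real {z | ρ ≤ |F z|} ≤ η / 4 := by
    refine hmk.trans ?_
    rw [div_le_iff₀ (by positivity)]
    linarith
  have hRc' : (joint (ψ k) t).real ((R k)ᶜ ×ˢ Set.univ) = (noiseLaw (ψ k)).real (R k)ᶜ := by
    rw [measureReal_prod_prod, probReal_univ, mul_one]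
  have hsub : {z | ε ≤ |incr (ψ k) z - linStat (ψ k) z - t / 2|}
      ⊆ ((R k)ᶜ ×ˢ Set.univ ∪ {z | K ≤ |linStat (ψ k) z|}) ∪ {z | ρ ≤ |F z|} := by
    intro z hz
    by_contra hcon
    simp only [Set.mem_union, Set.mem_prod, Set.mem_compl_iff, Set.mem_univ, and_true,
      Set.mem_ofPred_eq, not_or, not_not, not_le] at hcon hz
    obtain ⟨⟨c1, c2⟩, c3⟩ := hcon
    have c2' := abs_lt.1 c2
    rw [hF] at c3
    simp only [Set.indicator_of_mem c1, one_mul] at c3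
    have := abs_sub_lt_of_abs_exp_neg_sub_lt (p := incr (ψ k) z / 2)
      (q := linStat (ψ k) z / 2 + t / 4) (R := K / 2 + t / 4) (ε := ε / 2) (by linarith) (by
        rw [← hρdef]
        have e1 : -(incr (ψ k) z / 2) = -incr (ψ k) z / 2 := by ring
        have e2 : -(linStat (ψ k) z / 2 + t / 4) = -linStat (ψ k) z / 2 - t / 4 := by ring
        rw [e1, e2]; exact c3)
    have h1 := abs_lt.1 this
    rw [le_abs] at hz
    rcases hz with hz | hz <;> linarith
  refine (measureReal_mono hsub).trans ((measureReal_union_le _ _).trans ?_)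
  have := measureReal_union_le (μ := joint (ψ k) t) ((R k)ᶜ ×ˢ Set.univ)
    {z | K ≤ |linStat (ψ k) z|}
  rw [hRc'] at this
  linarith

/-- At every scale, the increment of the potential along a Gaussian translation is asymptotically
linear. -/
lemma linearIncr (h : AsympRegular d ψ) {t : ℝ} (ht : 0 < t) : LinearIncr d ψ t := by
  -- Split the translation into steps below the critical scale.
  obtain ⟨m, hm⟩ := exists_nat_gt t
  have hm0 : (0 : ℝ) < m := ht.trans hm
  set s := t / m with hs
  have hs0 : 0 < s := by positivity
  have hs1 : s < 1 := by rw [hs, div_lt_one hm0]; exact hm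
  have hstab := h.stableScore_of_lt_one hs0 hs1
  have htight := h.tightIncr_of_lt_one hs0 hs1
  have key : ∀ j : ℕ, StableScore d ψ (s * (j + 1)) := by
    intro j
    induction j with
    | zero => simpa using hstab
    | succ j ih =>
      have := h.stableScore_add hs0 (by positivity) hstab ih htight
      have e : s + s * (j + 1) = s * ((j + 1 : ℕ) + 1) := by push_cast; ring
      rwa [e] at this
  obtain ⟨j, rfl⟩ : ∃ j : ℕ, m = j + 1 :=
    ⟨m - 1, by have : 0 < m := by exact_mod_cast hm0
               omega⟩
  have e : s * (j + 1) = t := by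
    rw [hs]; push_cast at hm0 ⊢; field_simp
  have := key j
  rw [e] at this
  exact h.linearIncr_of_stableScore ht this

end AsympRegular

end LinearIncrement

/-! ### Weak convergence to a pair of independent Gaussian variables -/

section Levy

/-- The distribution function of a normal variable of mean `t / 2` and variance `t`. -/
def incrCdf (t c : ℝ) : ℝ := (gaussianReal (t / 2) t.toNNReal).real (Set.Iic c)

/-- Lévy's continuity theorem for pairs of random variables whose limits are independent normal
variables of mean `t / 2` and variance `t`. -/
lemma tendsto_real_of_tendsto_charFun_pair {Ω : ℕ → Type*} [∀ k, MeasurableSpace (Ω k)]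
    {m : (k : ℕ) → Measure (Ω k)} [∀ k, IsProbabilityMeasure (m k)] {A B : (k : ℕ) → Ω k → ℝ}
    (hA : ∀ k, Measurable (A k)) (hB : ∀ k, Measurable (B k)) {t : ℝ} (ht : 0 < t)
    (h : ∀ s s' : ℝ, Tendsto
      (fun k => ∫ ω, Complex.exp (((s * A k ω + s' * B k ω : ℝ) : ℂ) * Complex.I) ∂(m k)) atTop
      (𝓝 (Complex.exp ((((s + s') * (t / 2) : ℝ) : ℂ) * Complex.I
        - ((t * (s ^ 2 + s' ^ 2) / 2 : ℝ) : ℂ))))) (c : ℝ) :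
    Tendsto (fun k => (m k).real {ω | A k ω ≤ c ∧ B k ω ≤ c}) atTop (𝓝 (incrCdf t c ^ 2)) ∧
    Tendsto (fun k => (m k).real {ω | A k ω ≤ c}) atTop (𝓝 (incrCdf t c)) := by
  set N := gaussianReal (t / 2) t.toNNReal with hN
  have hNprob : IsProbabilityMeasure N := by rw [hN]; infer_instance
  have hYm : ∀ k, Measurable (fun ω => WithLp.toLp 2 (A k ω, B k ω)) := fun k => by
    have := (hA k).prodMk (hB k)
    fun_prop
  set Y : ℕ → ProbabilityMeasure (WithLp 2 (ℝ × ℝ)) := fun k =>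
    ⟨(m k).map (fun ω => WithLp.toLp 2 (A k ω, B k ω)),
      Measure.isProbabilityMeasure_map (hYm k).aemeasurable⟩ with hY
  set Y₀ : ProbabilityMeasure (WithLp 2 (ℝ × ℝ)) :=
    ⟨(N.prod N).map (WithLp.toLp 2), Measure.isProbabilityMeasure_map (by fun_prop)⟩ with hY₀
  have hlim : Tendsto Y atTop (𝓝 Y₀) := by
    refine ProbabilityMeasure.tendsto_of_tendsto_charFun fun p => ?_
    have e0 : charFun (Y₀ : Measure (WithLp 2 (ℝ × ℝ))) p
        = Complex.exp ((((p.ofLp.1 + p.ofLp.2) * (t / 2) : ℝ) : ℂ) * Complex.I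
        - ((t * (p.ofLp.1 ^ 2 + p.ofLp.2 ^ 2) / 2 : ℝ) : ℂ)) := by
      rw [hY₀, ProbabilityMeasure.coe_mk, charFun_prod, hN, charFun_gaussianReal,
        charFun_gaussianReal, ← Complex.exp_add]
      congr 1
      simp only [Real.coe_toNNReal t ht.le]
      push_cast
      ring
    have ek : ∀ k, charFun (Y k : Measure (WithLp 2 (ℝ × ℝ))) p = ∫ ω, Complex.exp
        (((p.ofLp.1 * A k ω + p.ofLp.2 * B k ω : ℝ) : ℂ) * Complex.I) ∂(m k) := by
      intro k
      rw [charFun_apply, hY, ProbabilityMeasure.coe_mk, integral_map (hYm k).aemeasurable]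
      · congr 1
      · exact Continuous.aestronglyMeasurable (by fun_prop)
    rw [e0]
    simp_rw [ek]
    exact h _ _
  have hcont : Continuous (WithLp.ofLp : WithLp 2 (ℝ × ℝ) → ℝ × ℝ) := by fun_prop
  have hlim2 := ProbabilityMeasure.tendsto_map_of_tendsto_of_continuous Y Y₀ hlim hcont
  have hmap : ∀ S : Set (ℝ × ℝ), MeasurableSet S → (N.prod N) (frontier S) = 0 →
      Tendsto (fun k => (m k).real {ω | (A k ω, B k ω) ∈ S}) atTop (𝓝 ((N.prod N).real S)) := by
    intro S hS hfr
    have e0 : ((Y₀.map hcont.measurable.aemeasurable : ProbabilityMeasure (ℝ × ℝ)) :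
        Measure (ℝ × ℝ)) = N.prod N := by
      rw [ProbabilityMeasure.toMeasure_map, hY₀, ProbabilityMeasure.coe_mk,
        Measure.map_map (by fun_prop) (by fun_prop)]
      exact Measure.map_id
    have ek : ∀ k, ((Y k).map hcont.measurable.aemeasurable : Measure (ℝ × ℝ))
        = (m k).map (fun ω => (A k ω, B k ω)) := by
      intro k
      rw [ProbabilityMeasure.toMeasure_map, hY, ProbabilityMeasure.coe_mk,
        Measure.map_map (by fun_prop) (hYm k)]
      rfl
    have := ProbabilityMeasure.tendsto_measure_of_null_frontier_of_tendsto' hlim2 (E := S)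
      (by rw [e0]; exact hfr)
    rw [e0] at this
    simp_rw [ek] at this
    have h2 := (ENNReal.tendsto_toReal (measure_ne_top _ _)).comp this
    refine h2.congr fun k => ?_
    rw [Function.comp_apply, Measure.map_apply ((hA k).prodMk (hB k)) hS]
    rfl
  have hatom : N {c} = 0 := by
    have : NullSingletonClass N := nullSingletonClass_gaussianReal (by simpa using ht)
    exact measure_singleton c
  constructor
  · have := hmap (Set.Iic c ×ˢ Set.Iic c) (measurableSet_Iic.prod measurableSet_Iic) (by
      rw [frontier_prod_eq, frontier_Iic]
      refine measure_union_null ?_ ?_ <;> rw [Measure.prod_prod, hatom] <;> simp)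
    rw [measureReal_prod_prod, ← sq] at this
    exact this
  · have := hmap (Set.Iic c ×ˢ Set.univ) (measurableSet_Iic.prod MeasurableSet.univ) (by
      rw [frontier_prod_eq, frontier_Iic]
      refine measure_union_null ?_ ?_ <;> rw [Measure.prod_prod] <;> simp [hatom])
    rw [measureReal_prod_prod, probReal_univ, mul_one] at this
    refine this.congr fun k => ?_
    congr 1; ext ω; simp

end Levy

/-! ### The central limit theorem for the log-likelihood ratio -/

section CentralLimit

/-- Bounded sequences that are close in probability have the same limit of expectations. -/
lemma tendsto_integral_of_norm_sub_inProb {Ω : ℕ → Type*} [∀ k, MeasurableSpace (Ω k)]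
    {m : (k : ℕ) → Measure (Ω k)} [∀ k, IsProbabilityMeasure (m k)] {F G : (k : ℕ) → Ω k → ℂ}
    (hF : ∀ k, Measurable (F k)) (hG : ∀ k, Measurable (G k)) (hF1 : ∀ k ω, ‖F k ω‖ ≤ 1)
    (hG1 : ∀ k ω, ‖G k ω‖ ≤ 1)
    (h : ∀ δ > 0, Tendsto (fun k => (m k).real {ω | δ ≤ ‖F k ω - G k ω‖}) atTop (𝓝 0)) {z : ℂ}
    (hz : Tendsto (fun k => ∫ ω, G k ω ∂(m k)) atTop (𝓝 z)) :
    Tendsto (fun k => ∫ ω, F k ω ∂(m k)) atTop (𝓝 z) := by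
  have hFi : ∀ k, Integrable (F k) (m k) := fun k =>
    Integrable.of_bound (hF k).aestronglyMeasurable 1 (Eventually.of_forall (hF1 k))
  have hGi : ∀ k, Integrable (G k) (m k) := fun k =>
    Integrable.of_bound (hG k).aestronglyMeasurable 1 (Eventually.of_forall (hG1 k))
  have hd : Tendsto (fun k => ∫ ω, F k ω ∂(m k) - ∫ ω, G k ω ∂(m k)) atTop (𝓝 0) := by
    rw [tendsto_zero_iff_norm_tendsto_zero]
    refine tendsto_zero_of_forall_eventually_le (fun _ => norm_nonneg _) fun ε hε => ?_
    filter_upwards [(h (ε / 2) (by positivity)).eventually_le_const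
      (show 0 < ε / 4 by positivity)] with k hk
    have hm : MeasurableSet {ω | ε / 2 ≤ ‖F k ω - G k ω‖} :=
      measurableSet_le measurable_const ((hF k).sub (hG k)).norm
    have hi : Integrable (Set.indicator {ω | ε / 2 ≤ ‖F k ω - G k ω‖} (fun _ => (2 : ℝ))) (m k) :=
      (integrable_const _).indicator hm
    rw [← integral_sub (hFi k) (hGi k)]
    refine (norm_integral_le_integral_norm _).trans ?_
    have hle := integral_mono ((hFi k).sub (hGi k)).norm
      ((integrable_const (ε / 2)).fun_add hi) (fun ω => by
        simp only [Pi.sub_apply]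
        by_cases hω : ε / 2 ≤ ‖F k ω - G k ω‖
        · rw [Set.indicator_of_mem (by exact hω)]
          linarith [norm_sub_le (F k ω) (G k ω), hF1 k ω, hG1 k ω]
        · rw [Set.indicator_of_notMem (by exact hω)]
          linarith [not_le.1 hω])
    rw [integral_add (integrable_const _) hi, integral_indicator hm] at hle
    simp only [integral_const, probReal_univ, smul_eq_mul, one_mul,
      measureReal_restrict_apply_univ, Pi.sub_apply] at hle
    linarith
  have := hd.add hz
  simpa using this

lemma norm_exp_mul_I_sub_le (a b : ℝ) :
    ‖Complex.exp ((a : ℂ) * Complex.I) - Complex.exp ((b : ℂ) * Complex.I)‖ ≤ |a - b| := by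
  have e : Complex.exp ((a : ℂ) * Complex.I) - Complex.exp ((b : ℂ) * Complex.I)
      = Complex.exp ((b : ℂ) * Complex.I) *
        (Complex.exp (Complex.I * ((a - b : ℝ) : ℂ)) - 1) := by
    rw [mul_sub, ← Complex.exp_add, mul_one]; congr 2; push_cast; ring
  rw [e, norm_mul, Complex.norm_exp_ofReal_mul_I, one_mul]
  exact Real.norm_exp_I_mul_ofReal_sub_one_le

lemma abs_exp_neg_sub_le {a b : ℝ} (ha : 0 ≤ a) (hb : 0 ≤ b) :
    |Real.exp (-a) - Real.exp (-b)| ≤ |a - b| := by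
  wlog hab : a ≤ b generalizing a b
  · rw [abs_sub_comm, abs_sub_comm a b]; exact this hb ha (not_le.1 hab).le
  have h1 : Real.exp (-b) ≤ Real.exp (-a) := Real.exp_le_exp.2 (by linarith)
  rw [abs_of_nonneg (by linarith), abs_of_nonpos (by linarith)]
  have h2 : Real.exp (-a) * (1 - (b - a)) ≤ Real.exp (-b) := by
    have := Real.add_one_le_exp (-(b - a))
    have h3 : Real.exp (-b) = Real.exp (-a) * Real.exp (-(b - a)) := by
      rw [← Real.exp_add]; congr 1; ring
    rw [h3]
    exact mul_le_mul_of_nonneg_left (by linarith) (Real.exp_pos _).le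
  have h4 : Real.exp (-a) ≤ 1 := Real.exp_le_one_iff.2 (by linarith)
  nlinarith

variable {d : ℕ → ℕ} {ψ : (k : ℕ) → Vec (d k) → ℝ}

/-- The law of two independent copies of the noise together with one independent Gaussian
translation. -/
abbrev replicaLaw {n : ℕ} (ψ : Vec n → ℝ) (t : ℝ) : Measure ((Vec n × Vec n) × Vec n) :=
  ((noiseLaw ψ).prod (noiseLaw ψ)).prod (gaussVec n (t / n))

/-- The mean square fluctuation of a conditional probability, expressed through two replicas of the
noise that share the same translation. -/
lemma integral_sq_cdf_incr_sub_eq {n : ℕ} {ψ : Vec n → ℝ} (hψ : ψ ∈ potentials n) (t c b : ℝ) :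
    ∫ v, ((noiseLaw ψ).real {x | ψ (x + v) - ψ x ≤ c} - b) ^ 2 ∂(gaussVec n (t / n))
      = (replicaLaw ψ t).real {ω | incr ψ (ω.1.1, ω.2) ≤ c ∧ incr ψ (ω.1.2, ω.2) ≤ c}
        - 2 * b * (replicaLaw ψ t).real {ω | incr ψ (ω.1.1, ω.2) ≤ c} + b ^ 2 := by
  have := isProbabilityMeasure_noiseLaw hψ
  have hm1 : Measurable fun ω : (Vec n × Vec n) × Vec n => incr ψ (ω.1.1, ω.2) :=
    (measurable_incr hψ).comp (by fun_prop)
  have hm2 : Measurable fun ω : (Vec n × Vec n) × Vec n => incr ψ (ω.1.2, ω.2) :=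
    (measurable_incr hψ).comp (by fun_prop)
  set γ := gaussVec n (t / n) with hγ
  obtain ⟨q, hq⟩ : ∃ q : Vec n → ℝ, ∀ v, q v = (noiseLaw ψ).real {x | ψ (x + v) - ψ x ≤ c} :=
    ⟨_, fun _ => rfl⟩
  have hqm : Measurable q := by
    have : q = fun v => (noiseLaw ψ).real {x | (x, v) ∈ {z | incr ψ z ≤ c}} := funext hq
    rw [this]
    exact measurable_measureReal_section (noiseLaw ψ)
      (measurableSet_le (measurable_incr hψ) measurable_const)
  have hq01 : ∀ v, 0 ≤ q v ∧ q v ≤ 1 := fun v => by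
    rw [hq]; exact ⟨measureReal_nonneg, measureReal_le_one⟩
  have hqi : Integrable q γ :=
    Integrable.of_bound (C := 1) hqm.aestronglyMeasurable (Eventually.of_forall fun v => by
      rw [Real.norm_eq_abs, abs_of_nonneg (hq01 v).1]; exact (hq01 v).2)
  have hqi2 : Integrable (fun v => q v ^ 2) γ :=
    Integrable.of_bound (C := 1) (hqm.pow_const 2).aestronglyMeasurable
      (Eventually.of_forall fun v => by
        rw [Real.norm_eq_abs, abs_of_nonneg (sq_nonneg _)]
        exact pow_le_one₀ (hq01 v).1 (hq01 v).2)
  have s1 : (replicaLaw ψ t).real {ω | incr ψ (ω.1.1, ω.2) ≤ c ∧ incr ψ (ω.1.2, ω.2) ≤ c}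
      = ∫ v, q v ^ 2 ∂γ := by
    have hS : MeasurableSet {ω : (Vec n × Vec n) × Vec n |
        incr ψ (ω.1.1, ω.2) ≤ c ∧ incr ψ (ω.1.2, ω.2) ≤ c} :=
      (measurableSet_le hm1 measurable_const).inter (measurableSet_le hm2 measurable_const)
    rw [prod_real_eq_integral_symm _ _ hS]
    refine integral_congr_ae (Eventually.of_forall fun v => ?_)
    have e : {p : Vec n × Vec n | (p, v) ∈ {ω : (Vec n × Vec n) × Vec n |
        incr ψ (ω.1.1, ω.2) ≤ c ∧ incr ψ (ω.1.2, ω.2) ≤ c}}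
        = {x | ψ (x + v) - ψ x ≤ c} ×ˢ {x | ψ (x + v) - ψ x ≤ c} := rfl
    simp only [hq]
    rw [sq, ← measureReal_prod_prod]
    rfl
  have s2 : (replicaLaw ψ t).real {ω | incr ψ (ω.1.1, ω.2) ≤ c} = ∫ v, q v ∂γ := by
    rw [prod_real_eq_integral_symm _ _ (measurableSet_le hm1 measurable_const)]
    refine integral_congr_ae (Eventually.of_forall fun v => ?_)
    have e : {p : Vec n × Vec n | (p, v) ∈ {ω : (Vec n × Vec n) × Vec n |
        incr ψ (ω.1.1, ω.2) ≤ c}} = {x | ψ (x + v) - ψ x ≤ c} ×ˢ Set.univ := by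
      ext p; simp [incr]
    simp only
    rw [e, measureReal_prod_prod, probReal_univ, mul_one, hq]
  rw [s1, s2]
  simp_rw [← hq]
  have e1 : ∀ v, (q v - b) ^ 2 = q v ^ 2 - 2 * b * q v + b ^ 2 := fun v => by ring
  simp_rw [e1]
  have hqi3 : Integrable (fun v => q v ^ 2 - 2 * b * q v) γ := hqi2.sub (hqi.const_mul _)
  rw [integral_add hqi3 (integrable_const _),
    integral_sub hqi2 (hqi.const_mul _), integral_const_mul]
  simp

namespace AsympRegular

lemma tendsto_prod_of_tendsto (h : AsympRegular d ψ) {S : (k : ℕ) → Set (Vec (d k))}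
    (hS : Tendsto (fun k => (noiseLaw (ψ k)).real (S k)) atTop (𝓝 0)) :
    Tendsto (fun k => ((noiseLaw (ψ k)).prod (noiseLaw (ψ k))).real {p | p.1 ∈ S k})
      atTop (𝓝 0) ∧
    Tendsto (fun k => ((noiseLaw (ψ k)).prod (noiseLaw (ψ k))).real {p | p.2 ∈ S k})
      atTop (𝓝 0) := by
  have hprob := h.isProbabilityMeasure
  constructor
  · refine hS.congr fun k => ?_
    have e : {p : Vec (d k) × Vec (d k) | p.1 ∈ S k} = S k ×ˢ Set.univ := by ext; simp
    rw [e, measureReal_prod_prod, probReal_univ, mul_one]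
  · refine hS.congr fun k => ?_
    have e : {p : Vec (d k) × Vec (d k) | p.2 ∈ S k} = Set.univ ×ˢ S k := by ext; simp
    rw [e, measureReal_prod_prod, probReal_univ, one_mul]

/-- The scores of two independent copies of the noise are asymptotically orthogonal. -/
lemma tendsto_inner_score (h : AsympRegular d ψ) {δ : ℝ} (hδ : 0 < δ) :
    Tendsto (fun k => ((noiseLaw (ψ k)).prod (noiseLaw (ψ k))).real
      {p | δ ≤ |(inner ℝ (score (ψ k) p.2) (score (ψ k) p.1) : ℝ)|}) atTop (𝓝 0) := by
  have hprob := h.isProbabilityMeasure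
  have hlim : Tendsto (fun k => (1 + opNorm (GDP.fisher (ψ k) - 1)) / d k *
      (∫ x, ‖score (ψ k) x‖ ^ 2 ∂(noiseLaw (ψ k))) / δ ^ 2) atTop (𝓝 0) := by
    have h1 : Tendsto (fun k => ((d k : ℝ))⁻¹) atTop (𝓝 0) :=
      tendsto_inv_atTop_zero.comp (tendsto_natCast_atTop_atTop.comp h.dim)
    have h2 := (((h.fisher.const_add 1).mul h1).mul
      (h.tendsto_integral_sq_norm_score.div_const (δ ^ 2)))
    simp only [add_zero, mul_zero, zero_mul] at h2
    refine h2.congr fun k => ?_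
    ring
  refine squeeze_zero (fun _ => measureReal_nonneg) (fun k => ?_) hlim
  have hm : Measurable (fun p : Vec (d k) × Vec (d k) =>
      (inner ℝ (score (ψ k) p.2) (score (ψ k) p.1) : ℝ)) :=
    (measurable_score.comp measurable_snd).inner (𝕜 := ℝ) (measurable_score.comp measurable_fst)
  have hn2 : Integrable (fun p : Vec (d k) × Vec (d k) => ‖score (ψ k) p.1‖ ^ 2 *
      ‖score (ψ k) p.2‖ ^ 2) ((noiseLaw (ψ k)).prod (noiseLaw (ψ k))) :=
    (integrable_sq_norm_score (h.mem k)).mul_prod (integrable_sq_norm_score (h.mem k))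
  have hi : Integrable (fun p : Vec (d k) × Vec (d k) =>
      (inner ℝ (score (ψ k) p.2) (score (ψ k) p.1) : ℝ) ^ 2)
      ((noiseLaw (ψ k)).prod (noiseLaw (ψ k))) := by
    refine hn2.mono' (hm.pow_const 2).aestronglyMeasurable (Eventually.of_forall fun p => ?_)
    rw [Real.norm_eq_abs, abs_of_nonneg (sq_nonneg _), ← mul_pow, ← sq_abs]
    refine pow_le_pow_left₀ (abs_nonneg _) ?_ 2
    rw [mul_comm]
    exact abs_real_inner_le_norm _ _
  refine (measureReal_le_integral_sq_div hi hδ).trans ?_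
  rw [integral_prod_symm _ hi]
  gcongr
  exact integral_integral_sq_inner_score_le (h.mem k)

/-- The scores of two replicas asymptotically form an orthonormal pair. -/
lemma tendsto_sq_norm_smul_score (h : AsympRegular d ψ) (s s' : ℝ) {η : ℝ} (hη : 0 < η) :
    Tendsto (fun k => ((noiseLaw (ψ k)).prod (noiseLaw (ψ k))).real
      {p | η ≤ |‖s • score (ψ k) p.1 + s' • score (ψ k) p.2‖ ^ 2 - (s ^ 2 + s' ^ 2)|})
      atTop (𝓝 0) := by
  have hprob := h.isProbabilityMeasure
  set C := 4 * (s ^ 2 + s' ^ 2) + 1 with hC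
  have hC0 : 0 < C := by positivity
  obtain ⟨δ, hδ0, hδ1, hδC⟩ : ∃ δ : ℝ, 0 < δ ∧ δ ≤ 1 ∧ C * δ ≤ η :=
    ⟨min 1 (η / C), lt_min one_pos (by positivity), min_le_left _ _, by
      have := mul_le_mul_of_nonneg_left (min_le_right 1 (η / C)) hC0.le
      rwa [mul_div_cancel₀ _ hC0.ne'] at this⟩
  obtain ⟨h1, h2⟩ := h.tendsto_prod_of_tendsto (h.norm_score δ hδ0)
  have h3 := (h1.add h2).add (h.tendsto_inner_score hδ0)
  rw [add_zero, add_zero] at h3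
  refine squeeze_zero (fun _ => measureReal_nonneg) (fun k => ?_) h3
  refine le_trans (measureReal_mono fun p hp => ?_) ((measureReal_union_le _ _).trans
    (add_le_add (measureReal_union_le _ _) le_rfl))
  by_contra hcon
  simp only [Set.mem_union, Set.mem_ofPred_eq, not_or, not_le] at hcon hp
  obtain ⟨⟨c1, c2⟩, c3⟩ := hcon
  have e : ‖s • score (ψ k) p.1 + s' • score (ψ k) p.2‖ ^ 2 - (s ^ 2 + s' ^ 2)
      = s ^ 2 * (‖score (ψ k) p.1‖ ^ 2 - 1) + s' ^ 2 * (‖score (ψ k) p.2‖ ^ 2 - 1)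
        + 2 * (s * s') * inner ℝ (score (ψ k) p.2) (score (ψ k) p.1) := by
    rw [norm_add_sq_real, norm_smul, norm_smul, mul_pow, mul_pow, real_inner_smul_left,
      real_inner_smul_right, Real.norm_eq_abs, Real.norm_eq_abs, sq_abs, sq_abs,
      real_inner_comm (score (ψ k) p.1) (score (ψ k) p.2)]
    ring
  have hsq : ∀ r : ℝ, 0 ≤ r → |r - 1| < δ → |r ^ 2 - 1| < 3 * δ := by
    intro r hr hrδ
    have := abs_lt.1 hrδ
    rw [abs_lt]; constructor <;> nlinarith
  have q1 := hsq _ (norm_nonneg _) c1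
  have q2 := hsq _ (norm_nonneg _) c2
  have hss : |s * s'| ≤ (s ^ 2 + s' ^ 2) / 2 := by
    rw [abs_mul]; nlinarith [sq_nonneg (|s| - |s'|), sq_abs s, sq_abs s']
  have b1 : |s ^ 2 * (‖score (ψ k) p.1‖ ^ 2 - 1)| ≤ s ^ 2 * (3 * δ) := by
    rw [abs_mul, abs_of_nonneg (sq_nonneg s)]; gcongr
  have b2 : |s' ^ 2 * (‖score (ψ k) p.2‖ ^ 2 - 1)| ≤ s' ^ 2 * (3 * δ) := by
    rw [abs_mul, abs_of_nonneg (sq_nonneg s')]; gcongr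
  have b3 : |2 * (s * s') * (inner ℝ (score (ψ k) p.2) (score (ψ k) p.1) : ℝ)|
      ≤ (s ^ 2 + s' ^ 2) * δ := by
    rw [abs_mul, abs_mul, abs_of_pos (show (0 : ℝ) < 2 by norm_num)]
    refine mul_le_mul (by linarith) c3.le (abs_nonneg _) (by positivity)
  rw [e] at hp
  have t1 := abs_add_le (s ^ 2 * (‖score (ψ k) p.1‖ ^ 2 - 1)
    + s' ^ 2 * (‖score (ψ k) p.2‖ ^ 2 - 1))
    (2 * (s * s') * (inner ℝ (score (ψ k) p.2) (score (ψ k) p.1) : ℝ))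
  have t2 := abs_add_le (s ^ 2 * (‖score (ψ k) p.1‖ ^ 2 - 1))
    (s' ^ 2 * (‖score (ψ k) p.2‖ ^ 2 - 1))
  have : C * δ = 4 * (s ^ 2 + s' ^ 2) * δ + δ := by rw [hC]; ring
  linarith

/-- Given the noise, the linear statistics of two replicas are jointly Gaussian; asymptotically
they are independent. -/
lemma tendsto_charFun_linStat (h : AsympRegular d ψ) {t : ℝ} (ht : 0 < t) (s s' : ℝ) :
    Tendsto (fun k => ∫ ω, Complex.exp (((s * linStat (ψ k) (ω.1.1, ω.2)
      + s' * linStat (ψ k) (ω.1.2, ω.2) : ℝ) : ℂ) * Complex.I) ∂(replicaLaw (ψ k) t)) atTop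
      (𝓝 (Complex.exp (-((t * (s ^ 2 + s' ^ 2) / 2 : ℝ) : ℂ)))) := by
  have hprob := h.isProbabilityMeasure
  have hlm : ∀ k, Measurable fun ω : (Vec (d k) × Vec (d k)) × Vec (d k) =>
      s * linStat (ψ k) (ω.1.1, ω.2) + s' * linStat (ψ k) (ω.1.2, ω.2) := fun k => by
    have hl := measurable_linStat (ψ := ψ k)
    exact ((hl.comp (by fun_prop)).const_mul s).add ((hl.comp (by fun_prop)).const_mul s')
  have hval : ∀ k, ∫ ω, Complex.exp (((s * linStat (ψ k) (ω.1.1, ω.2)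
      + s' * linStat (ψ k) (ω.1.2, ω.2) : ℝ) : ℂ) * Complex.I) ∂(replicaLaw (ψ k) t)
      = ∫ p, Complex.exp (-((t * ‖s • score (ψ k) p.1 + s' • score (ψ k) p.2‖ ^ 2 / 2 : ℝ) : ℂ))
        ∂((noiseLaw (ψ k)).prod (noiseLaw (ψ k))) := by
    intro k
    have hn0 : (0 : ℝ) < d k := by exact_mod_cast h.pos k
    have hτ : 0 ≤ t / d k := by positivity
    rw [integral_prod]
    · congr 1; ext p
      have hc := charFun_gaussVec hτ (s • gradient (ψ k) p.1 + s' • gradient (ψ k) p.2)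
      rw [charFun_apply] at hc
      have e1 : ∀ v : Vec (d k), (inner ℝ v (s • gradient (ψ k) p.1 + s' • gradient (ψ k) p.2) : ℝ)
          = s * linStat (ψ k) (p.1, v) + s' * linStat (ψ k) (p.2, v) := by
        intro v; rw [inner_add_right, inner_smul_right, inner_smul_right]; rfl
      have e2 : t / d k * ‖s • gradient (ψ k) p.1 + s' • gradient (ψ k) p.2‖ ^ 2 / 2
          = t * ‖s • score (ψ k) p.1 + s' • score (ψ k) p.2‖ ^ 2 / 2 := by
        rw [gradient_eq_smul_score (h.pos k) p.1, gradient_eq_smul_score (h.pos k) p.2,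
          smul_comm s, smul_comm s', ← smul_add, norm_smul, mul_pow, Real.norm_eq_abs, sq_abs,
          Real.sq_sqrt hn0.le]
        field_simp
      rw [e2] at hc
      simp_rw [e1] at hc
      rw [hc]
    · refine Integrable.of_bound (C := 1) ?_ (Eventually.of_forall fun ω => ?_)
      · have := hlm k
        exact Measurable.aestronglyMeasurable (by fun_prop)
      · rw [Complex.norm_exp_ofReal_mul_I]
  simp_rw [hval]
  have hnm : ∀ a : ℝ, 0 ≤ a → ‖Complex.exp (-(a : ℂ))‖ ≤ 1 := by
    intro a ha
    rw [← Complex.ofReal_neg, ← Complex.ofReal_exp, Complex.norm_real, Real.norm_eq_abs,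
      Real.abs_exp, Real.exp_le_one_iff]
    linarith
  refine tendsto_integral_of_norm_sub_inProb
    (G := fun k _ => Complex.exp (-((t * (s ^ 2 + s' ^ 2) / 2 : ℝ) : ℂ))) (fun k => ?_)
    (fun k => measurable_const) (fun k p => hnm _ (by positivity))
    (fun k p => hnm _ (by positivity)) (fun δ hδ => ?_) ?_
  · have h1 : Measurable (fun p : Vec (d k) × Vec (d k) =>
        t * ‖s • score (ψ k) p.1 + s' • score (ψ k) p.2‖ ^ 2 / 2) :=
      (((((measurable_score.comp measurable_fst).const_smul s).add
        ((measurable_score.comp measurable_snd).const_smul s')).norm.pow_const 2).const_mul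
          t).div_const 2
    fun_prop
  · refine squeeze_zero (fun _ => measureReal_nonneg) (fun k => measureReal_mono fun p hp => ?_)
      (h.tendsto_sq_norm_smul_score s s' (show 0 < 2 * δ / t by positivity))
    rw [Set.mem_ofPred_eq] at hp ⊢
    rw [← Complex.ofReal_neg, ← Complex.ofReal_neg, ← Complex.ofReal_exp, ← Complex.ofReal_exp,
      ← Complex.ofReal_sub, Complex.norm_real, Real.norm_eq_abs] at hp
    have h1 := hp.trans (abs_exp_neg_sub_le (by positivity) (by positivity))
    rw [div_le_iff₀ ht]
    have e : t * ‖s • score (ψ k) p.1 + s' • score (ψ k) p.2‖ ^ 2 / 2 - t * (s ^ 2 + s' ^ 2) / 2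
        = t / 2 * (‖s • score (ψ k) p.1 + s' • score (ψ k) p.2‖ ^ 2 - (s ^ 2 + s' ^ 2)) := by ring
    rw [e, abs_mul, abs_of_pos (show 0 < t / 2 by positivity)] at h1
    linarith
  · simp only [integral_const, probReal_univ, one_smul]
    exact tendsto_const_nhds

/-- The increments of two replicas are asymptotically independent normal variables. -/
lemma tendsto_charFun_incr (h : AsympRegular d ψ) {t : ℝ} (ht : 0 < t) (s s' : ℝ) :
    Tendsto (fun k => ∫ ω, Complex.exp (((s * incr (ψ k) (ω.1.1, ω.2)
      + s' * incr (ψ k) (ω.1.2, ω.2) : ℝ) : ℂ) * Complex.I) ∂(replicaLaw (ψ k) t)) atTop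
      (𝓝 (Complex.exp ((((s + s') * (t / 2) : ℝ) : ℂ) * Complex.I
        - ((t * (s ^ 2 + s' ^ 2) / 2 : ℝ) : ℂ)))) := by
  have hprob := h.isProbabilityMeasure
  have hlm : ∀ k, Measurable fun ω : (Vec (d k) × Vec (d k)) × Vec (d k) =>
      s * linStat (ψ k) (ω.1.1, ω.2) + s' * linStat (ψ k) (ω.1.2, ω.2) := fun k => by
    have hl := measurable_linStat (ψ := ψ k)
    exact ((hl.comp (by fun_prop)).const_mul s).add ((hl.comp (by fun_prop)).const_mul s')
  have him : ∀ k, Measurable fun ω : (Vec (d k) × Vec (d k)) × Vec (d k) =>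
      s * incr (ψ k) (ω.1.1, ω.2) + s' * incr (ψ k) (ω.1.2, ω.2) := fun k => by
    have hl := measurable_incr (h.mem k)
    exact ((hl.comp (by fun_prop)).const_mul s).add ((hl.comp (by fun_prop)).const_mul s')
  have hfst : ∀ k, (replicaLaw (ψ k) t).map (fun ω => (ω.1.1, ω.2)) = joint (ψ k) t := by
    intro k
    have h1 : ((noiseLaw (ψ k)).prod (noiseLaw (ψ k))).map Prod.fst = noiseLaw (ψ k) := by simp
    have := Measure.map_prod_map ((noiseLaw (ψ k)).prod (noiseLaw (ψ k)))
      (gaussVec (d k) (t / d k))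
      (measurable_fst : Measurable (Prod.fst : Vec (d k) × Vec (d k) → Vec (d k))) measurable_id
    rw [h1, Measure.map_id] at this
    exact this.symm
  have hsnd : ∀ k, (replicaLaw (ψ k) t).map (fun ω => (ω.1.2, ω.2)) = joint (ψ k) t := by
    intro k
    have h1 : ((noiseLaw (ψ k)).prod (noiseLaw (ψ k))).map Prod.snd = noiseLaw (ψ k) := by simp
    have := Measure.map_prod_map ((noiseLaw (ψ k)).prod (noiseLaw (ψ k)))
      (gaussVec (d k) (t / d k))
      (measurable_snd : Measurable (Prod.snd : Vec (d k) × Vec (d k) → Vec (d k))) measurable_id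
    rw [h1, Measure.map_id] at this
    exact this.symm
  refine tendsto_integral_of_norm_sub_inProb (G := fun k ω => Complex.exp
    (((s * linStat (ψ k) (ω.1.1, ω.2) + s' * linStat (ψ k) (ω.1.2, ω.2)
      + (s + s') * (t / 2) : ℝ) : ℂ) * Complex.I)) (fun k => ?_) (fun k => ?_)
    (fun k ω => (Complex.norm_exp_ofReal_mul_I _).le)
    (fun k ω => (Complex.norm_exp_ofReal_mul_I _).le) (fun δ hδ => ?_) ?_
  · have := him k; fun_prop
  · have := hlm k; fun_prop
  · set C := |s| + |s'| + 1 with hC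
    have hC0 : 0 < C := by positivity
    set η := δ / C with hη
    have hη0 : 0 < η := by positivity
    have hEm : ∀ k, MeasurableSet {z | η ≤ |incr (ψ k) z - linStat (ψ k) z - t / 2|} := fun k =>
      measurableSet_le measurable_const
        (((measurable_incr (h.mem k)).sub measurable_linStat).sub_const _).abs
    have hlin := h.linearIncr ht η hη0
    have h3 := hlin.add hlin
    rw [add_zero] at h3
    refine squeeze_zero (fun _ => measureReal_nonneg) (fun k => ?_) h3
    have m1 := map_measureReal_apply (μ := replicaLaw (ψ k) t)
      (f := fun ω => (ω.1.1, ω.2)) (by fun_prop) (hEm k)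
    have m2 := map_measureReal_apply (μ := replicaLaw (ψ k) t)
      (f := fun ω => (ω.1.2, ω.2)) (by fun_prop) (hEm k)
    rw [hfst k] at m1
    rw [hsnd k] at m2
    nth_rewrite 1 [m1]
    rw [m2]
    refine le_trans (measureReal_mono fun ω hω => ?_) (measureReal_union_le _ _)
    by_contra hcon
    simp only [Set.mem_union, Set.mem_preimage, Set.mem_ofPred_eq, not_or, not_le] at hcon
    have h4 := le_trans (show δ ≤ _ from hω) (norm_exp_mul_I_sub_le _ _)
    have e : s * incr (ψ k) (ω.1.1, ω.2) + s' * incr (ψ k) (ω.1.2, ω.2)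
        - (s * linStat (ψ k) (ω.1.1, ω.2) + s' * linStat (ψ k) (ω.1.2, ω.2) + (s + s') * (t / 2))
        = s * (incr (ψ k) (ω.1.1, ω.2) - linStat (ψ k) (ω.1.1, ω.2) - t / 2)
          + s' * (incr (ψ k) (ω.1.2, ω.2) - linStat (ψ k) (ω.1.2, ω.2) - t / 2) := by ring
    rw [e] at h4
    have t1 := abs_add_le (s * (incr (ψ k) (ω.1.1, ω.2) - linStat (ψ k) (ω.1.1, ω.2) - t / 2))
      (s' * (incr (ψ k) (ω.1.2, ω.2) - linStat (ψ k) (ω.1.2, ω.2) - t / 2))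
    rw [abs_mul, abs_mul] at t1
    have t2 := mul_le_mul_of_nonneg_left hcon.1.le (abs_nonneg s)
    have t3 := mul_le_mul_of_nonneg_left hcon.2.le (abs_nonneg s')
    have : C * η = δ := by rw [hη]; field_simp
    have : C * η = |s| * η + |s'| * η + η := by rw [hC]; ring
    linarith
  · have hl := (h.tendsto_charFun_linStat ht s s').const_mul
      (Complex.exp ((((s + s') * (t / 2) : ℝ) : ℂ) * Complex.I))
    rw [← Complex.exp_add, ← sub_eq_add_neg] at hl
    refine hl.congr fun k => ?_
    rw [← integral_const_mul]
    congr 1; ext ω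
    rw [← Complex.exp_add]
    congr 1
    push_cast
    ring

/-- The distribution function of the increment, given the Gaussian translation, converges in mean
square to that of a normal variable. -/
lemma tendsto_integral_sq_cdf_incr_sub (h : AsympRegular d ψ) {t : ℝ} (ht : 0 < t) (c : ℝ) :
    Tendsto (fun k => ∫ v, ((noiseLaw (ψ k)).real {x | ψ k (x + v) - ψ k x ≤ c} - incrCdf t c) ^ 2
      ∂(gaussVec (d k) (t / d k))) atTop (𝓝 0) := by
  have hprob := h.isProbabilityMeasure
  have hm1 : ∀ k, Measurable fun ω : (Vec (d k) × Vec (d k)) × Vec (d k) =>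
      incr (ψ k) (ω.1.1, ω.2) := fun k => (measurable_incr (h.mem k)).comp (by fun_prop)
  have hm2 : ∀ k, Measurable fun ω : (Vec (d k) × Vec (d k)) × Vec (d k) =>
      incr (ψ k) (ω.1.2, ω.2) := fun k => (measurable_incr (h.mem k)).comp (by fun_prop)
  obtain ⟨h2, h1⟩ := tendsto_real_of_tendsto_charFun_pair hm1 hm2 ht
    (h.tendsto_charFun_incr ht) c
  have h3 := (h2.sub (h1.const_mul (2 * incrCdf t c))).add_const (incrCdf t c ^ 2)
  have e0 : incrCdf t c ^ 2 - 2 * incrCdf t c * incrCdf t c + incrCdf t c ^ 2 = 0 := by ring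
  rw [e0] at h3
  exact h3.congr fun k => (integral_sq_cdf_incr_sub_eq (h.mem k) t c (incrCdf t c)).symm

end AsympRegular

end CentralLimit

/-! ### The standard normal distribution function -/

section StdCdf

/-- The distribution function of the standard normal law. -/
def stdCdf (x : ℝ) : ℝ := (gaussianReal 0 1).real (Set.Iic x)

lemma stdCdf_nonneg (x : ℝ) : 0 ≤ stdCdf x := measureReal_nonneg

lemma stdCdf_le_one (x : ℝ) : stdCdf x ≤ 1 := measureReal_le_one

lemma stdCdf_mono : Monotone stdCdf := fun _ _ h => measureReal_mono (Set.Iic_subset_Iic.2 h)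

lemma stdCdf_eq_cdf (x : ℝ) : stdCdf x = cdf (gaussianReal 0 1) x := (cdf_eq_real _ x).symm

lemma tendsto_stdCdf_atBot : Tendsto stdCdf atBot (𝓝 0) := by
  simp_rw [funext stdCdf_eq_cdf]; exact tendsto_cdf_atBot _

lemma tendsto_stdCdf_atTop : Tendsto stdCdf atTop (𝓝 1) := by
  simp_rw [funext stdCdf_eq_cdf]; exact tendsto_cdf_atTop _

lemma stdCdf_sub {x y : ℝ} (h : x ≤ y) :
    stdCdf y - stdCdf x = (gaussianReal 0 1).real (Set.Ioc x y) := by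
  rw [stdCdf, stdCdf, ← Set.Iic_sdiff_Iic,
    measureReal_sdiff (Set.Iic_subset_Iic.2 h) measurableSet_Iic]

lemma stdCdf_strictMono : StrictMono stdCdf := by
  intro x y h
  have h1 := stdCdf_sub h.le
  have h2 : 0 < (gaussianReal 0 1).real (Set.Ioc x y) := by
    rw [measureReal_def, ENNReal.toReal_pos_iff]
    refine ⟨pos_iff_ne_zero.2 fun h0 => ?_, measure_lt_top _ _⟩
    have := gaussianReal_absolutelyContinuous' 0 one_ne_zero h0
    rw [Real.volume_Ioc, ENNReal.ofReal_eq_zero] at this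
    linarith
  linarith

lemma abs_stdCdf_sub_le (x y : ℝ) : |stdCdf x - stdCdf y| ≤ |x - y| := by
  wlog h : x ≤ y generalizing x y
  · rw [abs_sub_comm, abs_sub_comm x]; exact this y x (not_le.1 h).le
  rw [abs_sub_comm, abs_sub_comm x, stdCdf_sub h, abs_of_nonneg measureReal_nonneg,
    abs_of_nonneg (by linarith), measureReal_def,
    gaussianReal_apply_eq_integral 0 one_ne_zero, ENNReal.toReal_ofReal
      (integral_nonneg fun z => gaussianPDFReal_nonneg _ _ _)]
  have hle : ∀ z, gaussianPDFReal 0 1 z ≤ 1 := by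
    intro z
    rw [gaussianPDFReal]
    have h1 : (Real.sqrt (2 * Real.pi * (1 : NNReal)))⁻¹ ≤ 1 := by
      refine inv_le_one_of_one_le₀ ?_
      rw [Real.one_le_sqrt]
      have := Real.pi_gt_three
      push_cast; linarith
    have h2 : Real.exp (-(z - 0) ^ 2 / (2 * (1 : NNReal))) ≤ 1 := by
      rw [Real.exp_le_one_iff, neg_div, neg_nonpos]; positivity
    calc _ ≤ (1 : ℝ) * 1 := mul_le_mul h1 h2 (Real.exp_pos _).le zero_le_one
      _ = 1 := one_mul 1
  have : ∫ z in Set.Ioc x y, gaussianPDFReal 0 1 z ≤ ∫ _z in Set.Ioc x y, (1 : ℝ) :=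
    setIntegral_mono_on (integrable_gaussianPDFReal 0 1).integrableOn (by simp) measurableSet_Ioc
      fun z _ => hle z
  simpa [h] using this

lemma continuous_stdCdf : Continuous stdCdf :=
  LipschitzWith.continuous (K := 1) (LipschitzWith.of_dist_le_mul fun x y => by
    simpa [Real.dist_eq] using abs_stdCdf_sub_le x y)

lemma gaussianReal_real_Iic (m : ℝ) {s : ℝ} (hs : 0 < s) (c : ℝ) :
    (gaussianReal m (s ^ 2).toNNReal).real (Set.Iic c) = stdCdf ((c - m) / s) := by
  have e : (gaussianReal 0 1).map (fun x => s * x + m) = gaussianReal m (s ^ 2).toNNReal := by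
    have h1 : (fun x : ℝ => s * x + m) = (fun x => x + m) ∘ (fun x => s * x) := rfl
    rw [h1, ← Measure.map_map (by fun_prop) (by fun_prop), gaussianReal_map_const_mul,
      gaussianReal_map_add_const]
    congr 1
    · simp
    · ext; simp [sq_nonneg]
  rw [← e, map_measureReal_apply (by fun_prop) measurableSet_Iic, stdCdf]
  congr 1
  ext x
  simp only [Set.mem_preimage, Set.mem_Iic]
  rw [le_div_iff₀ hs]
  constructor <;> intro h <;> linarith

lemma incrCdf_eq {s : ℝ} (hs : 0 < s) (c : ℝ) :
    incrCdf (s ^ 2) c = stdCdf ((c - s ^ 2 / 2) / s) := gaussianReal_real_Iic _ hs c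

end StdCdf

/-! ### From Gaussian translations to translations in uniform directions -/

section Sphere

variable {d : ℕ → ℕ} {ψ : (k : ℕ) → Vec (d k) → ℝ}

lemma sphereUnif_real_eq {n : ℕ} (hn : 0 < n) {τ : ℝ} (hτ : 0 < τ) {S : Set (Vec n)}
    (hS : MeasurableSet S) :
    (sphereUnif n).real S = (gaussVec n τ).real {v | ‖v‖⁻¹ • v ∈ S} := by
  rw [← gaussVec_map_direction hn hτ, map_measureReal_apply measurable_direction hS]
  rfl

lemma measurable_cdf_incr {n : ℕ} {ψ : Vec n → ℝ} (hψ : ψ ∈ potentials n) (c r : ℝ) :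
    Measurable fun θ => (noiseLaw ψ).real {x | ψ (x + r • θ) - ψ x ≤ c} := by
  have := isProbabilityMeasure_noiseLaw hψ
  have h1 : MeasurableSet {z : Vec n × Vec n | incr ψ (z.1, r • z.2) ≤ c} :=
    measurableSet_le ((measurable_incr hψ).comp (by fun_prop)) measurable_const
  have h2 := measurable_measureReal_section (noiseLaw ψ) h1
  simp only [Set.mem_ofPred_eq, incr] at h2
  exact h2

namespace AsympRegular

lemma tendsto_cdf_incr_inProb (h : AsympRegular d ψ) {t : ℝ} (ht : 0 < t) (c : ℝ) {δ : ℝ}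
    (hδ : 0 < δ) :
    Tendsto (fun k => (gaussVec (d k) (t / d k)).real
      {v | δ ≤ |(noiseLaw (ψ k)).real {x | ψ k (x + v) - ψ k x ≤ c} - incrCdf t c|}) atTop (𝓝 0) := by
  have h1 := (h.tendsto_integral_sq_cdf_incr_sub ht c).div_const (δ ^ 2)
  rw [zero_div] at h1
  refine squeeze_zero (fun _ => measureReal_nonneg) (fun k => ?_) h1
  refine measureReal_le_integral_sq_div ?_ hδ
  have hprob := h.isProbabilityMeasure k
  have hm : Measurable fun v => (noiseLaw (ψ k)).real {x | ψ k (x + v) - ψ k x ≤ c} := by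
    simpa using measurable_cdf_incr (h.mem k) c 1
  refine Integrable.of_bound (C := (1 + |incrCdf t c|) ^ 2)
    ((hm.sub_const _).pow_const 2).aestronglyMeasurable (Eventually.of_forall fun v => ?_)
  rw [Real.norm_eq_abs, abs_of_nonneg (sq_nonneg _), ← sq_abs]
  refine pow_le_pow_left₀ (abs_nonneg _) ((abs_sub _ _).trans ?_) 2
  rw [abs_of_nonneg measureReal_nonneg]
  gcongr
  exact measureReal_le_one

/-- The lower bound on the distribution function of the increment of length `μ` in most directions.
By convexity, the increment over a slightly longer Gaussian vector dominates the one of length `μ` in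
the same direction, up to the factor of the lengths. -/
lemma eventually_sphere_cdf_ge (h : AsympRegular d ψ) {μ : ℝ} (hμ : 0 < μ) (c : ℝ) {δ η : ℝ}
    (hδ : 0 < δ) (hη : 0 < η) :
    ∀ᶠ k in atTop, (sphereUnif (d k)).real {θ | (noiseLaw (ψ k)).real
      {x | ψ k (x + μ • θ) - ψ k x ≤ c} ≤ incrCdf (μ ^ 2) c - δ} ≤ η := by
  set F : ℝ → ℝ := fun ε =>
    stdCdf ((c - 3 * ε * |c| - (μ * (1 + ε)) ^ 2 / 2) / (μ * (1 + ε))) with hF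
  have hFc : ContinuousAt F 0 := by
    refine continuous_stdCdf.continuousAt.comp (ContinuousAt.div (by fun_prop) (by fun_prop) ?_)
    simpa using hμ.ne'
  have hF0 : F 0 = incrCdf (μ ^ 2) c := by rw [incrCdf_eq hμ, hF]; simp
  obtain ⟨ε, hε0, hε1, hε⟩ : ∃ ε : ℝ, 0 < ε ∧ ε ≤ 1 / 3 ∧ incrCdf (μ ^ 2) c - δ / 2 < F ε := by
    have ht : Tendsto F (𝓝[>] 0) (𝓝 (incrCdf (μ ^ 2) c)) := by
      have := hFc.tendsto
      rw [hF0] at this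
      exact this.mono_left nhdsWithin_le_nhds
    have e1 := ht.eventually_const_lt
      (show incrCdf (μ ^ 2) c - δ / 2 < incrCdf (μ ^ 2) c by linarith)
    have e2 : ∀ᶠ e : ℝ in 𝓝[>] 0, e ∈ Set.Ioc (0 : ℝ) (1 / 3) := Ioc_mem_nhdsGT (by norm_num)
    obtain ⟨e, h1, h2⟩ := (e1.and e2).exists
    exact ⟨e, h2.1, h2.2, h1⟩
  have hs : 0 < μ * (1 + ε) := by positivity
  set T := (μ * (1 + ε)) ^ 2 with hT
  have hT0 : 0 < T := by positivity
  set c' := c - 3 * ε * |c| with hc'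
  have hFε : F ε = incrCdf T c' := by rw [hT, incrCdf_eq hs]
  have hμε : 0 < μ ^ 2 * ε := by positivity
  filter_upwards [(tendsto_gaussVec_norm_sq h.dim hT0 hμε).eventually_le_const
      (show 0 < η / 2 by positivity),
    (h.tendsto_cdf_incr_inProb hT0 c' (show 0 < δ / 2 by positivity)).eventually_le_const
      (show 0 < η / 2 by positivity)] with k k1 k2
  have hn0 : (0 : ℝ) < d k := by exact_mod_cast h.pos k
  have hprob := h.isProbabilityMeasure k
  rw [sphereUnif_real_eq (h.pos k) (show 0 < T / d k by positivity)
    (measurableSet_le (measurable_cdf_incr (h.mem k) c μ) measurable_const)]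
  refine le_trans (measureReal_mono (s₂ := {v | μ ^ 2 * ε ≤ |‖v‖ ^ 2 - T|} ∪ {v | δ / 2 ≤
    |(noiseLaw (ψ k)).real {x | ψ k (x + v) - ψ k x ≤ c'} - incrCdf T c'|}) fun v hv => ?_)
    ((measureReal_union_le _ _).trans (by linarith))
  by_contra hcon
  simp only [Set.mem_union, Set.mem_ofPred_eq, not_or, not_le] at hcon
  have c1 := abs_lt.1 hcon.1
  have c2 := abs_lt.1 hcon.2
  rw [Set.mem_ofPred_eq, Set.mem_ofPred_eq] at hv
  have hv0 := norm_nonneg v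
  have hTe : T = μ ^ 2 * (1 + 2 * ε + ε ^ 2) := by rw [hT]; ring
  have hge : μ ≤ ‖v‖ := by
    refine le_of_sq_le_sq ?_ hv0
    nlinarith
  have hle : ‖v‖ ≤ μ * (1 + 3 * ε) := by
    refine le_of_sq_le_sq ?_ (by positivity)
    nlinarith
  have hvpos : 0 < ‖v‖ := hμ.trans_le hge
  have hmono : (noiseLaw (ψ k)).real {x | ψ k (x + v) - ψ k x ≤ c'}
      ≤ (noiseLaw (ψ k)).real {x | ψ k (x + μ • ‖v‖⁻¹ • v) - ψ k x ≤ c} := by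
    refine measureReal_mono fun x hx => ?_
    rw [Set.mem_ofPred_eq] at hx ⊢
    have h1 := increment_le_mul (h.mem k).1 x v (s := μ / ‖v‖) (by positivity)
      ((div_le_one hvpos).2 hge)
    rw [smul_smul, ← div_eq_mul_inv]
    refine h1.trans ((mul_le_mul_of_nonneg_left hx (by positivity)).trans ?_)
    rw [div_mul_eq_mul_div, div_le_iff₀ hvpos]
    rcases le_total 0 c with h0 | h0
    · rw [hc', abs_of_nonneg h0]; nlinarith [mul_nonneg hε0.le h0, mul_nonneg hμ.le h0]
    · rw [hc', abs_of_nonpos h0]; nlinarith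
  rw [hFε] at hε
  linarith

/-- The upper bound on the distribution function of the increment of length `μ` in most directions,
by comparison with slightly shorter Gaussian vectors. -/
lemma eventually_sphere_cdf_le (h : AsympRegular d ψ) {μ : ℝ} (hμ : 0 < μ) (c : ℝ) {δ η : ℝ}
    (hδ : 0 < δ) (hη : 0 < η) :
    ∀ᶠ k in atTop, (sphereUnif (d k)).real {θ | incrCdf (μ ^ 2) c + δ ≤ (noiseLaw (ψ k)).real
      {x | ψ k (x + μ • θ) - ψ k x ≤ c}} ≤ η := by
  set F : ℝ → ℝ := fun ε =>
    stdCdf ((c + 3 * ε * |c| - (μ * (1 - ε)) ^ 2 / 2) / (μ * (1 - ε))) with hF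
  have hFc : ContinuousAt F 0 := by
    refine continuous_stdCdf.continuousAt.comp (ContinuousAt.div (by fun_prop) (by fun_prop) ?_)
    simpa using hμ.ne'
  have hF0 : F 0 = incrCdf (μ ^ 2) c := by rw [incrCdf_eq hμ, hF]; simp
  obtain ⟨ε, hε0, hε1, hε⟩ : ∃ ε : ℝ, 0 < ε ∧ ε ≤ 1 / 3 ∧ F ε < incrCdf (μ ^ 2) c + δ / 2 := by
    have ht : Tendsto F (𝓝[>] 0) (𝓝 (incrCdf (μ ^ 2) c)) := by
      have := hFc.tendsto
      rw [hF0] at this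
      exact this.mono_left nhdsWithin_le_nhds
    have e1 := ht.eventually_lt_const
      (show incrCdf (μ ^ 2) c < incrCdf (μ ^ 2) c + δ / 2 by linarith)
    have e2 : ∀ᶠ e : ℝ in 𝓝[>] 0, e ∈ Set.Ioc (0 : ℝ) (1 / 3) := Ioc_mem_nhdsGT (by norm_num)
    obtain ⟨e, h1, h2⟩ := (e1.and e2).exists
    exact ⟨e, h2.1, h2.2, h1⟩
  have hs : 0 < μ * (1 - ε) := mul_pos hμ (by linarith)
  set T := (μ * (1 - ε)) ^ 2 with hT
  have hT0 : 0 < T := by positivity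
  set c' := c + 3 * ε * |c| with hc'
  have hFε : F ε = incrCdf T c' := by rw [hT, incrCdf_eq hs]
  have hμε : 0 < μ ^ 2 * ε := by positivity
  filter_upwards [(tendsto_gaussVec_norm_sq h.dim hT0 hμε).eventually_le_const
      (show 0 < η / 2 by positivity),
    (h.tendsto_cdf_incr_inProb hT0 c' (show 0 < δ / 2 by positivity)).eventually_le_const
      (show 0 < η / 2 by positivity)] with k k1 k2
  have hn0 : (0 : ℝ) < d k := by exact_mod_cast h.pos k
  have hprob := h.isProbabilityMeasure k
  rw [sphereUnif_real_eq (h.pos k) (show 0 < T / d k by positivity)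
    (measurableSet_le measurable_const (measurable_cdf_incr (h.mem k) c μ))]
  refine le_trans (measureReal_mono (s₂ := {v | μ ^ 2 * ε ≤ |‖v‖ ^ 2 - T|} ∪ {v | δ / 2 ≤
    |(noiseLaw (ψ k)).real {x | ψ k (x + v) - ψ k x ≤ c'} - incrCdf T c'|}) fun v hv => ?_)
    ((measureReal_union_le _ _).trans (by linarith))
  by_contra hcon
  simp only [Set.mem_union, Set.mem_ofPred_eq, not_or, not_le] at hcon
  have c1 := abs_lt.1 hcon.1
  have c2 := abs_lt.1 hcon.2
  rw [Set.mem_ofPred_eq, Set.mem_ofPred_eq] at hv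
  have hv0 := norm_nonneg v
  have hTe : T = μ ^ 2 * (1 - 2 * ε + ε ^ 2) := by rw [hT]; ring
  have hle : ‖v‖ ≤ μ := by
    refine le_of_sq_le_sq ?_ hμ.le
    nlinarith [mul_nonneg hμε.le (show 0 ≤ 1 - ε by linarith)]
  have hge : μ * (1 - 3 * ε) ≤ ‖v‖ := by
    refine le_of_sq_le_sq ?_ hv0
    nlinarith [mul_nonneg hμε.le (show 0 ≤ 3 - 8 * ε by linarith)]
  have hmono : (noiseLaw (ψ k)).real {x | ψ k (x + μ • ‖v‖⁻¹ • v) - ψ k x ≤ c}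
      ≤ (noiseLaw (ψ k)).real {x | ψ k (x + v) - ψ k x ≤ c'} := by
    refine measureReal_mono fun x hx => ?_
    rw [Set.mem_ofPred_eq] at hx ⊢
    have h1 := increment_le_mul (h.mem k).1 x (μ • ‖v‖⁻¹ • v) (s := ‖v‖ / μ) (by positivity)
      ((div_le_one hμ).2 hle)
    have hvv : (‖v‖ / μ) • μ • ‖v‖⁻¹ • v = v := by
      rcases eq_or_ne v 0 with rfl | hv0
      · simp
      · rw [smul_smul, smul_smul, div_mul_cancel₀ _ hμ.ne', mul_inv_cancel₀ (norm_ne_zero_iff.2 hv0),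
          one_smul]
    rw [hvv] at h1
    refine h1.trans ((mul_le_mul_of_nonneg_left hx (by positivity)).trans ?_)
    rw [div_mul_eq_mul_div, div_le_iff₀ hμ]
    rcases le_total 0 c with h0 | h0
    · rw [hc', abs_of_nonneg h0]
      nlinarith [mul_nonneg (mul_nonneg hε0.le h0) hμ.le, mul_le_mul_of_nonneg_right hle h0]
    · rw [hc', abs_of_nonpos h0]; nlinarith
  rw [hFε] at hε
  linarith

end AsympRegular

end Sphere

/-! ### The Gaussian trade-off function -/

section GaussianTesting

variable {μ : ℝ}

/-- The Cameron-Martin formula on the real line. -/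
lemma integral_gaussianReal_exp_mul (μ : ℝ) (g : ℝ → ℝ) :
    ∫ x, Real.exp (μ * x - μ ^ 2 / 2) * g x ∂(gaussianReal 0 1) = ∫ x, g x ∂(gaussianReal μ 1) := by
  rw [integral_gaussianReal_eq_integral_smul one_ne_zero,
    integral_gaussianReal_eq_integral_smul one_ne_zero]
  refine integral_congr_ae (Eventually.of_forall fun x => ?_)
  simp only [gaussianPDFReal, smul_eq_mul]
  rw [← mul_assoc, mul_assoc _ (Real.exp _) (Real.exp _), ← Real.exp_add]
  congr 3
  push_cast
  ring

lemma integrable_exp_mul_gaussianReal_std (μ : ℝ) :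
    Integrable (fun x => Real.exp (μ * x - μ ^ 2 / 2)) (gaussianReal 0 1) := by
  have := (integrable_exp_mul_gaussianReal (μ := 0) (v := 1) μ).mul_const (Real.exp (-(μ ^ 2 / 2)))
  refine this.congr (Eventually.of_forall fun x => ?_)
  simp only [← Real.exp_add]
  congr 1

lemma gaussianReal_one_real_Iic (m c : ℝ) : (gaussianReal m 1).real (Set.Iic c) = stdCdf (c - m) := by
  have := gaussianReal_real_Iic m one_pos c
  simpa using this

lemma gaussianReal_one_real_Ioi (m c : ℝ) :
    (gaussianReal m 1).real (Set.Ioi c) = 1 - stdCdf (c - m) := by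
  rw [← gaussianReal_one_real_Iic, ← Set.compl_Iic, probReal_compl_eq_one_sub measurableSet_Iic]

lemma gaussianReal_real_eq_setIntegral (μ : ℝ) {A : Set ℝ} (hA : MeasurableSet A) :
    (gaussianReal μ 1).real A = ∫ x in A, Real.exp (μ * x - μ ^ 2 / 2) ∂(gaussianReal 0 1) := by
  rw [← integral_indicator_one hA, ← integral_gaussianReal_exp_mul, ← integral_indicator hA]
  congr 1
  ext x
  by_cases hx : x ∈ A <;> simp [hx]

/-- The value of the likelihood functional `E min (exp (c - L)) 1` for a pair of normal laws whose
means differ by `μ`, at the threshold `c` of the test with critical value `z`. -/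
lemma integral_min_exp_gaussianReal (hμ : 0 < μ) (z : ℝ) :
    ∫ x, min (Real.exp (μ * z - μ ^ 2 / 2 - (μ * x + μ ^ 2 / 2))) 1 ∂(gaussianReal 0 1)
      = stdCdf (z - μ) + Real.exp (μ * z - μ ^ 2 / 2) * (1 - stdCdf z) := by
  have e : ∀ x, min (Real.exp (μ * z - μ ^ 2 / 2 - (μ * x + μ ^ 2 / 2))) 1
      = (Set.Iic (z - μ)).indicator (fun _ => (1 : ℝ)) x + Real.exp (μ * z - μ ^ 2 / 2) *
        (Set.Ioi (z - μ)).indicator (fun x => Real.exp ((-μ) * x - (-μ) ^ 2 / 2)) x := by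
    intro x
    by_cases hx : x ≤ z - μ
    · rw [Set.indicator_of_mem (Set.mem_Iic.2 hx), Set.indicator_of_notMem (by simpa using hx),
        min_eq_right]
      · simp
      · rw [Real.one_le_exp_iff]; nlinarith
    · rw [Set.indicator_of_notMem (by simpa using hx), Set.indicator_of_mem (by simpa using hx),
        min_eq_left, ← Real.exp_add, zero_add]
      · congr 1; ring
      · rw [Real.exp_le_one_iff]; nlinarith [not_le.1 hx]
  simp_rw [e]
  rw [integral_add ((integrable_const (1 : ℝ)).indicator measurableSet_Iic)
    (((integrable_exp_mul_gaussianReal_std (-μ)).indicator measurableSet_Ioi).const_mul _),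
    integral_indicator measurableSet_Iic, setIntegral_const, integral_const_mul,
    integral_indicator measurableSet_Ioi, ← gaussianReal_real_eq_setIntegral (-μ) measurableSet_Ioi, gaussianReal_one_real_Ioi]
  simp [stdCdf]

lemma roc_le_one_sub {Ω : Type*} [MeasurableSpace Ω] {P Q : Measure Ω} [IsProbabilityMeasure Q]
    {A : Set Ω} (hA : MeasurableSet A) {α : ℝ} (h : P.real A ≤ α) : roc P Q α ≤ 1 - Q.real A := by
  refine csInf_le ⟨0, ?_⟩ ⟨A, hA, h, rfl⟩
  rintro _ ⟨B, _, _, rfl⟩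
  linarith [measureReal_le_one (μ := Q) (s := B)]

lemma le_roc {Ω : Type*} [MeasurableSpace Ω] {P Q : Measure Ω} {α b : ℝ} (hα : 0 ≤ α)
    (h : ∀ A, MeasurableSet A → P.real A ≤ α → b ≤ 1 - Q.real A) : b ≤ roc P Q α := by
  refine le_csInf ⟨1, ∅, MeasurableSet.empty, by simpa using hα, by simp⟩ ?_
  rintro _ ⟨A, hA, hAα, rfl⟩
  exact h A hA hAα

lemma roc_nonneg {Ω : Type*} [MeasurableSpace Ω] {P Q : Measure Ω} [IsProbabilityMeasure Q]
    {α : ℝ} (hα : 0 ≤ α) : 0 ≤ roc P Q α :=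
  le_roc hα fun A _ _ => by linarith [measureReal_le_one (μ := Q) (s := A)]

lemma roc_le_one {Ω : Type*} [MeasurableSpace Ω] {P Q : Measure Ω} [IsProbabilityMeasure Q]
    {α : ℝ} (hα : 0 ≤ α) : roc P Q α ≤ 1 := by
  have := roc_le_one_sub (P := P) (Q := Q) MeasurableSet.empty (by simpa using hα)
  simpa using this

lemma gaussianRoc_le (μ : ℝ) {z α : ℝ} (h : 1 - stdCdf z ≤ α) : gaussianRoc μ α ≤ stdCdf (z - μ) := by
  have h1 : (gaussianReal 0 1).real (Set.Ioi z) ≤ α := by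
    rw [gaussianReal_one_real_Ioi]; simpa using h
  have := roc_le_one_sub (Q := gaussianReal μ 1) measurableSet_Ioi h1
  rw [gaussianReal_one_real_Ioi] at this
  rw [gaussianRoc]; linarith

/-- The Neyman-Pearson lemma for two normal laws of unit variance. -/
lemma le_gaussianRoc (hμ : 0 ≤ μ) {z α : ℝ} (hα : 0 ≤ α) (h : α ≤ 1 - stdCdf z) :
    stdCdf (z - μ) ≤ gaussianRoc μ α := by
  refine le_roc hα fun A hA hAα => ?_
  -- The Neyman-Pearson comparison of `A` with the optimal region `Set.Ioi z`.
  set b := Real.exp (μ * z - μ ^ 2 / 2)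
  have hi : Integrable (fun x => Real.exp (μ * x - μ ^ 2 / 2) - b) (gaussianReal 0 1) :=
    (integrable_exp_mul_gaussianReal_std μ).sub (integrable_const b)
  have key : ∀ {B : Set ℝ}, MeasurableSet B → (gaussianReal μ 1).real B
      - b * (gaussianReal 0 1).real B
      = ∫ x, B.indicator (fun x => Real.exp (μ * x - μ ^ 2 / 2) - b) x ∂(gaussianReal 0 1) := by
    intro B hB
    rw [integral_indicator hB, integral_sub (integrable_exp_mul_gaussianReal_std μ).integrableOn
      (integrable_const b).integrableOn, ← gaussianReal_real_eq_setIntegral μ hB, setIntegral_const,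
      smul_eq_mul, mul_comm b]
  have hle : (gaussianReal μ 1).real A - b * (gaussianReal 0 1).real A
      ≤ (gaussianReal μ 1).real (Set.Ioi z) - b * (gaussianReal 0 1).real (Set.Ioi z) := by
    rw [key hA, key measurableSet_Ioi]
    refine integral_mono (hi.indicator hA) (hi.indicator measurableSet_Ioi) fun x => ?_
    by_cases hx : z < x
    · rw [Set.indicator_of_mem (Set.mem_Ioi.2 hx)]
      have h0 : b ≤ Real.exp (μ * x - μ ^ 2 / 2) := Real.exp_le_exp.2 (by nlinarith)
      by_cases hxA : x ∈ A
      · rw [Set.indicator_of_mem hxA]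
      · rw [Set.indicator_of_notMem hxA]; linarith
    · rw [Set.indicator_of_notMem (show x ∉ Set.Ioi z from hx)]
      have h0 : Real.exp (μ * x - μ ^ 2 / 2) ≤ b := Real.exp_le_exp.2 (by nlinarith)
      by_cases hxA : x ∈ A
      · rw [Set.indicator_of_mem hxA]; linarith
      · rw [Set.indicator_of_notMem hxA]
  rw [gaussianReal_one_real_Ioi, gaussianReal_one_real_Ioi, sub_zero] at hle
  have hb : 0 < b := Real.exp_pos _
  nlinarith

end GaussianTesting

/-! ### Testing the noise against its translates -/

section TranslateTesting

variable {n : ℕ} {ψ : Vec n → ℝ}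

/-- The likelihood ratio between a translate of the noise and the noise. -/
lemma noiseLaw_real_sub_mem (hψ : ψ ∈ potentials n) (h : Vec n) {A : Set (Vec n)}
    (hA : MeasurableSet A) :
    (noiseLaw ψ).real {x | x - h ∈ A}
      = ∫ x, A.indicator (fun x => Real.exp (-(ψ (x + h) - ψ x))) x ∂(noiseLaw ψ) := by
  have hAh : MeasurableSet {x | x - h ∈ A} := (measurable_sub_const h) hA
  rw [← integral_indicator_one hAh, integral_noiseLaw hψ, integral_noiseLaw hψ,
    ← integral_add_right_eq_self (fun x => sqrtDensity ψ x ^ 2 •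
      {x | x - h ∈ A}.indicator (1 : Vec n → ℝ) x) h]
  refine integral_congr_ae (Eventually.of_forall fun x => ?_)
  by_cases hx : x ∈ A
  · simp only [Set.indicator_of_mem hx,
      Set.indicator_of_mem (show x + h ∈ {x | x - h ∈ A} by simpa using hx), smul_eq_mul,
      sqrtDensity_add h x, mul_pow, ← Real.exp_nat_mul, Pi.one_apply, mul_one]
    congr 2; push_cast; ring
  · simp only [Set.indicator_of_notMem hx,
      Set.indicator_of_notMem (show x + h ∉ {x | x - h ∈ A} by simpa using hx), smul_zero]

/-- The increments of a convex function over a fixed vector increase along that direction. -/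
lemma increment_le_increment_add (hc : ConvexOn ℝ Set.univ ψ) (y h : Vec n) {r s : ℝ} (hr : 0 ≤ r)
    (hs : 0 ≤ s) : ψ (y + r • h) - ψ y ≤ ψ (y + s • h + r • h) - ψ (y + s • h) := by
  rcases (add_nonneg hr hs).eq_or_lt with h0 | h0
  · have hr0 : r = 0 := by linarith
    have hs0 : s = 0 := by linarith
    simp [hr0, hs0]
  have h1 := increment_le_mul hc y ((r + s) • h) (s := r / (r + s)) (by positivity)
    ((div_le_one h0).2 (by linarith))
  have h2 := increment_le_mul hc y ((r + s) • h) (s := s / (r + s)) (by positivity)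
    ((div_le_one h0).2 (by linarith))
  rw [smul_smul, div_mul_cancel₀ _ h0.ne'] at h1 h2
  have e : y + s • h + r • h = y + (r + s) • h := by rw [add_smul]; abel
  rw [e]
  have h3 : r / (r + s) + s / (r + s) = 1 := by rw [← add_div, div_self h0.ne']
  have h4 : (r / (r + s)) * (ψ (y + (r + s) • h) - ψ y) + (s / (r + s)) *
      (ψ (y + (r + s) • h) - ψ y) = ψ (y + (r + s) • h) - ψ y := by
    rw [← add_mul, h3, one_mul]
  linarith

/-- The likelihood functional in terms of the two error probabilities of the likelihood-ratio test
with threshold `c`. -/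
lemma integral_min_exp_eq (hψ : ψ ∈ potentials n) (h : Vec n) (c : ℝ) :
    ∫ x, min (Real.exp (c - (ψ (x + h) - ψ x))) 1 ∂(noiseLaw ψ)
      = (noiseLaw ψ).real {x | ψ (x + h) - ψ x ≤ c}
        + Real.exp c * (noiseLaw ψ).real {x | x - h ∈ {x | c < ψ (x + h) - ψ x}} := by
  have := isProbabilityMeasure_noiseLaw hψ
  have hcont := continuous_potential hψ
  have hm1 : MeasurableSet {x | ψ (x + h) - ψ x ≤ c} :=
    measurableSet_le (by fun_prop) measurable_const
  have hm2 : MeasurableSet {x | c < ψ (x + h) - ψ x} :=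
    measurableSet_lt measurable_const (by fun_prop)
  have hi1 : Integrable ({x | ψ (x + h) - ψ x ≤ c}.indicator (1 : Vec n → ℝ)) (noiseLaw ψ) :=
    (integrable_const (1 : ℝ)).indicator hm1
  rw [noiseLaw_real_sub_mem hψ h hm2, ← integral_const_mul, ← integral_indicator_one hm1,
    ← integral_add hi1
      (((integrable_exp_neg_increment hψ h).1.indicator hm2).const_mul _)]
  refine integral_congr_ae (Eventually.of_forall fun x => ?_)
  by_cases hx : ψ (x + h) - ψ x ≤ c
  · simp only
    rw [Set.indicator_of_mem (show x ∈ {x | ψ (x + h) - ψ x ≤ c} from hx),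
      Set.indicator_of_notMem (show x ∉ {x | c < ψ (x + h) - ψ x} from not_lt.2 hx), min_eq_right]
    · simp
    · rw [Real.one_le_exp_iff]; linarith
  · simp only
    rw [Set.indicator_of_notMem (show x ∉ {x | ψ (x + h) - ψ x ≤ c} from hx),
      Set.indicator_of_mem (show x ∈ {x | c < ψ (x + h) - ψ x} from not_le.1 hx), min_eq_left,
      ← Real.exp_add, zero_add]
    · congr 1
    · rw [Real.exp_le_one_iff]; linarith

/-- The likelihood-ratio region is optimal for testing the noise against a translate. -/
lemma real_sub_exp_mul_le (hψ : ψ ∈ potentials n) (h : Vec n) (c : ℝ) {A : Set (Vec n)}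
    (hA : MeasurableSet A) :
    (noiseLaw ψ).real A - Real.exp c * (noiseLaw ψ).real {x | x - h ∈ A}
      ≤ (noiseLaw ψ).real {x | c < ψ (x + h) - ψ x}
        - Real.exp c * (noiseLaw ψ).real {x | x - h ∈ {x | c < ψ (x + h) - ψ x}} := by
  have := isProbabilityMeasure_noiseLaw hψ
  have hcont := continuous_potential hψ
  have hm2 : MeasurableSet {x | c < ψ (x + h) - ψ x} :=
    measurableSet_lt measurable_const (by fun_prop)
  have hi := (integrable_exp_neg_increment hψ h).1
  have hI : ∀ {B : Set (Vec n)}, MeasurableSet B → Integrable (fun x => B.indicator 1 x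
      - Real.exp c * B.indicator (fun x => Real.exp (-(ψ (x + h) - ψ x))) x) (noiseLaw ψ) := fun hB =>
    ((integrable_const (1 : ℝ)).indicator hB).sub ((hi.indicator hB).const_mul _)
  have key : ∀ {B : Set (Vec n)}, MeasurableSet B →
      (noiseLaw ψ).real B - Real.exp c * (noiseLaw ψ).real {x | x - h ∈ B}
        = ∫ x, (B.indicator 1 x - Real.exp c *
          B.indicator (fun x => Real.exp (-(ψ (x + h) - ψ x))) x) ∂(noiseLaw ψ) := by
    intro B hB
    have hi1 : Integrable (B.indicator (1 : Vec n → ℝ)) (noiseLaw ψ) :=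
      (integrable_const (1 : ℝ)).indicator hB
    rw [noiseLaw_real_sub_mem hψ h hB, ← integral_const_mul, ← integral_indicator_one hB,
      ← integral_sub hi1 ((hi.indicator hB).const_mul _)]
  rw [key hA, key hm2]
  refine integral_mono (hI hA) (hI hm2) fun x => ?_
  have he : Real.exp c * Real.exp (-(ψ (x + h) - ψ x)) = Real.exp (c - (ψ (x + h) - ψ x)) := by
    rw [← Real.exp_add]; congr 1
  by_cases hx : c < ψ (x + h) - ψ x
  · have h0 : Real.exp (c - (ψ (x + h) - ψ x)) ≤ 1 := Real.exp_le_one_iff.2 (by linarith)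
    simp only [Set.indicator_of_mem (show x ∈ {x | c < ψ (x + h) - ψ x} from hx), he,
      Pi.one_apply]
    by_cases hxA : x ∈ A
    · simp only [Set.indicator_of_mem hxA, he, Pi.one_apply, le_refl]
    · simp only [Set.indicator_of_notMem hxA, mul_zero, sub_zero]; linarith
  · have h0 : 1 ≤ Real.exp (c - (ψ (x + h) - ψ x)) := Real.one_le_exp_iff.2 (by linarith)
    simp only [Set.indicator_of_notMem (show x ∉ {x | c < ψ (x + h) - ψ x} from hx), mul_zero,
      sub_zero]
    by_cases hxA : x ∈ A
    · simp only [Set.indicator_of_mem hxA, he, Pi.one_apply]; linarith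
    · simp only [Set.indicator_of_notMem hxA, mul_zero, sub_zero, le_refl]

/-- Among the translates by `r • h` with `0 ≤ r ≤ 1`, the one by `h` is the easiest to tell from the
noise: the likelihood-ratio regions are increasing in the direction `h`. -/
lemma real_le_exp_mul_add (hψ : ψ ∈ potentials n) (h : Vec n) (c : ℝ) {r : ℝ} (hr0 : 0 ≤ r)
    (hr1 : r ≤ 1) {A : Set (Vec n)} (hA : MeasurableSet A) :
    (noiseLaw ψ).real A ≤ Real.exp c * (noiseLaw ψ).real {x | x - r • h ∈ A}
      + (1 - ∫ x, min (Real.exp (c - (ψ (x + h) - ψ x))) 1 ∂(noiseLaw ψ)) := by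
  have := isProbabilityMeasure_noiseLaw hψ
  have hcont := continuous_potential hψ
  have h1 := real_sub_exp_mul_le hψ (r • h) c hA
  have hmr : MeasurableSet {x | c < ψ (x + r • h) - ψ x} :=
    measurableSet_lt measurable_const (by fun_prop)
  have h2 := real_sub_exp_mul_le hψ h c hmr
  have h3 : (noiseLaw ψ).real {x | x - h ∈ {x | c < ψ (x + r • h) - ψ x}}
      ≤ (noiseLaw ψ).real {x | x - r • h ∈ {x | c < ψ (x + r • h) - ψ x}} := by
    refine measureReal_mono fun x hx => ?_
    have h4 := increment_le_increment_add hψ.1 (x - h) h hr0 (sub_nonneg.2 hr1)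
    have e : x - h + (1 - r) • h = x - r • h := by rw [sub_smul, one_smul]; abel
    rw [e] at h4
    exact lt_of_lt_of_le hx h4
  have h5 : (noiseLaw ψ).real {x | c < ψ (x + h) - ψ x}
      = 1 - (noiseLaw ψ).real {x | ψ (x + h) - ψ x ≤ c} := by
    rw [← probReal_compl_eq_one_sub (measurableSet_le (by fun_prop) measurable_const)]
    congr 1; ext x; simp only [Set.mem_ofPred_eq, Set.mem_compl_iff, not_le]
  rw [integral_min_exp_eq hψ]
  have h6 := mul_le_mul_of_nonneg_left h3 (Real.exp_pos c).le
  linarith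

/-- The likelihood functional depends continuously on the distribution function of the
log-likelihood ratio. -/
lemma abs_integral_min_exp_sub_le {Ω : Type*} [MeasurableSpace Ω] {P : Measure Ω}
    [IsProbabilityMeasure P] {L : Ω → ℝ} (hL : Measurable L) {μ δ : ℝ} (hμ : 0 < μ)
    (h : ∀ c, |P.real {x | L x ≤ c} - incrCdf (μ ^ 2) c| ≤ δ) (z : ℝ) :
    |∫ x, min (Real.exp (μ * z - μ ^ 2 / 2 - L x)) 1 ∂P
      - (stdCdf (z - μ) + Real.exp (μ * z - μ ^ 2 / 2) * (1 - stdCdf z))| ≤ δ := by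
  set c := μ * z - μ ^ 2 / 2 with hc
  -- Realize `L` and its normal limit on one probability space.
  set f : Ω × ℝ → ℝ := fun y => 2 * (L y.1 - c) with hf
  set g : Ω × ℝ → ℝ := fun y => 2 * (μ * y.2 + μ ^ 2 / 2 - c) with hg
  have hfm : Measurable f := by fun_prop
  have hgm : Measurable g := by fun_prop
  have hks : ∀ s, |(P.prod (gaussianReal 0 1)).real {y | f y ≤ s}
      - (P.prod (gaussianReal 0 1)).real {y | g y ≤ s}| ≤ δ := by
    intro s
    have e1 : (P.prod (gaussianReal 0 1)).real {y | f y ≤ s} = P.real {x | L x ≤ s / 2 + c} := by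
      have hm : MeasurableSet {x | L x ≤ s / 2 + c} := measurableSet_le hL measurable_const
      rw [← measurePreserving_fst (μ := P) (ν := gaussianReal 0 1) |>.measureReal_preimage
        hm.nullMeasurableSet]
      congr 1; ext y
      simp only [hf, Set.mem_ofPred_eq, Set.mem_preimage]
      constructor <;> intro h <;> linarith
    have e2 : (P.prod (gaussianReal 0 1)).real {y | g y ≤ s} = incrCdf (μ ^ 2) (s / 2 + c) := by
      rw [incrCdf_eq hμ, stdCdf, ← measurePreserving_snd (μ := P) (ν := gaussianReal 0 1)
        |>.measureReal_preimage measurableSet_Iic.nullMeasurableSet]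
      congr 1; ext y
      simp only [hg, Set.mem_ofPred_eq, Set.mem_preimage, Set.mem_Iic]
      rw [le_div_iff₀ hμ]
      constructor <;> intro h <;> linarith
    rw [e1, e2]
    exact h _
  have i1 := integral_min_exp_le_of_abs_real_le_sub_le hfm hgm zero_le_one hks
  have i2 := integral_min_exp_le_of_abs_real_le_sub_le hgm hfm zero_le_one
    (fun s => by rw [abs_sub_comm]; exact hks s)
  have e1 : ∫ y, min (Real.exp (-f y / 2)) 1 ∂(P.prod (gaussianReal 0 1))
      = ∫ x, min (Real.exp (c - L x)) 1 ∂P := by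
    have := integral_fun_fst (μ := P) (ν := gaussianReal 0 1)
      (fun x => min (Real.exp (c - L x)) 1)
    simp only [probReal_univ, one_smul] at this
    rw [← this]
    congr 1; ext y; simp only [hf]; congr 2; ring
  have e2 : ∫ y, min (Real.exp (-g y / 2)) 1 ∂(P.prod (gaussianReal 0 1))
      = stdCdf (z - μ) + Real.exp c * (1 - stdCdf z) := by
    rw [hc, ← integral_min_exp_gaussianReal hμ]
    have := integral_fun_snd (μ := P) (ν := gaussianReal 0 1)
      (fun x => min (Real.exp (μ * z - μ ^ 2 / 2 - (μ * x + μ ^ 2 / 2))) 1)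
    simp only [probReal_univ, one_smul] at this
    rw [← this]
    congr 1; ext y; simp only [hg]; congr 2; ring
  rw [e1, e2] at i1 i2
  rw [abs_le]
  constructor <;> linarith

end TranslateTesting

/-! ### Trade-off functions of the noise and its translates -/

section RocBounds

variable {μ : ℝ}

/-- Uniform continuity of translation in total variation. -/
lemma eventually_real_add_mem_le {n : ℕ} {ψ : Vec n → ℝ} (hψ : ψ ∈ potentials n) {κ : ℝ}
    (hκ : 0 < κ) : ∀ᶠ u in 𝓝 (0 : Vec n), ∀ B : Set (Vec n), MeasurableSet B →
      (noiseLaw ψ).real {x | x + u ∈ B} ≤ (noiseLaw ψ).real B + κ := by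
  have := isProbabilityMeasure_noiseLaw hψ
  have hcont := continuous_potential hψ
  obtain ⟨K, hK0, hK⟩ : ∃ K : ℝ, 0 < K ∧ Real.exp K ≤ 1 + κ / 2 :=
    ⟨Real.log (1 + κ / 2), Real.log_pos (by linarith), (Real.exp_log (by linarith)).le⟩
  have hm : ∀ u, MeasurableSet {x | K < ψ (x + u) - ψ x} := fun u =>
    measurableSet_lt measurable_const (by fun_prop)
  have h1 : Tendsto (fun u => (noiseLaw ψ).real {x | K < ψ (x + u) - ψ x}) (𝓝 0) (𝓝 0) := by
    have e : ∀ u, (noiseLaw ψ).real {x | K < ψ (x + u) - ψ x}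
        = ∫ x, {x | K < ψ (x + u) - ψ x}.indicator (1 : Vec n → ℝ) x ∂(noiseLaw ψ) :=
      fun u => (integral_indicator_one (hm u)).symm
    simp_rw [e]
    rw [show (0 : ℝ) = ∫ _x, (0 : ℝ) ∂(noiseLaw ψ) by simp]
    refine tendsto_integral_filter_of_dominated_convergence (fun _ => 1)
      (Eventually.of_forall fun u =>
        (measurable_const.indicator (hm u)).aestronglyMeasurable)
      (Eventually.of_forall fun u => Eventually.of_forall fun x => ?_) (integrable_const _)
      (Eventually.of_forall fun x => ?_)
    · refine (norm_indicator_le_norm_self _ _).trans ?_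
      simp
    · have h2 : Tendsto (fun u => ψ (x + u) - ψ x) (𝓝 0) (𝓝 0) := by
        have : Continuous fun u => ψ (x + u) - ψ x := by fun_prop
        simpa using this.tendsto 0
      refine tendsto_const_nhds.congr' ?_
      filter_upwards [h2.eventually_lt_const hK0] with u hu
      rw [Set.indicator_of_notMem (show x ∉ {x | K < ψ (x + u) - ψ x} from not_lt.2 hu.le)]
  filter_upwards [h1.eventually_le_const (show 0 < κ / 2 by linarith)] with u hu B hB
  have h3 := noiseLaw_real_translate_le hψ u hB K
  have h4 : (noiseLaw ψ).real B ≤ 1 := measureReal_le_one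
  nlinarith [measureReal_nonneg (μ := noiseLaw ψ) (s := B)]

lemma exists_stdCdf_eq {y : ℝ} (h0 : 0 < y) (h1 : y < 1) : ∃ z, stdCdf z = y := by
  obtain ⟨a, ha⟩ := (tendsto_stdCdf_atBot.eventually_le_const h0).exists
  obtain ⟨b, hb⟩ := (tendsto_stdCdf_atTop.eventually_const_le h1).exists
  exact mem_range_of_exists_le_of_exists_ge continuous_stdCdf ⟨a, ha⟩ ⟨b, hb⟩

lemma gaussianRoc_one_le (μ : ℝ) : gaussianRoc μ 1 ≤ 0 := by
  have := roc_le_one_sub (P := gaussianReal 0 1) (Q := gaussianReal μ 1) MeasurableSet.univ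
    (α := 1) (by simp)
  rw [gaussianRoc]
  simpa using this

lemma gaussianRoc_le_one (μ : ℝ) {α : ℝ} (hα : 0 ≤ α) : gaussianRoc μ α ≤ 1 := roc_le_one hα

/-- If the log-likelihood ratio of the translate by `h` is nearly normal, then the trade-off
functions of all the translates by `r • h` with `0 ≤ r ≤ 1` are nearly bounded below by the Gaussian
one. -/
lemma gaussianRoc_sub_le_roc {n : ℕ} {ψ : Vec n → ℝ} (hψ : ψ ∈ potentials n) (hμ : 0 < μ) {h : Vec n}
    {δ : ℝ} (hks : ∀ c, |(noiseLaw ψ).real {x | ψ (x + h) - ψ x ≤ c} - incrCdf (μ ^ 2) c| ≤ δ)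
    {r : ℝ} (hr0 : 0 ≤ r) (hr1 : r ≤ 1) {α : ℝ} (hα : α ∈ Set.Icc (0 : ℝ) 1) :
    gaussianRoc μ α - δ ≤ roc ((noiseLaw ψ).map (fun x => x - r • h)) (noiseLaw ψ) α := by
  have := isProbabilityMeasure_noiseLaw hψ
  have hcont := continuous_potential hψ
  have hδ : 0 ≤ δ := (abs_nonneg _).trans (hks 0)
  have hL : Measurable fun x => ψ (x + h) - ψ x := by fun_prop
  refine le_roc hα.1 fun A hA hAα => ?_
  rw [map_measureReal_apply (by fun_prop) hA] at hAα
  have hAα : (noiseLaw ψ).real {x | x - r • h ∈ A} ≤ α := hAα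
  have key : ∀ z, (noiseLaw ψ).real A ≤ 1 - stdCdf (z - μ)
      + Real.exp (μ * z - μ ^ 2 / 2) * ((noiseLaw ψ).real {x | x - r • h ∈ A}
        - (1 - stdCdf z)) + δ := by
    intro z
    have h1 := real_le_exp_mul_add hψ h (μ * z - μ ^ 2 / 2) hr0 hr1 hA
    have h2 := (abs_le.1 (abs_integral_min_exp_sub_le hL hμ hks z)).1
    linarith
  -- At level zero no critical value is finite: let it tend to infinity.
  rcases hα.1.eq_or_lt with h0 | h0
  · have hA0 : (noiseLaw ψ).real {x | x - r • h ∈ A} = 0 :=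
      le_antisymm (hAα.trans h0.symm.le) measureReal_nonneg
    have h1 : (noiseLaw ψ).real A ≤ δ := by
      have ht : Tendsto (fun z => 1 - stdCdf (z - μ) + δ) atTop (𝓝 (1 - 1 + δ)) :=
        ((tendsto_stdCdf_atTop.comp (tendsto_atTop_add_const_right _ (-μ) tendsto_id)).const_sub
          1).add_const δ
      rw [sub_self, zero_add] at ht
      refine ge_of_tendsto ht (Eventually.of_forall fun z => (key z).trans ?_)
      rw [hA0]
      have := mul_nonneg (Real.exp_pos (μ * z - μ ^ 2 / 2)).le (sub_nonneg.2 (stdCdf_le_one z))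
      linarith
    linarith [gaussianRoc_le_one μ hα.1]
  rcases hα.2.eq_or_lt with h1 | h1
  · rw [h1]
    linarith [gaussianRoc_one_le μ, measureReal_le_one (μ := noiseLaw ψ) (s := A)]
  obtain ⟨z, hz⟩ := exists_stdCdf_eq (y := 1 - α) (by linarith) (by linarith)
  have h2 := gaussianRoc_le μ (z := z) (α := α) (by linarith)
  have h3 := key z
  have h4 : Real.exp (μ * z - μ ^ 2 / 2) * ((noiseLaw ψ).real {x | x - r • h ∈ A}
        - (1 - stdCdf z)) ≤ 0 :=
    mul_nonpos_of_nonneg_of_nonpos (Real.exp_pos _).le (by linarith)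
  linarith

/-- If the log-likelihood ratio of the translate by `h` is nearly normal, then at every level some
test, of slightly smaller size, nearly attains the Gaussian trade-off function. The slack `κ` in the
size depends only on the error allowed. -/
lemma exists_test_le (hμ : 0 < μ) {ε : ℝ} (hε : 0 < ε) :
    ∃ δ > 0, ∃ κ > 0, ∀ (n : ℕ) (ψ : Vec n → ℝ), ψ ∈ potentials n → ∀ h : Vec n,
      (∀ c, |(noiseLaw ψ).real {x | ψ (x + h) - ψ x ≤ c} - incrCdf (μ ^ 2) c| ≤ δ) →
      ∀ α ∈ Set.Icc (0 : ℝ) 1, ∃ A : Set (Vec n), MeasurableSet A ∧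
        (A = ∅ ∨ (noiseLaw ψ).real {x | x - h ∈ A} + κ ≤ α) ∧
        1 - (noiseLaw ψ).real A ≤ gaussianRoc μ α + ε := by
  obtain ⟨K, hK0, hKb, hKt⟩ : ∃ K : ℝ, 0 < K ∧ stdCdf (-K - μ) ≤ ε / 4 ∧
      1 - ε ≤ stdCdf (K - μ) := by
    have t1 : Tendsto (fun K : ℝ => stdCdf (-K - μ)) atTop (𝓝 0) :=
      tendsto_stdCdf_atBot.comp (tendsto_atBot_add_const_right _ (-μ) tendsto_neg_atTop_atBot)
    have t2 : Tendsto (fun K : ℝ => stdCdf (K - μ)) atTop (𝓝 1) :=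
      tendsto_stdCdf_atTop.comp (tendsto_atTop_add_const_right _ (-μ) tendsto_id)
    obtain ⟨K, h1, h2, h3⟩ := ((eventually_gt_atTop 0).and ((t1.eventually_le_const
      (show 0 < ε / 4 by linarith)).and (t2.eventually_const_le
      (show 1 - ε < 1 by linarith)))).exists
    exact ⟨K, h1, h2, h3⟩
  -- By compactness, `stdCdf` increases by a definite amount over intervals of length `ε / 4`.
  obtain ⟨w, hw, hwmin⟩ := isCompact_Icc.exists_isMinOn (Set.nonempty_Icc.2 (by linarith : -K ≤ K))
    (f := fun z => stdCdf (z + ε / 4) - stdCdf z)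
    (((continuous_stdCdf.comp (continuous_add_const _)).sub continuous_stdCdf).continuousOn)
  set g := stdCdf (w + ε / 4) - stdCdf w with hg
  have hg0 : 0 < g := sub_pos.2 (stdCdf_strictMono (by linarith))
  set b := Real.exp (-(μ * K) - μ ^ 2 / 2) with hb
  have hb0 : 0 < b := Real.exp_pos _
  refine ⟨min (ε / 4) (b * g / 4), by positivity, g / 2, by positivity, ?_⟩
  intro n ψ hψ h hks α hα
  set δ := min (ε / 4) (b * g / 4) with hδ
  have hδ1 : δ ≤ ε / 4 := min_le_left _ _
  have hδ2 : δ ≤ b * g / 4 := min_le_right _ _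
  have := isProbabilityMeasure_noiseLaw hψ
  have hcont := continuous_potential hψ
  have hL : Measurable fun x => ψ (x + h) - ψ x := by fun_prop
  -- The likelihood-ratio test with the slightly raised critical value `z + ε / 4` has size below `α`.
  have htest : ∀ z ∈ Set.Icc (-K) K, 1 - stdCdf z ≤ α → stdCdf (z - μ) ≤ gaussianRoc μ α + ε / 4 →
      ∃ A : Set (Vec n), MeasurableSet A ∧
        (A = ∅ ∨ (noiseLaw ψ).real {x | x - h ∈ A} + g / 2 ≤ α) ∧
        1 - (noiseLaw ψ).real A ≤ gaussianRoc μ α + ε := by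
    intro z hz hzα hzG
    set y := z + ε / 4 with hy
    set c := μ * y - μ ^ 2 / 2 with hc
    have hm : MeasurableSet {x | c < ψ (x + h) - ψ x} := measurableSet_lt measurable_const hL
    refine ⟨{x | c < ψ (x + h) - ψ x}, hm, Or.inr ?_, ?_⟩
    · have h1 := (abs_le.1 (abs_integral_min_exp_sub_le hL hμ hks y)).2
      rw [← hc, integral_min_exp_eq hψ] at h1
      have h2 := (abs_le.1 (hks c)).1
      rw [incrCdf_eq hμ, show (c - μ ^ 2 / 2) / μ = y - μ by rw [hc]; field_simp; ring] at h2
      have h3 : g ≤ stdCdf y - stdCdf z := hwmin hz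
      have h4 : b ≤ Real.exp c := by
        refine Real.exp_le_exp.2 ?_
        rw [hc, hy]
        nlinarith [hz.1]
      set q := (noiseLaw ψ).real {x | x - h ∈ {x | c < ψ (x + h) - ψ x}}
      have h5 : Real.exp c * (q - (1 - stdCdf y)) ≤ Real.exp c * (g / 2) := by
        nlinarith
      have h6 := le_of_mul_le_mul_left h5 (Real.exp_pos c)
      linarith
    · rw [← probReal_compl_eq_one_sub hm]
      have h1 : {x | c < ψ (x + h) - ψ x}ᶜ = {x | ψ (x + h) - ψ x ≤ c} := by
        ext x; simp only [Set.mem_ofPred_eq, Set.mem_compl_iff, not_lt]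
      have h2 := (abs_le.1 (hks c)).2
      rw [incrCdf_eq hμ, show (c - μ ^ 2 / 2) / μ = y - μ by rw [hc]; field_simp; ring] at h2
      have h3 := (abs_le.1 (abs_stdCdf_sub_le (y - μ) (z - μ))).2
      rw [show y - μ - (z - μ) = ε / 4 by rw [hy]; ring, abs_of_pos (by linarith)] at h3
      rw [h1]
      linarith
  -- At very small levels the trivial test is good enough; at very large ones, `z = -K` is.
  rcases lt_or_ge α (1 - stdCdf K) with h1 | h1
  · refine ⟨∅, MeasurableSet.empty, Or.inl rfl, ?_⟩
    have := le_gaussianRoc hμ.le hα.1 h1.le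
    simp only [measureReal_empty, sub_zero]
    linarith
  rcases lt_or_ge (1 - stdCdf (-K)) α with h2 | h2
  · refine htest (-K) ⟨le_rfl, by linarith⟩ h2.le ?_
    have : 0 ≤ gaussianRoc μ α := roc_nonneg hα.1
    linarith
  · obtain ⟨z, hz, hzα⟩ : ∃ z ∈ Set.Icc (-K) K, stdCdf z = 1 - α :=
      intermediate_value_Icc (by linarith) continuous_stdCdf.continuousOn
        ⟨by linarith, by linarith⟩
    refine htest z hz (by linarith) ?_
    have := le_gaussianRoc hμ.le hα.1 (show α ≤ 1 - stdCdf z by linarith)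
    linarith

/-- A finite set of thresholds suffices to control the distance to the limiting distribution
function uniformly. -/
lemma exists_finset_forall_abs_sub_le (hμ : 0 < μ) {δ : ℝ} (hδ : 0 < δ) :
    ∃ S : Finset ℝ, ∀ F : ℝ → ℝ, Monotone F → (∀ c, 0 ≤ F c) → (∀ c, F c ≤ 1) →
      (∀ c ∈ S, |F c - incrCdf (μ ^ 2) c| ≤ δ) → ∀ c, |F c - incrCdf (μ ^ 2) c| ≤ 2 * δ := by
  set H : ℝ → ℝ := fun c => stdCdf ((c - μ ^ 2 / 2) / μ) with hH
  have hHe : ∀ c, incrCdf (μ ^ 2) c = H c := incrCdf_eq hμ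
  simp_rw [hHe]
  have hHm : Monotone H := fun x y hxy => stdCdf_mono (by gcongr)
  have hH0 : ∀ c, 0 ≤ H c := fun c => stdCdf_nonneg _
  have hH1 : ∀ c, H c ≤ 1 := fun c => stdCdf_le_one _
  have hHl : ∀ x y, x ≤ y → H y - H x ≤ (y - x) / μ := by
    intro x y hxy
    have := (abs_le.1 (abs_stdCdf_sub_le ((y - μ ^ 2 / 2) / μ) ((x - μ ^ 2 / 2) / μ))).2
    rw [← sub_div, sub_sub_sub_cancel_right, abs_of_nonneg
      (div_nonneg (by linarith) hμ.le)] at this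
    exact this
  have hHb : Tendsto H atBot (𝓝 0) := tendsto_stdCdf_atBot.comp
    ((tendsto_atBot_add_const_right _ (-(μ ^ 2 / 2)) tendsto_id).atBot_div_const hμ)
  have hHt : Tendsto H atTop (𝓝 1) := tendsto_stdCdf_atTop.comp
    ((tendsto_atTop_add_const_right _ (-(μ ^ 2 / 2)) tendsto_id).atTop_div_const hμ)
  obtain ⟨a, ha⟩ := (hHb.eventually_le_const hδ).exists
  obtain ⟨b, hb⟩ := (hHt.eventually_const_le (show 1 - δ < 1 by linarith)).exists
  have hs : 0 < δ * μ := by positivity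
  obtain ⟨m, hm⟩ := exists_nat_ge ((b - a) / (δ * μ))
  rw [div_le_iff₀ hs] at hm
  refine ⟨(Finset.range (m + 1)).image fun i : ℕ => a + i * (δ * μ), ?_⟩
  intro F hFm hF0 hF1 hF c
  have hgrid : ∀ i : ℕ, i ≤ m → |F (a + i * (δ * μ)) - H (a + i * (δ * μ))| ≤ δ := fun i hi =>
    hF _ (Finset.mem_image.2 ⟨i, Finset.mem_range.2 (by omega), rfl⟩)
  rcases lt_or_ge c a with h1 | h1
  · have h2 := (abs_le.1 (hgrid 0 (Nat.zero_le _))).2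
    simp only [Nat.cast_zero, zero_mul, add_zero] at h2
    have h3 := hFm h1.le
    have h4 := hHm h1.le
    rw [abs_le]
    constructor <;> linarith [hF0 c, hH0 c]
  rcases le_or_gt (a + m * (δ * μ)) c with h2 | h2
  · have h3 := (abs_le.1 (hgrid m le_rfl)).1
    have h4 := hFm h2
    have h5 : H b ≤ H (a + m * (δ * μ)) := hHm (by linarith)
    have h6 := hHm h2
    rw [abs_le]
    constructor <;> linarith [hF1 c, hH1 c]
  set i := ⌊(c - a) / (δ * μ)⌋₊ with hi
  have hi1 : a + i * (δ * μ) ≤ c := by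
    have := Nat.floor_le (div_nonneg (sub_nonneg.2 h1) hs.le)
    rw [← hi, le_div_iff₀ hs] at this
    linarith
  have hi2 : c < a + (i + 1 : ℕ) * (δ * μ) := by
    have := Nat.lt_floor_add_one ((c - a) / (δ * μ))
    rw [← hi, div_lt_iff₀ hs] at this
    push_cast
    linarith
  have him : i + 1 ≤ m := by
    have : (i : ℝ) * (δ * μ) < m * (δ * μ) := by linarith
    exact_mod_cast lt_of_mul_lt_mul_right this hs.le
  have g1 := abs_le.1 (hgrid i (by omega))
  have g2 := abs_le.1 (hgrid (i + 1) him)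
  have k1 := hFm hi1
  have k2 := hFm hi2.le
  have l1 := hHl _ _ hi1
  have l2 := hHl _ _ hi2.le
  have l3 : H (a + (i + 1 : ℕ) * (δ * μ)) - H (a + i * (δ * μ)) ≤ δ := by
    refine (hHl _ _ (hi1.trans hi2.le)).trans (le_of_eq ?_)
    push_cast; field_simp; ring
  have l4 := hHm hi1
  have l5 := hHm hi2.le
  rw [abs_le]
  constructor <;> linarith [g1.1, g1.2, g2.1, g2.2]

end RocBounds

/-! ### Rescaled potentials -/

section Rescaling

variable {n : ℕ} {φ : Vec n → ℝ}

/-- Rescaling the potential rescales the noise. -/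
lemma noiseLaw_comp_smul (φ : Vec n → ℝ) {s : ℝ} (hs : s ≠ 0) :
    noiseLaw (fun x => φ (s⁻¹ • x)) = (noiseLaw φ).map (fun x => s • x) := by
  have hZ : ∫ x, Real.exp (-φ (s⁻¹ • x)) = |s ^ n| * ∫ x, Real.exp (-φ x) := by
    have := Measure.integral_comp_inv_smul (volume : Measure (Vec n)) (fun x => Real.exp (-φ x)) s
    simpa using this
  ext B hB
  have hB' : MeasurableSet ((fun x : Vec n => s • x) ⁻¹' B) := (measurable_const_smul s) hB
  rw [Measure.map_apply (measurable_const_smul s) hB, noiseLaw, noiseLaw,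
    tilted_apply_eq_ofReal_integral' _ hB, tilted_apply_eq_ofReal_integral' _ hB',
    integral_div, integral_div, hZ]
  congr 1
  have hB2 : ∫ x in B, Real.exp (-φ (s⁻¹ • x))
      = |s ^ n| * ∫ x in (fun x : Vec n => s • x) ⁻¹' B, Real.exp (-φ x) := by
    have := Measure.integral_comp_inv_smul (volume : Measure (Vec n))
      (((fun x : Vec n => s • x) ⁻¹' B).indicator fun x => Real.exp (-φ x)) s
    rw [integral_indicator hB', finrank_euclideanSpace_fin, smul_eq_mul] at this
    rw [← this, ← integral_indicator hB]
    refine integral_congr_ae (Eventually.of_forall fun x => ?_)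
    have hx : s⁻¹ • x ∈ (fun x : Vec n => s • x) ⁻¹' B ↔ x ∈ B := by
      rw [Set.mem_preimage, smul_inv_smul₀ hs]
    by_cases hxB : x ∈ B
    · simp only [Set.indicator_of_mem hxB, Set.indicator_of_mem (hx.2 hxB)]
    · simp only [Set.indicator_of_notMem hxB, Set.indicator_of_notMem (fun h => hxB (hx.1 h))]
  rw [hB2]
  have : |s ^ n| ≠ 0 := abs_ne_zero.2 (pow_ne_zero _ hs)
  rw [mul_div_mul_left _ _ this]

lemma gradient_comp_smul (φ : Vec n → ℝ) (c : ℝ) (x : Vec n) :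
    gradient (fun y => φ (c • y)) x = c • gradient φ (c • x) := by
  rw [gradient, gradient, fderiv_comp_smul, map_smulₛₗ]
  simp

lemma comp_smul_mem_potentials (hφ : φ ∈ potentials n) {s : ℝ} (hs : s ≠ 0) :
    (fun x => φ (s⁻¹ • x)) ∈ potentials n := by
  obtain ⟨h1, h2, h3, h4, h5⟩ := hφ
  have hm : Measurable (fun x : Vec n => s • x) := measurable_const_smul s
  refine ⟨?_, fun x => ?_, ?_, ?_, ?_⟩
  · have := h1.comp_linearMap (LinearMap.lsmul ℝ (Vec n) s⁻¹)
    rwa [Set.preimage_univ] at this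
  · simp only [smul_neg, h2]
  · exact h3.comp_smul (inv_ne_zero hs)
  · rw [noiseLaw_comp_smul φ hs, integrable_map_measure
      (measurable_norm.pow_const 2).aestronglyMeasurable hm.aemeasurable]
    refine (h4.const_mul (s ^ 2)).congr (Eventually.of_forall fun x => ?_)
    simp only [Function.comp_apply, norm_smul, mul_pow, Real.norm_eq_abs, sq_abs]
  · rw [noiseLaw_comp_smul φ hs, integrable_map_measure
      (measurable_gradient.norm.pow_const 2).aestronglyMeasurable hm.aemeasurable]
    refine (h5.const_mul (s⁻¹ ^ 2)).congr (Eventually.of_forall fun x => ?_)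
    simp only [Function.comp_apply, gradient_comp_smul, norm_smul, mul_pow, Real.norm_eq_abs, sq_abs,
      inv_smul_smul₀ hs]

lemma fisher_comp_smul (φ : Vec n → ℝ) {s : ℝ} (hs : s ≠ 0) :
    fisher (fun x => φ (s⁻¹ • x)) = (s ^ 2)⁻¹ • fisher φ := by
  ext i j
  have hm : Measurable (fun x : Vec n => s • x) := measurable_const_smul s
  have hg : Measurable fun x => gradient (fun y => φ (s⁻¹ • y)) x := measurable_gradient
  simp only [fisher, Matrix.of_apply, Matrix.smul_apply, smul_eq_mul]
  rw [noiseLaw_comp_smul φ hs, integral_map hm.aemeasurable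
    (Measurable.aestronglyMeasurable (by fun_prop)), ← integral_const_mul]
  refine integral_congr_ae (Eventually.of_forall fun x => ?_)
  simp only [gradient_comp_smul, inv_smul_smul₀ hs, PiLp.smul_apply, smul_eq_mul]
  field_simp

lemma opNorm_zero_sub_one (hn : 0 < n) : opNorm (0 - 1 : Matrix (Fin n) (Fin n) ℝ) = 1 := by
  have : Nonempty (Fin n) := ⟨⟨0, hn⟩⟩
  have : Nontrivial (Vec n) := inferInstance
  rw [opNorm, zero_sub, map_neg, norm_neg, map_one, norm_one]

/-- A sequence satisfying the hypotheses becomes regular after rescaling and dropping the finitely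
many dimensions in which the Fisher information may be degenerate. -/
lemma exists_asympRegular {φ : (n : ℕ) → Vec n → ℝ} (hφ : ∀ n, φ n ∈ potentials n)
    (hD1 : CondD1 fun n => rescaled (φ n)) (hD2 : CondD2 fun n => rescaled (φ n))
    (hI : AsympIsotropic φ) :
    ∃ N, (∀ n ≥ N, 0 < opNorm (fisher (φ n))) ∧
      AsympRegular (fun k => k + N) (fun k => rescaled (φ (k + N))) := by
  obtain ⟨N, hN⟩ : ∃ N, ∀ n ≥ N, 0 < n ∧ 0 < opNorm (fisher (φ n)) := by
    have h1 := (hI.eventually_lt_const one_pos).and (eventually_gt_atTop 0)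
    obtain ⟨N, hN⟩ := eventually_atTop.1 h1
    refine ⟨N, fun n hn => ⟨(hN n hn).2, (opNorm_nonneg _).lt_of_ne fun h0 => ?_⟩⟩
    have h2 := (hN n hn).1
    -- If the Fisher information vanished, the junk value `0⁻¹ = 0` would leave the identity.
    rw [← h0, _root_.inv_zero, zero_smul, opNorm_zero_sub_one (hN n hn).2] at h2
    exact lt_irrefl _ h2
  have hadd : Tendsto (fun k => k + N) atTop atTop := tendsto_add_atTop_nat N
  have hs : ∀ k, Real.sqrt (opNorm (fisher (φ (k + N)))) ≠ 0 := fun k =>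
    (Real.sqrt_pos.2 (hN (k + N) (Nat.le_add_left _ _)).2).ne'
  refine ⟨N, fun n hn => (hN n hn).2, ?_, fun k => (hN _ (Nat.le_add_left _ _)).1, hadd, ?_, ?_, ?_⟩
  · exact fun k => comp_smul_mem_potentials (hφ (k + N)) (hs k)
  · obtain ⟨a, ha, h⟩ := hD1
    intro b hb
    filter_upwards [hadd.eventually (ha.eventually_le_const hb)] with k hk
    have := isProbabilityMeasure_sphereUnif (hN (k + N) (Nat.le_add_left _ _)).1
    refine le_trans (by linarith) ((h (k + N)).trans (measureReal_mono fun v hv => ?_))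
    exact le_trans hv hk
  · intro ε hε
    refine ((hD2 ε hε).comp hadd).congr fun k => ?_
    simp only [Function.comp_apply]
    congr 1
    ext x
    simp only [Set.mem_ofPred_eq, score, norm_smul, norm_inv, Real.norm_eq_abs,
      abs_of_nonneg (Real.sqrt_nonneg _)]
    rw [div_eq_inv_mul]
  · refine (hI.comp hadd).congr fun k => ?_
    simp only [Function.comp_apply]
    have h1 := fisher_comp_smul (φ (k + N)) (hs k)
    rw [Real.sq_sqrt (opNorm_nonneg _)] at h1
    rw [← h1]
    rfl

end Rescaling

/-! ### Trade-off functions of the mechanism -/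

section Mechanism

variable {n : ℕ}

/-- Trade-off functions are invariant under bimeasurable changes of variables. -/
lemma roc_map_measurableEquiv {Ω Ω' : Type*} [MeasurableSpace Ω] [MeasurableSpace Ω']
    (P Q : Measure Ω) (e : Ω ≃ᵐ Ω') (α : ℝ) : roc (P.map e) (Q.map e) α = roc P Q α := by
  rw [roc, roc]
  congr 1
  ext β
  constructor
  · rintro ⟨A, hA, h1, h2⟩
    rw [map_measureReal_apply e.measurable hA] at h1 h2
    exact ⟨e ⁻¹' A, e.measurable hA, h1, h2⟩
  · rintro ⟨A, hA, h1, h2⟩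
    have h3 : e ⁻¹' (e.symm ⁻¹' A) = A := by ext x; simp
    have h4 : MeasurableSet (e.symm ⁻¹' A) := e.symm.measurable hA
    refine ⟨e.symm ⁻¹' A, h4, ?_, ?_⟩ <;> rw [map_measureReal_apply e.measurable h4, h3]
    exacts [h1, h2]

/-- The affine change of variables that turns the second output into pure noise. -/
lemma roc_mechanism {𝒳 : Type*} {k : ℕ} (f : (Fin k → 𝒳) → Vec n) {φ : Vec n → ℝ} {μ : ℝ} (hμ : 0 < μ)
    (hφ : 0 < opNorm (fisher φ)) (D D' : Fin k → 𝒳) (α : ℝ) :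
    roc (mechanism f (noiseScale μ φ) φ D) (mechanism f (noiseScale μ φ) φ D') α
      = roc ((noiseLaw (rescaled φ)).map fun x => x - μ • (f D' - f D)) (noiseLaw (rescaled φ)) α := by
  have hs : Real.sqrt (opNorm (fisher φ)) ≠ 0 := (Real.sqrt_pos.2 hφ).ne'
  let e : Vec n ≃ᵐ Vec n :=
    ((Homeomorph.smulOfNeZero μ⁻¹ (inv_ne_zero hμ.ne')).trans
      (Homeomorph.addLeft (f D'))).toMeasurableEquiv
  have he : (e : Vec n → Vec n) = fun x => f D' + μ⁻¹ • x := rfl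
  have hr : noiseLaw (rescaled φ) = _ := noiseLaw_comp_smul φ hs
  rw [← roc_map_measurableEquiv ((noiseLaw (rescaled φ)).map _) (noiseLaw (rescaled φ)) e, he, hr, Measure.map_map (by fun_prop) (by fun_prop),
    Measure.map_map (by fun_prop) (by fun_prop), Measure.map_map (by fun_prop) (by fun_prop),
    mechanism, mechanism]
  congr 2
  · funext x
    simp only [Function.comp_apply, noiseScale, smul_sub, smul_smul, inv_mul_cancel₀ hμ.ne', one_smul]
    abel
  · funext x
    simp only [Function.comp_apply, noiseScale, smul_smul]

/-- Uniform closeness of the log-likelihood ratios to their normal limit in the directions of `E`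
gives both bounds on the trade-off functions of the mechanism. -/
lemma exists_forall_mechanism {μ : ℝ} (hμ : 0 < μ) {ε : ℝ} (hε : 0 < ε) :
    ∃ δ > 0, ∀ (n : ℕ) (φ : Vec n → ℝ), φ ∈ potentials n → 0 < opNorm (fisher φ) →
      ∀ E : Set (Vec n), E ⊆ Metric.sphere 0 1 →
      (∀ θ ∈ E, ∀ c, |(noiseLaw (rescaled φ)).real
        {x | rescaled φ (x + μ • θ) - rescaled φ x ≤ c} - incrCdf (μ ^ 2) c| ≤ δ) →
      ∀ (𝒳 : Type*) (k : ℕ) (f : (Fin k → 𝒳) → Vec n), SensitivityOne f (neighborPairs 𝒳 k) →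
        (∀ p ∈ pairsInDirections f E, ∀ α ∈ Set.Icc (0 : ℝ) 1, gaussianRoc μ α - ε ≤
          roc (mechanism f (noiseScale μ φ) φ p.1) (mechanism f (noiseScale μ φ) φ p.2) α) ∧
        (SensitivityOne f (pairsInDirections f E) → ∀ α ∈ Set.Icc (0 : ℝ) 1,
          |infRoc (mechanism f (noiseScale μ φ) φ) (pairsInDirections f E) α - gaussianRoc μ α|
            ≤ ε) := by
  obtain ⟨δ₀, hδ₀, κ, hκ, htest⟩ := exists_test_le hμ hε
  refine ⟨min δ₀ ε, lt_min hδ₀ hε, ?_⟩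
  intro n φ hφ hφ0 E hE hks 𝒳 k f hf
  have hψ : rescaled φ ∈ potentials n :=
    comp_smul_mem_potentials hφ (Real.sqrt_pos.2 hφ0).ne'
  have := isProbabilityMeasure_noiseLaw hψ
  have hdir : ∀ p ∈ pairsInDirections f E, ∃ θ ∈ E, ∃ r, 0 ≤ r ∧ r ≤ 1 ∧ r = ‖f p.1 - f p.2‖ ∧
      μ • (f p.2 - f p.1) = r • μ • θ := by
    intro p hp
    refine ⟨_, hp.2, ‖f p.1 - f p.2‖, norm_nonneg _, hf.1 ⟨p, hp.1, rfl⟩, rfl, ?_⟩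
    rcases eq_or_ne (f p.2 - f p.1) 0 with h0 | h0
    · simp [h0]
    · rw [norm_sub_rev, smul_comm _ μ, smul_inv_smul₀ (norm_ne_zero_iff.2 h0)]
  have hlow : ∀ p ∈ pairsInDirections f E, ∀ α ∈ Set.Icc (0 : ℝ) 1, gaussianRoc μ α - ε ≤
      roc (mechanism f (noiseScale μ φ) φ p.1) (mechanism f (noiseScale μ φ) φ p.2) α := by
    intro p hp α hα
    obtain ⟨θ, hθ, r, hr0, hr1, -, he⟩ := hdir p hp
    rw [roc_mechanism f hμ hφ0, he]
    have := gaussianRoc_sub_le_roc hψ hμ (hks θ hθ) hr0 hr1 hα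
    linarith [min_le_right δ₀ ε]
  refine ⟨hlow, fun hR α hα => ?_⟩
  have hne : (pairsInDirections f E).Nonempty := hR.nonempty.of_image
  have hbdd : BddBelow ((fun p => roc (mechanism f (noiseScale μ φ) φ p.1)
      (mechanism f (noiseScale μ φ) φ p.2) α) '' pairsInDirections f E) := by
    refine ⟨gaussianRoc μ α - ε, ?_⟩
    rintro _ ⟨p, hp, rfl⟩
    exact hlow p hp α hα
  have h1 : gaussianRoc μ α - ε ≤
      infRoc (mechanism f (noiseScale μ φ) φ) (pairsInDirections f E) α := by
    refine le_csInf (hne.image _) ?_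
    rintro _ ⟨p, hp, rfl⟩
    exact hlow p hp α hα
  -- A pair at distance almost one is almost as easy to tell apart as one at distance one, by continuity
  -- of translations, uniformly in the direction.
  obtain ⟨ρ, hρ, hball⟩ := Metric.eventually_nhds_iff.1 (eventually_real_add_mem_le hψ hκ)
  obtain ⟨_, ⟨p, hp, rfl⟩, hpr, -⟩ := hR.exists_between
    (show 1 - ρ / μ < 1 by linarith [div_pos hρ hμ])
  obtain ⟨θ, hθ, r, hr0, hr1, hr, he⟩ := hdir p hp
  simp only [← hr] at hpr
  obtain ⟨A, hA, hA1, hA2⟩ := htest n _ hψ (μ • θ)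
    (fun c => (hks θ hθ c).trans (min_le_left _ _)) α hα
  have h2 : infRoc (mechanism f (noiseScale μ φ) φ) (pairsInDirections f E) α
      ≤ 1 - (noiseLaw (rescaled φ)).real A := by
    refine (csInf_le hbdd ⟨p, hp, rfl⟩).trans ?_
    simp only
    rw [roc_mechanism f hμ hφ0, he]
    refine roc_le_one_sub hA ?_
    rw [map_measureReal_apply (by fun_prop) hA]
    rcases hA1 with rfl | hA1
    · simpa using hα.1
    have hm : MeasurableSet {x | x - μ • θ ∈ A} := (measurable_sub_const _) hA
    have hdist : dist ((1 - r) • μ • θ) 0 < ρ := by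
      have hθ1 : ‖θ‖ = 1 := by simpa using hE hθ
      rw [dist_zero_right, norm_smul, norm_smul, hθ1, mul_one, Real.norm_eq_abs, Real.norm_eq_abs,
        abs_of_pos hμ, abs_of_nonneg (by linarith), ← lt_div_iff₀ hμ]
      linarith
    refine le_trans (le_of_eq ?_) ((hball hdist _ hm).trans hA1)
    congr 1
    ext x
    simp only [Set.mem_preimage, Set.mem_ofPred_eq]
    rw [show x + (1 - r) • μ • θ - μ • θ = x - r • μ • θ by rw [sub_smul, one_smul]; abel]
  rw [abs_le]
  constructor <;> linarith

end Mechanism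

/-! ### Good directions -/

section Directions

/-- In an asymptotically regular sequence, the log-likelihood ratios are uniformly close to normal
for all directions in a measurable set of nearly full measure. -/
lemma AsympRegular.eventually_exists_uniform_directions {d : ℕ → ℕ} {ψ : (k : ℕ) → Vec (d k) → ℝ}
    (h : AsympRegular d ψ) {μ : ℝ} (hμ : 0 < μ) {δ η : ℝ} (hδ : 0 < δ) (hη : 0 < η) :
    ∀ᶠ k in atTop, ∃ E : Set (Vec (d k)), MeasurableSet E ∧ E ⊆ Metric.sphere 0 1 ∧
      1 - η < (sphereUnif (d k)).real E ∧ ∀ θ ∈ E, ∀ c, |(noiseLaw (ψ k)).real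
        {x | ψ k (x + μ • θ) - ψ k x ≤ c} - incrCdf (μ ^ 2) c| ≤ δ := by
  obtain ⟨S, hS⟩ := exists_finset_forall_abs_sub_le hμ (show 0 < δ / 2 by linarith)
  set η' := η / (4 * (S.card + 1)) with hη'
  have hη0 : 0 < η' := by positivity
  have hev : ∀ᶠ k in atTop, ∀ c ∈ S, (sphereUnif (d k)).real {θ | (noiseLaw (ψ k)).real
      {x | ψ k (x + μ • θ) - ψ k x ≤ c} ≤ incrCdf (μ ^ 2) c - δ / 2} ≤ η' ∧
      (sphereUnif (d k)).real {θ | incrCdf (μ ^ 2) c + δ / 2 ≤ (noiseLaw (ψ k)).real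
      {x | ψ k (x + μ • θ) - ψ k x ≤ c}} ≤ η' :=
    (Filter.eventually_all_finset S).2 fun c _ =>
      (h.eventually_sphere_cdf_ge hμ c (by linarith) hη0).and
        (h.eventually_sphere_cdf_le hμ c (by linarith) hη0)
  filter_upwards [hev] with k hk
  have := isProbabilityMeasure_sphereUnif (h.pos k)
  have hprob := h.isProbabilityMeasure k
  set F : Vec (d k) → ℝ → ℝ := fun θ c =>
    (noiseLaw (ψ k)).real {x | ψ k (x + μ • θ) - ψ k x ≤ c} with hF
  have hFm : ∀ c, Measurable fun θ => F θ c := fun c => measurable_cdf_incr (h.mem k) c μ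
  set B : ℝ → Set (Vec (d k)) := fun c =>
    {θ | F θ c ≤ incrCdf (μ ^ 2) c - δ / 2} ∪ {θ | incrCdf (μ ^ 2) c + δ / 2 ≤ F θ c} with hB
  have hBm : ∀ c, MeasurableSet (B c) := fun c =>
    (measurableSet_le (hFm c) measurable_const).union (measurableSet_le measurable_const (hFm c))
  have hBle : ∀ c ∈ S, (sphereUnif (d k)).real (B c) ≤ 2 * η' := fun c hc =>
    (measureReal_union_le _ _).trans (by linarith [(hk c hc).1, (hk c hc).2])
  set U : Set (Vec (d k)) := ⋃ c ∈ S, B c with hU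
  have hUm : MeasurableSet U := Finset.measurableSet_biUnion S fun c _ => hBm c
  have hUle : (sphereUnif (d k)).real U < η := by
    calc (sphereUnif (d k)).real U ≤ ∑ c ∈ S, (sphereUnif (d k)).real (B c) :=
          measureReal_biUnion_finset_le S B
      _ ≤ S.card • (2 * η') := Finset.sum_le_card_nsmul _ _ _ hBle
      _ ≤ (S.card + 1) * (2 * η') := by rw [nsmul_eq_mul]; gcongr; linarith
      _ = η / 2 := by rw [hη']; field_simp; ring
      _ < η := by linarith
  refine ⟨Metric.sphere 0 1 \ U, Metric.isClosed_sphere.measurableSet.diff hUm, Set.sdiff_subset, ?_,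
    fun θ hθ => ?_⟩
  · have h1 : (sphereUnif (d k)).real (Metric.sphere 0 1 \ U)ᶜ
        ≤ (sphereUnif (d k)).real (Metric.sphere 0 1)ᶜ + (sphereUnif (d k)).real U := by
      refine (measureReal_mono fun x hx => ?_).trans (measureReal_union_le _ _)
      by_cases hxU : x ∈ U
      · exact Or.inr hxU
      · exact Or.inl fun hx' => hx ⟨hx', hxU⟩
    rw [probReal_compl_eq_one_sub (Metric.isClosed_sphere.measurableSet.diff hUm),
      measureReal_def _ (Metric.sphere 0 1)ᶜ, sphereUnif_compl_sphere] at h1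
    simp only [ENNReal.toReal_zero] at h1
    linarith
  · have h2 := hS (F θ) (fun c c' hcc => measureReal_mono fun x hx => le_trans hx hcc)
      (fun c => measureReal_nonneg) (fun c => measureReal_le_one) (fun c hc => ?_)
    · intro c; linarith [h2 c]
    · have h3 : θ ∉ B c := fun h' => hθ.2 (Set.mem_biUnion hc h')
      simp only [hB, Set.mem_union, Set.mem_ofPred_eq, not_or, not_le] at h3
      rw [abs_le]
      constructor <;> linarith [h3.1, h3.2]

end Directions

/-! ### The rate -/

section Rate

/-- If a property that is monotone in the error `ε` eventually holds for every `ε > 0`, then it holds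
along an error sequence tending to zero. -/
lemma exists_pos_tendsto_zero {W : ℕ → ℝ → Prop} (hmono : ∀ n ε ε', ε ≤ ε' → W n ε → W n ε') {b : ℝ}
    (hb : 0 < b) (hWb : ∀ n, W n b) (hev : ∀ ε > 0, ∀ᶠ n in atTop, W n ε) :
    ∃ c : ℕ → ℝ, (∀ n, 0 < c n) ∧ Tendsto c atTop (𝓝 0) ∧ ∀ n, W n (c n) := by
  set S : ℕ → Set ℝ := fun n => {ε | 0 < ε ∧ W n ε} with hS
  have hbdd : ∀ n, BddBelow (S n) := fun n => ⟨0, fun ε h => h.1.le⟩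
  have hne : ∀ n, (S n).Nonempty := fun n => ⟨b, hb, hWb n⟩
  have h0 : ∀ n, 0 ≤ sInf (S n) := fun n => Real.sInf_nonneg fun ε h => h.1.le
  have hpos : ∀ n : ℕ, (0 : ℝ) < 1 / ((n : ℝ) + 1) := fun n => Nat.one_div_pos_of_nat
  refine ⟨fun n => sInf (S n) + 1 / ((n : ℝ) + 1), fun n => by linarith [h0 n, hpos n], ?_,
    fun n => ?_⟩
  · have h1 : Tendsto (fun n => sInf (S n)) atTop (𝓝 0) := by
      rw [tendsto_order]
      refine ⟨fun a ha => Eventually.of_forall fun n => ha.trans_le (h0 n), fun a ha => ?_⟩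
      filter_upwards [hev (a / 2) (by linarith)] with n hn
      exact (csInf_le (hbdd n) ⟨by linarith, hn⟩).trans_lt (by linarith)
    simpa using h1.add (tendsto_one_div_add_atTop_nhds_zero_nat (𝕜 := ℝ))
  · obtain ⟨ε, hε, hlt⟩ := exists_lt_of_csInf_lt (hne n)
      (show sInf (S n) < sInf (S n) + 1 / ((n : ℝ) + 1) by linarith [hpos n])
    exact hmono n ε _ hlt.le hε.2

end Rate

end

end GDP

theorem corollary3p2
    (μ : ℝ) (hμ : 0 < μ)
    (φ : (n : ℕ) → GDP.Vec n → ℝ)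
    (hφ : ∀ n, φ n ∈ GDP.potentials n)
    (hD1 : GDP.CondD1 (fun n => GDP.rescaled (φ n)))
    (hD2 : GDP.CondD2 (fun n => GDP.rescaled (φ n)))
    (hI : GDP.AsympIsotropic φ) :
    ∃ (c : ℕ → ℝ) (E : (n : ℕ) → Set (GDP.Vec n)),
      (∀ n, 0 < c n) ∧ Tendsto c atTop (𝓝 0) ∧
      (∀ n, MeasurableSet (E n) ∧ E n ⊆ Metric.sphere 0 1 ∧
        1 - c n < (GDP.sphereUnif n).real (E n)) ∧
      ∀ (n : ℕ) (𝒳 : Type*) (k : ℕ) (f : (Fin k → 𝒳) → GDP.Vec n),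
        GDP.SensitivityOne f (GDP.neighborPairs 𝒳 k) →
        (∀ p ∈ GDP.pairsInDirections f (E n), ∀ α ∈ Set.Icc (0 : ℝ) 1,
          GDP.gaussianRoc μ α - c n ≤
            GDP.roc (GDP.mechanism f (GDP.noiseScale μ (φ n)) (φ n) p.1)
              (GDP.mechanism f (GDP.noiseScale μ (φ n)) (φ n) p.2) α) ∧
        (GDP.SensitivityOne f (GDP.pairsInDirections f (E n)) →
          ∀ α ∈ Set.Icc (0 : ℝ) 1,
            |GDP.infRoc (GDP.mechanism f (GDP.noiseScale μ (φ n)) (φ n))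
                (GDP.pairsInDirections f (E n)) α - GDP.gaussianRoc μ α| ≤ c n) := by
  obtain ⟨N, hN, hreg⟩ := GDP.exists_asympRegular hφ hD1 hD2 hI
  obtain ⟨c, hc0, hc, hW⟩ := GDP.exists_pos_tendsto_zero (b := 2)
    (W := fun n ε => ∃ E : Set (GDP.Vec n), MeasurableSet E ∧ E ⊆ Metric.sphere 0 1 ∧
      1 - ε < (GDP.sphereUnif n).real E ∧
      ∀ (𝒳 : Type _) (k : ℕ) (f : (Fin k → 𝒳) → GDP.Vec n),
        GDP.SensitivityOne f (GDP.neighborPairs 𝒳 k) →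
        (∀ p ∈ GDP.pairsInDirections f E, ∀ α ∈ Set.Icc (0 : ℝ) 1,
          GDP.gaussianRoc μ α - ε ≤
            GDP.roc (GDP.mechanism f (GDP.noiseScale μ (φ n)) (φ n) p.1)
              (GDP.mechanism f (GDP.noiseScale μ (φ n)) (φ n) p.2) α) ∧
        (GDP.SensitivityOne f (GDP.pairsInDirections f E) →
          ∀ α ∈ Set.Icc (0 : ℝ) 1,
            |GDP.infRoc (GDP.mechanism f (GDP.noiseScale μ (φ n)) (φ n))
                (GDP.pairsInDirections f E) α - GDP.gaussianRoc μ α| ≤ ε))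
    (fun n ε ε' hle ⟨E, h1, h2, h3, h4⟩ => ⟨E, h1, h2, by linarith, fun 𝒳 k f hf =>
      ⟨fun p hp α hα => by linarith [(h4 𝒳 k f hf).1 p hp α hα],
        fun hR α hα => ((h4 𝒳 k f hf).2 hR α hα).trans hle⟩⟩)
    two_pos
    -- With error `2` the empty set of directions will do: it admits no pairs, so both claims are void.
    (fun n => ⟨∅, MeasurableSet.empty, Set.empty_subset _, by simp, fun 𝒳 k f hf =>
      ⟨fun p hp => hp.2.elim, fun hR => by
        obtain ⟨p, hp⟩ := hR.nonempty.of_image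
        exact hp.2.elim⟩⟩)
    (fun ε hε => by
      obtain ⟨δ, hδ, hmech⟩ := GDP.exists_forall_mechanism hμ hε
      have hev := hreg.eventually_exists_uniform_directions hμ hδ hε
      obtain ⟨K, hK⟩ := eventually_atTop.1 hev
      refine eventually_atTop.2 ⟨K + N, fun n hn => ?_⟩
      obtain ⟨k, rfl⟩ : ∃ k, n = k + N := ⟨n - N, by omega⟩
      obtain ⟨E, h1, h2, h3, h4⟩ := hK k (by omega)
      exact ⟨E, h1, h2, h3, hmech (k + N) (φ (k + N)) (hφ _) (hN _ (Nat.le_add_left _ _)) E h2 h4⟩)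
  choose E h1 h2 h3 h4 using hW
  exact ⟨c, E, hc0, hc, fun n => ⟨h1 n, h2 n, h3 n⟩, fun n => h4 n⟩
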